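/- Let $k,n\in\mathbb N$ ($k,n\ge 1$), $0<T<\infty$, $1\le q<\infty$, and $q'=q/(q-1)$ if $q>1$. **Data.** Let $\Phi:(0,\infty)\to[0,\infty)$ be continuous and decreasing with $0<\int_0^\infty\Phi(z)z^{n-1}\,dz<\infty$, and put $\varphi(\tau)=\Phi\big((\tau/V_n)^{1/n}\big)$, $\tau>0$, where $V_n$ is the volume of the unit ball of $\mathbb R^n$. Let $v>0$ be a measurable weight on $(0,\infty)$ with $V(t)=\int_0^t v(\tau)\,d\tau<\infty$ for all $t>0$. Assume that there is $c>0$ such that, if $q=1$, $V(t)/t\le c\,V(s)/s$ for all $0<s\le t$, and, if $q>1$, $t^q\int_t^\infty\tau^{-q}v(\tau)\,d\tau\le cV(t)$ for all $t>0$. ("Decreasing" means non-increasing throughout.) For $t\in(0,T]$ let $W(t)=V(t)^{-1}\int_0^t\varphi$, $\widetilde W(t)=V(t)^{-1}t^{1-k/n}\varphi(t)$, and $$\Psi_1(t)=\sup_{0<\tau\le t}W(\tau),\quad U_1(t)=\sup_{t\le\tau\le T}\widetilde W(\tau);\qquad \Psi_q(t)=\Big(\int_0^tW^{q'}v\Big)^{1/q'},\quad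 U_q(t)=\Big(\int_t^T\widetilde W^{q'}v\Big)^{1/q'}\quad(q>1).$$ Assume $\Psi_q(T)<\infty$ and that at least one of the following holds: (A) there is $d_1>0$ with $\int_t^T\tau^{-k/n}\varphi(\tau)\,d\tau\le d_1t^{-k/n}\int_0^t\varphi(\tau)\,d\tau$ for all $t\in(0,T]$, and for some $\varepsilon>0$ the function $t^{\varepsilon}V(t)^{-1}$ is decreasing on $(0,T]$; (B) there is $d_2>0$ with $\int_0^t\tau^{-k/n}\varphi(\tau)\,d\tau\le d_2t^{1-k/n}\varphi(t)$ for all $t\in(0,T]$, and for some $\varepsilon>0$ the function $t^{\varepsilon}U_q(t)$ is decreasing on $(0,T]$. **Cone.** Let $\Omega_\varphi(t,\tau)=\varphi(\tau)/\big(1+(\tau/t)^{k/n}\big)$, and for $\sigma\ge0$ on $(0,T)$ let $\|\sigma\|=\big(\int_0^\infty(\sigma^*)^qv\big)^{1/q}$, where $\sigma^*$ is the decreasing rearrangement of the extension of $\sigma$ by zero. Let $K$ be the cone of the functions $h(t)=\int_0^T\Omega_\varphi(t,\tau)\sigma(\tau)\,d\tau$, $t\in(0,T)$, with $\sigma\ge0$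 decreasing on $(0,T)$ and $\|\sigma\|<\infty$, and let $\varrho_K(h)$ be the infimum of $\|\sigma\|$ over all such $\sigma$ that represent $h$. **Spaces.** A generalized Banach function space (GBFS) $X$ on $(0,T)$ is a normed space $X=\{f\text{ measurable}:\|f\|_X<\infty\}$ given by a function norm $\|f\|_X=\varrho(|f|)$, where $\varrho$ maps the non-negative measurable functions on $(0,T)$ to $[0,\infty]$, is positively homogeneous and subadditive, vanishes exactly at the functions that are $0$ a.e., is monotone with respect to $\le$ a.e., satisfies $\varrho(f_j)\uparrow\varrho(f)$ whenever $0\le f_j\uparrow f$ a.e., and is such that for every measurable $B\subset(0,T)$ of positive measure there are a function $h_B$ with $0<h_B<\infty$ a.e. on $B$ and a constant $c_B$ with $\int_Bh_B|f|\le c_B\|f\|_X$ for all $f\in X$, and there is $f_B\in X$ with $f_B>0$ a.e. on $B$. The associate space $X'$ is generated by the function norm $g\mapsto\sup\{\int_0^Tfg:\ f\ge0,\ \|f\|_X\le1\}$. We write $K\mapsto X$ if $K\subset X$ and $\|h\|_X\le c\,\varrho_K(h)$ for all $h\in K$ with some constant $c>0$. A GBFS $X_0$ is optimal for $K\mapsto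 X$ if $K\mapsto X_0$, and $X_0\subset Y$ for every GBFS $Y$ with $K\mapsto Y$. **Theorem 4.1.** Under these assumptions an optimal GBFS for $K\mapsto X$ exists. For every optimal GBFS $X_0$ the associate space $X_0'$ is a GBFS, and the function norm $\varrho_0$ that generates it satisfies $\varrho_0(g)\simeq\widetilde\varrho_0(g)$, that is, there are constants $c_1,c_2\in(0,\infty)$ with $c_1\widetilde\varrho_0(g)\le\varrho_0(g)\le c_2\widetilde\varrho_0(g)$ for all measurable $g:(0,T)\to[0,\infty]$, where for $q=1$ $$\widetilde\varrho_0(g)=\sup_{t\in(0,T]}V(t)^{-1}\Big(\int_0^t\varphi(\tau)\,d\tau\Big)\Big(\int_t^Tg(s)\,ds\Big),$$ and for $1<q<\infty$ $$\widetilde\varrho_0(g)=\Big(\int_0^T\Big(\Big(\int_0^t\varphi(\tau)\,d\tau\Big)\Big(\int_t^Tg(s)\,ds\Big)\Big)^{q'}w(t)\,dt\Big)^{1/q'},\qquad w(t)=V(t)^{-q'}v(t).$$ -/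

import Mathlib

open MeasureTheory Set
open scoped ENNReal NNReal

namespace OptimalGBFS

noncomputable section

/-- Lebesgue measure on the interval `(0,T)`. -/
def leb (T : ℝ) : Measure ℝ := volume.restrict (Ioo 0 T)

/-! ### Generalized Banach function spaces

A space `X = X(0,T)` is given by its function norm `ρ`, defined on non-negative measurable
functions with values in `[0,∞]`: `X` consists of the measurable `f` with `ρ |f| < ∞`, and
`‖f‖_X = ρ |f|`. Only the values of `ρ` on functions measurable on `(0,T)` matter. -/

/-- `ρ` is the function norm of a generalized Banach function space (GBFS) on `(0,T)`. -/
structure IsGBFSNorm (T : ℝ) (ρ : (ℝ → ℝ≥0∞) → ℝ≥0∞) : Prop where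
  smul : ∀ (c : ℝ≥0) (f : ℝ → ℝ≥0∞), AEMeasurable f (leb T) →
    ρ (fun t => (c : ℝ≥0∞) * f t) = (c : ℝ≥0∞) * ρ f
  add_le : ∀ f g : ℝ → ℝ≥0∞, AEMeasurable f (leb T) → AEMeasurable g (leb T) →
    ρ (fun t => f t + g t) ≤ ρ f + ρ g
  eq_zero_iff : ∀ f : ℝ → ℝ≥0∞, AEMeasurable f (leb T) → (ρ f = 0 ↔ ∀ᵐ t ∂(leb T), f t = 0)
  mono : ∀ f g : ℝ → ℝ≥0∞, AEMeasurable f (leb T) → AEMeasurable g (leb T) →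
    (∀ᵐ t ∂(leb T), f t ≤ g t) → ρ f ≤ ρ g
  fatou : ∀ f : ℕ → ℝ → ℝ≥0∞, (∀ j, AEMeasurable (f j) (leb T)) →
    (∀ᵐ t ∂(leb T), Monotone fun j => f j t) → ρ (fun t => ⨆ j, f j t) = ⨆ j, ρ (f j)
  weighted_integral_le : ∀ B : Set ℝ, MeasurableSet B → B ⊆ Ioo 0 T → 0 < volume B →
    ∃ h : ℝ → ℝ≥0∞, AEMeasurable h (leb T) ∧ (∀ᵐ t ∂(volume.restrict B), 0 < h t ∧ h t < ∞) ∧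
      ∃ c : ℝ≥0, ∀ f : ℝ → ℝ≥0∞, AEMeasurable f (leb T) → ∫⁻ t in B, h t * f t ≤ c * ρ f
  exists_pos : ∀ B : Set ℝ, MeasurableSet B → B ⊆ Ioo 0 T → 0 < volume B →
    ∃ f : ℝ → ℝ≥0∞, AEMeasurable f (leb T) ∧ (∀ᵐ t ∂(volume.restrict B), 0 < f t) ∧ ρ f < ∞

/-- The associate function norm, `g ↦ sup {∫₀ᵀ f g : ρ f ≤ 1}`; it generates `X'`. -/
def assocNorm (T : ℝ) (ρ : (ℝ → ℝ≥0∞) → ℝ≥0∞) (g : ℝ → ℝ≥0∞) : ℝ≥0∞ :=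
  ⨆ (f : ℝ → ℝ≥0∞) (_ : AEMeasurable f (leb T)) (_ : ρ f ≤ 1), ∫⁻ t, f t * g t ∂(leb T)

/-- The embedding `K ↦ X` of a cone `K` with functional `ρK` into the space with norm `ρ`. -/
def ConeEmbeds (K : Set (ℝ → ℝ≥0∞)) (ρK ρ : (ℝ → ℝ≥0∞) → ℝ≥0∞) : Prop :=
  (∀ h ∈ K, ρ h < ∞) ∧ ∃ c : ℝ≥0, 0 < c ∧ ∀ h ∈ K, ρ h ≤ c * ρK h

/-- `ρ₀` is the norm of a GBFS that is optimal (smallest) for the embedding `K ↦ X`. -/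
structure IsOptimal (T : ℝ) (K : Set (ℝ → ℝ≥0∞)) (ρK ρ₀ : (ℝ → ℝ≥0∞) → ℝ≥0∞) : Prop where
  isGBFS : IsGBFSNorm T ρ₀
  embeds : ConeEmbeds K ρK ρ₀
  subset : ∀ ρ : (ℝ → ℝ≥0∞) → ℝ≥0∞, IsGBFSNorm T ρ → ConeEmbeds K ρK ρ →
    ∀ f : ℝ → ℝ≥0∞, AEMeasurable f (leb T) → ρ₀ f < ∞ → ρ f < ∞

/-! ### Weighted Lorentz spaces -/

/-- The decreasing rearrangement `f*` (Lebesgue measure on the line). -/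
def rearr (f : ℝ → ℝ≥0∞) (t : ℝ) : ℝ≥0∞ :=
  sInf {s : ℝ≥0∞ | volume {x | s < f x} ≤ ENNReal.ofReal t}

/-- The functional of `Λ_q(v)`. -/
def lorentz (q : ℝ) (v : ℝ → ℝ) (f : ℝ → ℝ≥0∞) : ℝ≥0∞ :=
  (∫⁻ t in Ioi 0, rearr f t ^ q * ENNReal.ofReal (v t)) ^ (1 / q)

/-- The functional of `Λ_q(v)` on functions on `(0,T)`, extended by zero. -/
def lorentzOn (T q : ℝ) (v : ℝ → ℝ) (f : ℝ → ℝ≥0∞) : ℝ≥0∞ :=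
  lorentz q v ((Ioo 0 T).indicator f)

/-- The primitive `V(t) = ∫₀ᵗ v`. -/
def primV (v : ℝ → ℝ) (t : ℝ) : ℝ≥0∞ := ∫⁻ τ in Ioo 0 t, ENNReal.ofReal (v τ)

/-- The condition on the weight under which the functional of `Λ_q(v)` is taken to be equivalent
to a norm: `V(t)/t` almost decreases if `q = 1`, and
`t^q ∫_t^∞ τ^{-q} v(τ) dτ ≤ c V(t)` if `q > 1`. -/
def NormableWeight (q : ℝ) (v : ℝ → ℝ) : Prop :=
  ∃ c : ℝ≥0, 0 < c ∧
    (q = 1 → ∀ s t : ℝ, 0 < s → s ≤ t →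
      primV v t / ENNReal.ofReal t ≤ c * (primV v s / ENNReal.ofReal s)) ∧
    (1 < q → ∀ t : ℝ, 0 < t →
      ENNReal.ofReal (t ^ q) * ∫⁻ τ in Ioi t, ENNReal.ofReal (τ ^ (-q) * v τ) ≤ c * primV v t)

/-! ### Kernels and the cone `K` -/

/-- Assumptions on the radial profile of a generalized Bessel-McDonald kernel on `ℝⁿ`. -/
structure IsKernelProfile (n : ℕ) (Φ : ℝ → ℝ) : Prop where
  nonneg : ∀ z, 0 < z → 0 ≤ Φ z
  continuousOn : ContinuousOn Φ (Ioi 0)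
  antitoneOn : AntitoneOn Φ (Ioi 0)
  integral_pos : 0 < ∫⁻ z in Ioi 0, ENNReal.ofReal (Φ z * z ^ (n - 1))
  integral_lt_top : ∫⁻ z in Ioi 0, ENNReal.ofReal (Φ z * z ^ (n - 1)) < ∞

/-- Volume of the unit ball of `ℝⁿ`. -/
def unitBallVol (n : ℕ) : ℝ := (volume (Metric.ball (0 : EuclideanSpace ℝ (Fin n)) 1)).toReal

/-- `φ(τ) = Φ((τ / V_n)^{1/n})`. -/
def phi (n : ℕ) (Φ : ℝ → ℝ) (τ : ℝ) : ℝ := Φ ((τ / unitBallVol n) ^ (1 / (n : ℝ)))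

/-- `∫₀ᵗ φ`. -/
def primPhi (n : ℕ) (Φ : ℝ → ℝ) (t : ℝ) : ℝ≥0∞ := ∫⁻ τ in Ioo 0 t, ENNReal.ofReal (phi n Φ τ)

/-- `Ω_φ(t,τ) = φ(τ) / (1 + (τ/t)^{k/n})`. -/
def Omega (k n : ℕ) (Φ : ℝ → ℝ) (t τ : ℝ) : ℝ≥0∞ :=
  ENNReal.ofReal (phi n Φ τ / (1 + (τ / t) ^ ((k : ℝ) / n)))

/-- The non-negative decreasing functions on `(0,T)` in `Λ_q(v)`. -/
def DecLorentz (T q : ℝ) (v : ℝ → ℝ) : Set (ℝ → ℝ≥0∞) :=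
  {σ | AntitoneOn σ (Ioo 0 T) ∧ lorentzOn T q v σ < ∞}

/-- `σ` represents `h`: `h(t) = ∫₀ᵀ Ω_φ(t,τ) σ(τ) dτ` for `t ∈ (0,T)`. -/
def Represents (k n : ℕ) (Φ : ℝ → ℝ) (T : ℝ) (σ h : ℝ → ℝ≥0∞) : Prop :=
  ∀ t ∈ Ioo 0 T, h t = ∫⁻ τ in Ioo 0 T, Omega k n Φ t τ * σ τ

/-- The cone `K` of functions on `(0,T)` for the basic space `Λ_q(v)`. -/
def coneK (k n : ℕ) (Φ : ℝ → ℝ) (T q : ℝ) (v : ℝ → ℝ) : Set (ℝ → ℝ≥0∞) :=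
  {h | ∃ σ ∈ DecLorentz T q v, Represents k n Φ T σ h}

/-- The functional `ϱ_K`. -/
def rhoK (k n : ℕ) (Φ : ℝ → ℝ) (T q : ℝ) (v : ℝ → ℝ) (h : ℝ → ℝ≥0∞) : ℝ≥0∞ :=
  ⨅ (σ : ℝ → ℝ≥0∞) (_ : σ ∈ DecLorentz T q v) (_ : Represents k n Φ T σ h), lorentzOn T q v σ

/-! ### The quantities in the assumptions and in the conclusion -/

/-- `W(t) = V(t)⁻¹ ∫₀ᵗ φ`. -/
def fnW (n : ℕ) (Φ v : ℝ → ℝ) (t : ℝ) : ℝ≥0∞ := (primV v t)⁻¹ * primPhi n Φ t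

/-- `Ψ_q(t)`; the exponent `q.conjExponent = q / (q - 1)` is `q'`. -/
def Psi (n : ℕ) (Φ v : ℝ → ℝ) (q t : ℝ) : ℝ≥0∞ :=
  if q = 1 then ⨆ τ ∈ Ioc 0 t, fnW n Φ v τ
  else (∫⁻ τ in Ioo 0 t, fnW n Φ v τ ^ q.conjExponent * ENNReal.ofReal (v τ)) ^
    (1 / q.conjExponent)

/-- `W̃(t) = V(t)⁻¹ t^{1-k/n} φ(t)`. -/
def fnWt (k n : ℕ) (Φ v : ℝ → ℝ) (t : ℝ) : ℝ≥0∞ :=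
  (primV v t)⁻¹ * ENNReal.ofReal (t ^ (1 - (k : ℝ) / n) * phi n Φ t)

/-- `U_q(t)`. -/
def fnU (k n : ℕ) (Φ v : ℝ → ℝ) (T q t : ℝ) : ℝ≥0∞ :=
  if q = 1 then ⨆ τ ∈ Icc t T, fnWt k n Φ v τ
  else (∫⁻ τ in Ioo t T, fnWt k n Φ v τ ^ q.conjExponent * ENNReal.ofReal (v τ)) ^
    (1 / q.conjExponent)

/-- Condition (A). -/
def CondA (k n : ℕ) (Φ v : ℝ → ℝ) (T : ℝ) : Prop :=
  (∃ d : ℝ≥0, 0 < d ∧ ∀ t ∈ Ioc 0 T,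
    ∫⁻ τ in Ioo t T, ENNReal.ofReal (τ ^ (-((k : ℝ) / n)) * phi n Φ τ) ≤
      d * (ENNReal.ofReal (t ^ (-((k : ℝ) / n))) * primPhi n Φ t)) ∧
  ∃ ε : ℝ, 0 < ε ∧ AntitoneOn (fun t => ENNReal.ofReal (t ^ ε) * (primV v t)⁻¹) (Ioc 0 T)

/-- Condition (B). -/
def CondB (k n : ℕ) (Φ v : ℝ → ℝ) (T q : ℝ) : Prop :=
  (∃ d : ℝ≥0, 0 < d ∧ ∀ t ∈ Ioc 0 T,
    ∫⁻ τ in Ioo 0 t, ENNReal.ofReal (τ ^ (-((k : ℝ) / n)) * phi n Φ τ) ≤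
      d * ENNReal.ofReal (t ^ (1 - (k : ℝ) / n) * phi n Φ t)) ∧
  ∃ ε : ℝ, 0 < ε ∧ AntitoneOn (fun t => ENNReal.ofReal (t ^ ε) * fnU k n Φ v T q t) (Ioc 0 T)

/-- `w(t) = V(t)^{-q'} v(t)`. -/
def fnw (v : ℝ → ℝ) (q t : ℝ) : ℝ≥0∞ := primV v t ^ (-q.conjExponent) * ENNReal.ofReal (v t)

/-- The functional `ϱ̃₀`. -/
def rhoTilde (n : ℕ) (Φ v : ℝ → ℝ) (T q : ℝ) (g : ℝ → ℝ≥0∞) : ℝ≥0∞ :=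
  if q = 1 then ⨆ t ∈ Ioc 0 T, (primV v t)⁻¹ * primPhi n Φ t * ∫⁻ s in Ioo t T, g s
  else (∫⁻ t in Ioo 0 T,
    (primPhi n Φ t * ∫⁻ s in Ioo t T, g s) ^ q.conjExponent * fnw v q t) ^ (1 / q.conjExponent)

end

end OptimalGBFS

open OptimalGBFS

namespace OptimalGBFS

/-! Write R for the associate functional of `rhoK`, p = q', κ = k/n, and G(τ) for the integral of g
over (τ,T).

Duality settles existence and reduces the theorem to R ≃ `rhoTilde`. R is a function norm, and its
associate R' is an optimal norm: K embeds by the definition of R, and if K embeds into a space with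
norm ρ, then R ≤ Cρ', hence ρ'' ≤ CR', while ρ ≤ ρ'' by the Lorentz-Luxemburg theorem
(`IsGBFSNorm.le_assocNorm_assocNorm`, a separation argument in L²). The space of any optimal norm
lies in that of R', the inclusion is automatically bounded (`IsGBFSNorm.exists_le_mul_of_subset`),
and so its associate norm is equivalent to R.

The kernel is comparable to φ(τ) min(1, (t/τ)^κ). By Tonelli, pairing g with the function
represented by σ amounts to J + J₂, where J = ∫ φσG and J₂ = ∫ g(t) t^κ ∫_t^T φ(τ) τ^{-κ} σ(τ) dτ
dt.

For the lower bound of R, J is enough. If q = 1, test with indicators of (0,t). If q > 1, the Hölder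
extremal (WG)^{p-1} need not decrease; it is replaced by its tail integral against v/V, whose norm
is controlled by Hardy's inequality (`IsWeight.hardy`).

For the upper bound, the pairing is written with dτ/τ, and dτ/τ is traded for v/V dτ. This is
legitimate when V at least doubles under a fixed dilation (`IsWeight.lintegral_mul_inv_le`); Hölder
then finishes. Under (A) reverse doubling is immediate, J₂ ≤ dJ, and φ(τ) ≤ τ^{-1} ∫_0^τ φ. Under
(B) reverse doubling is extracted from the decay of U_q, and J + J₂ = ∫ τ^{1-κ} φ P σ dτ/τ with P(τ)
= κ ∫_0^τ s^{κ-1} G(s) ds. A Hardy inequality for the measure W̃^p v, or its pointwise analogue for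
q = 1, bounds the norm of W̃P by that of τ^κ W̃ G, and τ^κ W̃ ≤ W. -/

instance leb_isFiniteMeasure (T : ℝ) : IsFiniteMeasure (leb T) := by
  unfold leb; infer_instance

/-! ### Associate norms -/

section Assoc

variable {T : ℝ} {ρ : (ℝ → ℝ≥0∞) → ℝ≥0∞}

lemma lintegral_le_assocNorm {f : ℝ → ℝ≥0∞} (hf : AEMeasurable f (leb T)) (h : ρ f ≤ 1)
    (g : ℝ → ℝ≥0∞) : ∫⁻ t, f t * g t ∂(leb T) ≤ assocNorm T ρ g :=
  le_iSup₂_of_le f hf (le_iSup_of_le h le_rfl)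

lemma assocNorm_le {g : ℝ → ℝ≥0∞} {a : ℝ≥0∞}
    (h : ∀ f, AEMeasurable f (leb T) → ρ f ≤ 1 → ∫⁻ t, f t * g t ∂(leb T) ≤ a) :
    assocNorm T ρ g ≤ a :=
  iSup₂_le fun f hf => iSup_le fun h1 => h f hf h1

lemma assocNorm_mono {f g : ℝ → ℝ≥0∞} (h : ∀ᵐ t ∂(leb T), f t ≤ g t) :
    assocNorm T ρ f ≤ assocNorm T ρ g :=
  assocNorm_le fun u hu h1 => (lintegral_mono_ae (h.mono fun t ht => by gcongr)).trans
    (lintegral_le_assocNorm hu h1 g)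

lemma assocNorm_smul (c : ℝ≥0∞) {f : ℝ → ℝ≥0∞} (hf : AEMeasurable f (leb T)) :
    assocNorm T ρ (fun t => c * f t) = c * assocNorm T ρ f := by
  unfold assocNorm
  simp only [ENNReal.mul_iSup]
  refine iSup_congr fun u => iSup_congr fun hu => iSup_congr fun h1 => ?_
  rw [← lintegral_const_mul'' _ (hu.fun_mul hf)]
  refine lintegral_congr fun t => ?_
  ring

lemma assocNorm_add_le {f g : ℝ → ℝ≥0∞} (hf : AEMeasurable f (leb T)) :
    assocNorm T ρ (fun t => f t + g t) ≤ assocNorm T ρ f + assocNorm T ρ g := by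
  refine assocNorm_le fun u hu h1 => ?_
  simp only [mul_add]
  rw [lintegral_add_left' (hu.fun_mul hf)]
  exact add_le_add (lintegral_le_assocNorm hu h1 f) (lintegral_le_assocNorm hu h1 g)

lemma assocNorm_iSup {f : ℕ → ℝ → ℝ≥0∞} (hf : ∀ j, AEMeasurable (f j) (leb T))
    (hm : ∀ᵐ t ∂(leb T), Monotone fun j => f j t) :
    assocNorm T ρ (fun t => ⨆ j, f j t) = ⨆ j, assocNorm T ρ (f j) := by
  refine le_antisymm (assocNorm_le fun u hu h1 => ?_) (iSup_le fun j => ?_)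
  · simp only [ENNReal.mul_iSup]
    rw [lintegral_iSup' (fun j => hu.fun_mul (hf j))
      (hm.mono fun t ht i j hij => mul_le_mul_right (ht hij) _)]
    exact iSup_mono fun j => lintegral_le_assocNorm hu h1 _
  · exact assocNorm_mono (Filter.Eventually.of_forall fun t => le_iSup (fun j => f j t) j)

lemma restrict_le_leb {B : Set ℝ} (hBT : B ⊆ Ioo 0 T) : volume.restrict B ≤ leb T :=
  Measure.restrict_mono hBT le_rfl

/-- The associate functional of an arbitrary functional is a function norm as soon as the unit ball
contains a positive function and the associate functional is finite at a positive function. -/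
lemma assocNorm_isGBFSNorm
    (hpos : ∃ f, AEMeasurable f (leb T) ∧ (∀ᵐ t ∂(leb T), 0 < f t) ∧ ρ f ≤ 1)
    (hfin : ∃ g, AEMeasurable g (leb T) ∧ (∀ᵐ t ∂(leb T), 0 < g t) ∧ assocNorm T ρ g < ∞) :
    IsGBFSNorm T (assocNorm T ρ) := by
  obtain ⟨u, hu, hu0, hu1⟩ := hpos
  obtain ⟨w, hw, hw0, hw1⟩ := hfin
  constructor
  · exact fun c f hf => assocNorm_smul c hf
  · exact fun f g hf _ => assocNorm_add_le hf
  · refine fun g hg => ⟨fun h => ?_, fun h => ?_⟩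
    · have h2 : ∫⁻ t, u t * g t ∂(leb T) = 0 :=
        le_antisymm ((lintegral_le_assocNorm hu hu1 g).trans h.le) zero_le
      rw [lintegral_eq_zero_iff' (hu.fun_mul hg)] at h2
      filter_upwards [h2, hu0] with t h3 h4
      simpa [h4.ne'] using h3
    · refine le_antisymm (assocNorm_le fun f hf _ => ?_) zero_le
      refine (lintegral_congr_ae (h.mono fun t ht => ?_)).trans_le (lintegral_zero (μ := leb T)).le
      simp [ht]
  · exact fun f g _ _ h => assocNorm_mono h
  · exact fun f hf hm => assocNorm_iSup hf hm
  · intro B _ hBT _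
    -- A positive u in the unit ball serves as the weight; the truncation at 1 makes it finite.
    refine ⟨fun t => min (u t) 1, hu.min aemeasurable_const, ?_, 1, fun f hf => ?_⟩
    · filter_upwards [ae_mono (restrict_le_leb hBT) hu0] with t ht
      exact ⟨lt_min ht one_pos, (min_le_right _ _).trans_lt ENNReal.one_lt_top⟩
    · rw [ENNReal.coe_one, one_mul]
      calc ∫⁻ t in B, min (u t) 1 * f t ≤ ∫⁻ t, min (u t) 1 * f t ∂(leb T) :=
            lintegral_mono' (restrict_le_leb hBT) le_rfl
        _ ≤ ∫⁻ t, u t * f t ∂(leb T) := by gcongr; exact min_le_left _ _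
        _ ≤ _ := lintegral_le_assocNorm hu hu1 f
  · intro B _ hBT _
    exact ⟨w, hw, ae_mono (restrict_le_leb hBT) hw0, hw1⟩

lemma volume_Ioo_zero_pos (hT : 0 < T) : 0 < volume (Ioo 0 T) := by simpa using hT

lemma IsGBFSNorm.exists_pos_le_one (h : IsGBFSNorm T ρ) (hT : 0 < T) :
    ∃ f, AEMeasurable f (leb T) ∧ (∀ᵐ t ∂(leb T), 0 < f t) ∧ ρ f ≤ 1 := by
  obtain ⟨f, hf, hf0, hf1⟩ := h.exists_pos _ measurableSet_Ioo le_rfl (volume_Ioo_zero_pos hT)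
  set c : ℝ≥0 := (ρ f).toNNReal + 1
  have hc : (c : ℝ≥0∞) ≠ 0 := by simp [c]
  refine ⟨fun t => (c⁻¹ : ℝ≥0) * f t, hf.const_mul _, ?_, ?_⟩
  · filter_upwards [hf0] with t ht
    exact ENNReal.mul_pos (by simp [c]) ht.ne'
  · rw [h.smul _ _ hf, ENNReal.coe_inv (by simp [c])]
    calc (c : ℝ≥0∞)⁻¹ * ρ f ≤ (c : ℝ≥0∞)⁻¹ * c := by
          gcongr
          simp only [c, ENNReal.coe_add, ENNReal.coe_toNNReal hf1.ne]
          exact le_self_add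
      _ = 1 := ENNReal.inv_mul_cancel hc ENNReal.coe_ne_top

/-- The weight that the axioms attach to B = (0,T) is a positive function whose associate norm is at
most c. -/
lemma IsGBFSNorm.assoc (h : IsGBFSNorm T ρ) (hT : 0 < T) : IsGBFSNorm T (assocNorm T ρ) := by
  refine assocNorm_isGBFSNorm (h.exists_pos_le_one hT) ?_
  obtain ⟨u, hu, hu0, c, hc⟩ :=
    h.weighted_integral_le _ measurableSet_Ioo le_rfl (volume_Ioo_zero_pos hT)
  refine ⟨u, hu, hu0.mono fun t ht => ht.1, ?_⟩
  refine (assocNorm_le fun f hf h1 => ?_).trans_lt (ENNReal.coe_lt_top (r := c))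
  calc ∫⁻ t, f t * u t ∂(leb T) = ∫⁻ t in Ioo 0 T, u t * f t := by
        simp only [mul_comm, leb]
    _ ≤ c * ρ f := hc f hf
    _ ≤ c := mul_le_of_le_one_right' h1

lemma IsGBFSNorm.congr_ae (h : IsGBFSNorm T ρ) {f g : ℝ → ℝ≥0∞} (hf : AEMeasurable f (leb T))
    (hg : AEMeasurable g (leb T)) (hfg : ∀ᵐ t ∂(leb T), f t = g t) : ρ f = ρ g :=
  le_antisymm (h.mono _ _ hf hg (hfg.mono fun _ ht => ht.le))
    (h.mono _ _ hg hf (hfg.mono fun _ ht => ht.ge))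

/-- Reduces norm estimates to bounded functions, which lie in L² because the interval is finite. -/
lemma IsGBFSNorm.iSup_min (h : IsGBFSNorm T ρ) {f : ℝ → ℝ≥0∞} (hf : AEMeasurable f (leb T)) :
    ρ f = ⨆ j : ℕ, ρ (fun t => min (f t) j) := by
  rw [← h.fatou _ (fun j => hf.min aemeasurable_const)
    (Filter.Eventually.of_forall fun t i j hij => by dsimp only; gcongr)]
  congr 1
  ext t
  refine le_antisymm ?_ (iSup_le fun j => min_le_left _ _)
  rcases eq_or_ne (f t) ∞ with h1 | h1
  · simp [h1, ENNReal.iSup_natCast]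
  · obtain ⟨j, hj⟩ := ENNReal.exists_nat_gt h1
    exact le_iSup_of_le j (le_min le_rfl hj.le)

end Assoc

/-! ### Separation in L², the Lorentz-Luxemburg inequality, boundedness of inclusions -/

section Duality

variable {T : ℝ} {ρ : (ℝ → ℝ≥0∞) → ℝ≥0∞}

/-- The ball of radius `c` of a function space, inside `L²(0,T)`. -/
def ballL2 (T : ℝ) (ρ : (ℝ → ℝ≥0∞) → ℝ≥0∞) (c : ℝ≥0) : Set (Lp ℝ 2 (leb T)) :=
  {u | ρ (fun t => ‖u t‖ₑ) ≤ c}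

lemma aemeasurable_enorm_Lp (u : Lp ℝ 2 (leb T)) : AEMeasurable (fun t => ‖u t‖ₑ) (leb T) :=
  (Lp.aestronglyMeasurable u).enorm

lemma IsGBFSNorm.convex_ballL2 (h : IsGBFSNorm T ρ) (c : ℝ≥0) : Convex ℝ (ballL2 T ρ c) := by
  intro u hu w hw a b ha hb hab
  simp only [ballL2, mem_ofPred_eq] at hu hw ⊢
  have hum := aemeasurable_enorm_Lp u
  have hwm := aemeasurable_enorm_Lp w
  calc ρ (fun t => ‖(a • u + b • w : Lp ℝ 2 (leb T)) t‖ₑ)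
      ≤ ρ (fun t => (a.toNNReal : ℝ≥0∞) * ‖u t‖ₑ + (b.toNNReal : ℝ≥0∞) * ‖w t‖ₑ) := by
        refine h.mono _ _ (aemeasurable_enorm_Lp _) ((hum.const_mul _).add (hwm.const_mul _)) ?_
        filter_upwards [Lp.coeFn_add (a • u) (b • w), Lp.coeFn_smul a u, Lp.coeFn_smul b w]
          with t h1 h2 h3
        rw [h1, Pi.add_apply, h2, h3]
        refine (enorm_add_le _ _).trans (le_of_eq ?_)
        simp only [Pi.smul_apply, enorm_smul]
        rw [Real.enorm_eq_ofReal ha, Real.enorm_eq_ofReal hb]; rfl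
    _ ≤ (a.toNNReal : ℝ≥0∞) * ρ (fun t => ‖u t‖ₑ) + (b.toNNReal : ℝ≥0∞) * ρ (fun t => ‖w t‖ₑ) := by
        refine (h.add_le _ _ (hum.const_mul _) (hwm.const_mul _)).trans ?_
        rw [h.smul _ _ hum, h.smul _ _ hwm]
    _ ≤ (a.toNNReal : ℝ≥0∞) * c + (b.toNNReal : ℝ≥0∞) * c := by gcongr
    _ = c := by
        rw [← add_mul, ← ENNReal.coe_add, ← Real.toNNReal_add ha hb, hab]; simp

/-- An L²-convergent sequence has an a.e. convergent subsequence. Its lower limit is an increasing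
limit of infima, each dominated by a member of the ball, so the Fatou property applies. -/
lemma IsGBFSNorm.isClosed_ballL2 (h : IsGBFSNorm T ρ) (c : ℝ≥0) : IsClosed (ballL2 T ρ c) := by
  refine IsSeqClosed.isClosed fun u x hu hx => ?_
  obtain ⟨ns, -, hns⟩ := (tendstoInMeasure_of_tendsto_Lp hx).exists_seq_tendsto_ae
  simp only [ballL2, mem_ofPred_eq] at hu ⊢
  set F : ℕ → ℝ → ℝ≥0∞ := fun j t => ⨅ i : ℕ, ‖u (ns (j + i)) t‖ₑ with hF
  have hFm : ∀ j, AEMeasurable (F j) (leb T) := fun j =>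
    AEMeasurable.iInf fun i => aemeasurable_enorm_Lp _
  have hmono : ∀ t, Monotone fun j => F j t := by
    intro t i j hij
    refine le_iInf fun l => (iInf_le _ (j - i + l)).trans (le_of_eq ?_)
    have : i + (j - i + l) = j + l := by omega
    rw [this]
  calc ρ (fun t => ‖x t‖ₑ) ≤ ρ (fun t => ⨆ j, F j t) := by
        refine h.mono _ _ (aemeasurable_enorm_Lp _) (AEMeasurable.iSup hFm) ?_
        filter_upwards [hns] with t ht
        have h1 := (continuous_enorm.tendsto (x t)).comp ht
        rw [← h1.liminf_eq, Filter.liminf_eq_iSup_iInf_of_nat']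
        refine iSup_mono fun j => le_iInf fun i => (iInf_le _ i).trans (le_of_eq ?_)
        simp [Function.comp, add_comm]
    _ = ⨆ j, ρ (F j) := h.fatou _ hFm (Filter.Eventually.of_forall hmono)
    _ ≤ c := by
        refine iSup_le fun j => (h.mono _ _ (hFm j) (aemeasurable_enorm_Lp _) ?_).trans (hu (ns j))
        exact Filter.Eventually.of_forall fun t => iInf_le _ 0

lemma memLp_toReal_of_le {f : ℝ → ℝ≥0∞} (hf : AEMeasurable f (leb T)) {j : ℕ}
    (hj : ∀ t, f t ≤ j) : MemLp (fun t => (f t).toReal) 2 (leb T) := by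
  refine MemLp.of_bound hf.ennreal_toReal.aestronglyMeasurable j
    (Filter.Eventually.of_forall fun t => ?_)
  rw [Real.norm_of_nonneg ENNReal.toReal_nonneg]
  exact ENNReal.toReal_le_of_le_ofReal (by positivity) (by simpa using hj t)

lemma IsGBFSNorm.toLp_mem_ballL2_iff (h : IsGBFSNorm T ρ) {f : ℝ → ℝ≥0∞}
    (hf : AEMeasurable f (leb T)) {j : ℕ} (hj : ∀ t, f t ≤ j) (c : ℝ≥0) :
    (memLp_toReal_of_le hf hj).toLp ∈ ballL2 T ρ c ↔ ρ f ≤ c := by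
  simp only [ballL2, mem_ofPred_eq]
  rw [h.congr_ae (aemeasurable_enorm_Lp _) hf]
  filter_upwards [(memLp_toReal_of_le hf hj).coeFn_toLp] with t ht
  rw [ht, Real.enorm_eq_ofReal ENNReal.toReal_nonneg, ENNReal.ofReal_toReal]
  exact ((hj t).trans_lt (ENNReal.natCast_lt_top j)).ne

lemma lintegral_mul_ofReal_eq {f : ℝ → ℝ≥0∞} {j : ℕ}
    (hj : ∀ t, f t ≤ j) (w : ℝ → ℝ)
    (hi : Integrable (fun t => (f t).toReal * w t) (leb T)) (hw : ∀ t, f t ≠ 0 → 0 ≤ w t) :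
    ∫⁻ t, f t * ENNReal.ofReal (w t) ∂(leb T) =
      ENNReal.ofReal (∫ t, (f t).toReal * w t ∂(leb T)) := by
  have h0 : ∀ t, 0 ≤ (f t).toReal * w t := fun t => by
    rcases eq_or_ne (f t) 0 with h | h
    · simp [h]
    · exact mul_nonneg ENNReal.toReal_nonneg (hw t h)
  rw [ofReal_integral_eq_lintegral_ofReal hi (Filter.Eventually.of_forall h0)]
  refine lintegral_congr fun t => ?_
  rw [ENNReal.ofReal_mul ENNReal.toReal_nonneg,
    ENNReal.ofReal_toReal ((hj t).trans_lt (ENNReal.natCast_lt_top j)).ne]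

/-- A bounded function outside a ball is separated from it by a positive functional. -/
lemma IsGBFSNorm.exists_separating (h : IsGBFSNorm T ρ) {f : ℝ → ℝ≥0∞}
    (hf : AEMeasurable f (leb T)) {j : ℕ} (hj : ∀ t, f t ≤ j) {c : ℝ≥0} (hc : c < ρ f) :
    ∃ g : ℝ → ℝ≥0∞, AEMeasurable g (leb T) ∧ ∃ s : ℝ≥0, 0 < s ∧
      (∀ F : ℝ → ℝ≥0∞, AEMeasurable F (leb T) → ρ F ≤ c → ∫⁻ t, F t * g t ∂(leb T) ≤ s) ∧
      s ≤ ∫⁻ t, f t * g t ∂(leb T) := by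
  obtain ⟨L, s, hL, hs⟩ := geometric_hahn_banach_closed_point (h.convex_ballL2 c)
    (h.isClosed_ballL2 c) (fun hmem => hc.not_ge ((h.toLp_mem_ballL2_iff hf hj c).1 hmem))
  -- By Riesz representation the separating functional is integration against w.
  set w : Lp ℝ 2 (leb T) := (InnerProductSpace.toDual ℝ _).symm L with hw
  have hLw : ∀ {F : ℝ → ℝ≥0∞} (hF : AEMeasurable F (leb T)) {j : ℕ} (hj : ∀ t, F t ≤ j),
      L (memLp_toReal_of_le hF hj).toLp = ∫ t, (F t).toReal * w t ∂(leb T) ∧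
      Integrable (fun t => (F t).toReal * w t) (leb T) := by
    intro F hF j hj
    have hae : ∀ᵐ t ∂(leb T), inner ℝ (w t) (((memLp_toReal_of_le hF hj).toLp : Lp ℝ 2 (leb T)) t) =
        (F t).toReal * w t := by
      filter_upwards [(memLp_toReal_of_le hF hj).coeFn_toLp] with t ht
      rw [ht]; simp
    refine ⟨?_, (L2.integrable_inner (𝕜 := ℝ) w (memLp_toReal_of_le hF hj).toLp).congr hae⟩
    rw [← InnerProductSpace.toDual_symm_apply (𝕜 := ℝ), L2.inner_def]
    exact integral_congr_ae hae
  obtain ⟨w', hw'm, hw'⟩ := (Lp.aestronglyMeasurable w).aemeasurable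
  have hs0 : 0 < s := by
    have hz : (0 : Lp ℝ 2 (leb T)) ∈ ballL2 T ρ c := by
      have : ρ (fun t => ‖(0 : Lp ℝ 2 (leb T)) t‖ₑ) = 0 := by
        rw [h.eq_zero_iff _ (aemeasurable_enorm_Lp _)]
        filter_upwards [Lp.coeFn_zero ℝ 2 (leb T)] with t ht
        rw [ht]; simp
      exact this.trans_le zero_le
    simpa using hL 0 hz
  have hbdd : ∀ F : ℝ → ℝ≥0∞, AEMeasurable F (leb T) → ρ F ≤ c → ∀ i : ℕ, (∀ t, F t ≤ i) →
      ∫⁻ t, F t * ENNReal.ofReal (w t) ∂(leb T) ≤ ENNReal.ofReal s := by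
    intro F hF hFc i hi
    -- The density w may change sign. Restricting F to the set where it is nonnegative keeps F in
    -- the ball by monotonicity, and turns the pairing with w into the pairing with its positive
    -- part.
    set P : Set ℝ := {t | 0 ≤ w' t}
    have hP : MeasurableSet P := measurableSet_le measurable_const hw'm
    have hG : AEMeasurable (P.indicator F) (leb T) := hF.indicator hP
    have hGF : ∀ t, P.indicator F t ≤ F t := fun t => indicator_le_self _ _ t
    have hGi : ∀ t, P.indicator F t ≤ i := fun t => (hGF t).trans (hi t)
    have hGc : ρ (P.indicator F) ≤ c :=
      (h.mono _ _ hG hF (Filter.Eventually.of_forall hGF)).trans hFc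
    have h1 := hL _ ((h.toLp_mem_ballL2_iff hG hGi c).2 hGc)
    obtain ⟨h2, h3⟩ := hLw hG hGi
    have hae : ∀ᵐ t ∂(leb T), (P.indicator F t).toReal * w t = (P.indicator F t).toReal * w' t := by
      filter_upwards [hw'] with t ht
      rw [ht]
    calc ∫⁻ t, F t * ENNReal.ofReal (w t) ∂(leb T)
        = ∫⁻ t, P.indicator F t * ENNReal.ofReal (w' t) ∂(leb T) := by
          refine lintegral_congr_ae ?_
          filter_upwards [hw'] with t ht
          rw [ht]
          by_cases htP : t ∈ P
          · simp [htP]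
          · have : w' t ≤ 0 := (not_le.1 htP).le
            simp [htP, ENNReal.ofReal_of_nonpos this]
      _ = ENNReal.ofReal (∫ t, (P.indicator F t).toReal * w' t ∂(leb T)) := by
          refine lintegral_mul_ofReal_eq hGi w' (h3.congr hae) fun t ht => ?_
          by_contra hlt
          exact ht (indicator_of_notMem (by simpa [P] using hlt) _)
      _ ≤ ENNReal.ofReal s := by
          rw [← integral_congr_ae hae, ← h2]
          exact ENNReal.ofReal_le_ofReal h1.le
  refine ⟨fun t => ENNReal.ofReal (w t),
    (Lp.aestronglyMeasurable w).aemeasurable.ennreal_ofReal, s.toNNReal, by simpa using hs0, ?_, ?_⟩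
  · intro F hF hFc
    have hsup : ∀ t, F t = ⨆ i : ℕ, min (F t) i := fun t => by
      refine le_antisymm ?_ (iSup_le fun j => min_le_left _ _)
      rcases eq_or_ne (F t) ∞ with h1 | h1
      · simp [h1, ENNReal.iSup_natCast]
      · obtain ⟨j, hj⟩ := ENNReal.exists_nat_gt h1
        exact le_iSup_of_le j (le_min le_rfl hj.le)
    calc ∫⁻ t, F t * ENNReal.ofReal (w t) ∂(leb T)
        = ∫⁻ t, ⨆ i : ℕ, min (F t) i * ENNReal.ofReal (w t) ∂(leb T) := by
          refine lintegral_congr fun t => ?_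
          rw [← ENNReal.iSup_mul, ← hsup]
      _ = ⨆ i : ℕ, ∫⁻ t, min (F t) i * ENNReal.ofReal (w t) ∂(leb T) := by
          refine lintegral_iSup' (fun i => (hF.min aemeasurable_const).fun_mul
            (Lp.aestronglyMeasurable w).aemeasurable.ennreal_ofReal)
            (Filter.Eventually.of_forall fun t i i' hii => by dsimp only; gcongr)
      _ ≤ _ := iSup_le fun i => hbdd _ (hF.min aemeasurable_const)
          ((h.mono _ _ (hF.min aemeasurable_const) hF
            (Filter.Eventually.of_forall fun t => min_le_left _ _)).trans hFc) i
          fun t => min_le_right _ _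
  · obtain ⟨h2, h3⟩ := hLw hf hj
    rw [h2] at hs
    calc ENNReal.ofReal s ≤ ENNReal.ofReal (∫ t, (f t).toReal * w t ∂(leb T)) :=
          ENNReal.ofReal_le_ofReal hs.le
      -- Replacing w by its positive part can only increase the pairing with f.
      _ ≤ ∫⁻ t, ENNReal.ofReal ((f t).toReal * w t) ∂(leb T) := by
          refine ENNReal.ofReal_le_of_le_toReal ?_
          rw [integral_eq_lintegral_pos_part_sub_lintegral_neg_part h3]
          exact sub_le_self _ ENNReal.toReal_nonneg
      _ = _ := by
          refine lintegral_congr fun t => ?_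
          rw [ENNReal.ofReal_mul ENNReal.toReal_nonneg,
            ENNReal.ofReal_toReal ((hj t).trans_lt (ENNReal.natCast_lt_top j)).ne]

/-- One half of the Lorentz-Luxemburg theorem: a function norm with the Fatou property is
dominated by its second associate. -/
lemma IsGBFSNorm.le_assocNorm_assocNorm (h : IsGBFSNorm T ρ) {f : ℝ → ℝ≥0∞}
    (hf : AEMeasurable f (leb T)) : ρ f ≤ assocNorm T (assocNorm T ρ) f := by
  have hfj : ∀ j : ℕ, AEMeasurable (fun t => min (f t) j) (leb T) :=
    fun j => hf.min aemeasurable_const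
  rw [h.iSup_min hf]
  refine iSup_le fun j => le_trans ?_
    (assocNorm_mono (Filter.Eventually.of_forall fun t => min_le_left (f t) j))
  refine le_of_forall_lt fun c' hc' => ?_
  obtain ⟨c, hc1, hc⟩ := ENNReal.lt_iff_exists_nnreal_btwn.1 hc'
  have hc0 : c ≠ 0 := by rintro rfl; simp at hc1
  refine hc1.trans_le ?_
  obtain ⟨g, hg, s, hs, hF, hfg⟩ := h.exists_separating (hfj j) (fun t => min_le_right _ _) hc
  have hs0 : (s : ℝ≥0∞) ≠ 0 := by simpa using hs.ne'
  have hcc : (c : ℝ≥0∞) ≠ 0 := by simpa using hc0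
  -- The pairing with g is at most s on the ball of radius c, so (c/s)g lies in the unit ball of the
  -- associate space; it pairs with the truncation of f to at least c.
  have h1 : assocNorm T ρ (fun t => ((c : ℝ≥0∞) / s) * g t) ≤ 1 := by
    refine assocNorm_le fun u hu hu1 => ?_
    have h2 := hF (fun t => (c : ℝ≥0∞) * u t) (hu.const_mul _)
      (by rw [h.smul _ _ hu]; exact mul_le_of_le_one_right' hu1)
    calc ∫⁻ t, u t * ((c : ℝ≥0∞) / s * g t) ∂(leb T)
        = (s : ℝ≥0∞)⁻¹ * ∫⁻ t, (c : ℝ≥0∞) * u t * g t ∂(leb T) := by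
          rw [← lintegral_const_mul'' _ ((hu.const_mul _).fun_mul hg)]
          refine lintegral_congr fun t => ?_
          rw [ENNReal.div_eq_inv_mul]; ring
      _ ≤ (s : ℝ≥0∞)⁻¹ * s := by gcongr
      _ = 1 := ENNReal.inv_mul_cancel hs0 ENNReal.coe_ne_top
  refine le_trans ?_ (lintegral_le_assocNorm (hg.const_mul _) h1 _)
  calc (c : ℝ≥0∞) = c / s * s := (ENNReal.div_mul_cancel hs0 ENNReal.coe_ne_top).symm
    _ ≤ c / s * ∫⁻ t, min (f t) j * g t ∂(leb T) := by gcongr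
    _ = _ := by
      rw [← lintegral_const_mul'' _ ((hfj j).fun_mul hg)]
      refine lintegral_congr fun t => ?_
      ring

/-- An inclusion of generalized Banach function spaces is bounded. -/
lemma IsGBFSNorm.exists_le_mul_of_subset {ρ' : (ℝ → ℝ≥0∞) → ℝ≥0∞} (h : IsGBFSNorm T ρ)
    (h' : IsGBFSNorm T ρ')
    (hsub : ∀ f : ℝ → ℝ≥0∞, AEMeasurable f (leb T) → ρ f < ∞ → ρ' f < ∞) :
    ∃ C : ℝ≥0, ∀ f : ℝ → ℝ≥0∞, AEMeasurable f (leb T) → ρ' f ≤ C * ρ f := by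
  by_contra! hcon
  -- If no constant works, some functions have ρ-norm at most 2^{-j} and ρ'-norm at least j. Their
  -- sum has finite ρ-norm by the Fatou property, but its ρ'-norm exceeds every j.
  have key : ∀ j : ℕ, ∃ F : ℝ → ℝ≥0∞, AEMeasurable F (leb T) ∧ ρ F ≤ 2⁻¹ ^ j ∧ (j : ℝ≥0∞) ≤ ρ' F := by
    intro j
    obtain ⟨f, hf, hlt⟩ := hcon ((j + 1) * 2 ^ j)
    have h0 : ρ f ≠ 0 := by
      intro h0
      rw [(h'.eq_zero_iff f hf).2 ((h.eq_zero_iff f hf).1 h0)] at hlt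
      simp at hlt
    have hT : ρ f ≠ ∞ := by
      intro hT
      rw [hT, ENNReal.mul_top (by simp)] at hlt
      simp at hlt
    set c : ℝ≥0 := 2⁻¹ ^ j * (ρ f).toNNReal⁻¹ with hc
    have hcE : (c : ℝ≥0∞) = 2⁻¹ ^ j * (ρ f)⁻¹ := by
      rw [hc, ENNReal.coe_mul, ENNReal.coe_inv (by simp [ENNReal.toNNReal_eq_zero_iff, h0, hT]),
        ENNReal.coe_toNNReal hT]
      simp [ENNReal.inv_pow]
    refine ⟨fun t => c * f t, hf.const_mul _, ?_, ?_⟩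
    · rw [h.smul _ _ hf, hcE, mul_assoc, ENNReal.inv_mul_cancel h0 hT, mul_one]
    · rw [h'.smul _ _ hf, hcE]
      calc (j : ℝ≥0∞) ≤ j + 1 := le_self_add
        _ = 2⁻¹ ^ j * (ρ f)⁻¹ * (((j + 1) * 2 ^ j) * ρ f) := by
            have e1 : (2⁻¹ : ℝ≥0∞) ^ j * 2 ^ j = 1 := by
              rw [← mul_pow, ENNReal.inv_mul_cancel (by simp) (by simp), one_pow]
            have e2 := ENNReal.inv_mul_cancel h0 hT
            calc (j : ℝ≥0∞) + 1 = (j + 1) * 1 * 1 := by ring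
              _ = (j + 1) * (2⁻¹ ^ j * 2 ^ j) * ((ρ f)⁻¹ * ρ f) := by rw [e1, e2]
              _ = _ := by ring
        _ ≤ _ := by
            gcongr
            simpa using hlt.le
  choose F hFm hF1 hF2 using key
  set S : ℕ → ℝ → ℝ≥0∞ := fun N t => ∑ j ∈ Finset.range N, F j t with hS
  have hSm : ∀ N, AEMeasurable (S N) (leb T) := fun N =>
    Finset.aemeasurable_fun_sum _ fun j _ => hFm j
  have hSmono : ∀ t, Monotone fun N => S N t := fun t => by
    intro a b hab
    exact Finset.sum_le_sum_of_subset (Finset.range_mono hab)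
  have hSρ : ∀ N, ρ (S N) ≤ ∑ j ∈ Finset.range N, 2⁻¹ ^ j := by
    intro N
    induction N with
    | zero => simpa using (h.eq_zero_iff (S 0) (hSm 0)).2 (Filter.Eventually.of_forall fun t => by simp [hS])
    | succ N ih =>
      rw [Finset.sum_range_succ]
      refine le_trans (le_of_eq ?_) ((h.add_le _ _ (hSm N) (hFm N)).trans (add_le_add ih (hF1 N)))
      congr 1; ext t; simp [hS, Finset.sum_range_succ]
  have h1 : ρ (fun t => ⨆ N, S N t) < ∞ := by
    rw [h.fatou S hSm (Filter.Eventually.of_forall hSmono)]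
    refine lt_of_le_of_lt (iSup_le fun N => (hSρ N).trans (ENNReal.sum_le_tsum _)) ?_
    rw [ENNReal.tsum_geometric]
    simp
  have h2 := hsub _ (AEMeasurable.iSup hSm) h1
  obtain ⟨j, hj⟩ := ENNReal.exists_nat_gt h2.ne
  refine hj.not_ge ((hF2 j).trans (h'.mono _ _ (hFm j) (AEMeasurable.iSup hSm)
    (Filter.Eventually.of_forall fun t => le_iSup_of_le (j + 1) ?_)))
  simp only [hS, Finset.sum_range_succ]
  exact le_add_self

end Duality

/-! ### The optimal space as a second associate -/

section Optimal

variable {T : ℝ} {K : Set (ℝ → ℝ≥0∞)} {ρK : (ℝ → ℝ≥0∞) → ℝ≥0∞}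

/-- If `K` embeds into a space, its associate norm dominates the associate functional of `K`. -/
lemma ConeEmbeds.assocNorm_le {ρ : (ℝ → ℝ≥0∞) → ℝ≥0∞} (h : IsGBFSNorm T ρ)
    (hK : ConeEmbeds K ρK ρ) (htop : ∀ f, ρK f < ∞ → f ∈ K) :
    ∃ C : ℝ≥0, ∀ g, AEMeasurable g (leb T) → assocNorm T ρK g ≤ C * assocNorm T ρ g := by
  obtain ⟨-, c, hc, hle⟩ := hK
  refine ⟨c, fun g hg => OptimalGBFS.assocNorm_le fun f hf hf1 => ?_⟩
  have h1 : ρ (fun t => (c⁻¹ : ℝ≥0) * f t) ≤ 1 := by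
    rw [h.smul _ _ hf]
    calc ((c⁻¹ : ℝ≥0) : ℝ≥0∞) * ρ f ≤ (c⁻¹ : ℝ≥0) * (c * ρK f) := by
          gcongr; exact hle f (htop f (hf1.trans_lt ENNReal.one_lt_top))
      _ = ρK f := by
          rw [← mul_assoc, ← ENNReal.coe_mul, inv_mul_cancel₀ hc.ne', ENNReal.coe_one, one_mul]
      _ ≤ 1 := hf1
  calc ∫⁻ t, f t * g t ∂(leb T) = c * ∫⁻ t, (c⁻¹ : ℝ≥0) * f t * g t ∂(leb T) := by
        rw [← lintegral_const_mul'' _ ((hf.const_mul _).fun_mul hg)]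
        refine lintegral_congr fun t => ?_
        rw [← mul_assoc, ← mul_assoc, ← ENNReal.coe_mul, mul_inv_cancel₀ hc.ne', ENNReal.coe_one,
          one_mul]
    _ ≤ _ := by gcongr; exact lintegral_le_assocNorm (hf.const_mul _) h1 g

/-- The second associate of the functional of a cone is the norm of the optimal space. -/
lemma isOptimal_assocNorm_assocNorm (hT : 0 < T) (hR : IsGBFSNorm T (assocNorm T ρK))
    (htop : ∀ f, ρK f < ∞ → f ∈ K)
    (hemb : ConeEmbeds K ρK (assocNorm T (assocNorm T ρK))) :
    IsOptimal T K ρK (assocNorm T (assocNorm T ρK)) := by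
  refine ⟨hR.assoc hT, hemb, fun ρ hρ hKρ f hf hfin => ?_⟩
  obtain ⟨C, hC⟩ := hKρ.assocNorm_le hρ htop
  have h1 : assocNorm T (assocNorm T ρ) f ≤ C * assocNorm T (assocNorm T ρK) f := by
    refine assocNorm_le fun g hg hg1 => ?_
    -- The general case divides by C. If C = 0, then g vanishes a.e. since R is a norm.
    rcases eq_or_ne C 0 with rfl | hC0
    · have hg0 : assocNorm T ρK g = 0 := by simpa using hC g hg
      have := (hR.eq_zero_iff g hg).1 hg0
      rw [lintegral_congr_ae (g := fun _ => 0) (this.mono fun t ht => by simp [ht])]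
      simp
    · have h2 : assocNorm T ρK (fun t => (C⁻¹ : ℝ≥0) * g t) ≤ 1 := by
        rw [hR.smul _ _ hg]
        calc ((C⁻¹ : ℝ≥0) : ℝ≥0∞) * assocNorm T ρK g ≤ (C⁻¹ : ℝ≥0) * (C * 1) := by
              gcongr; exact (hC g hg).trans (by gcongr)
          _ = 1 := by rw [mul_one, ← ENNReal.coe_mul, inv_mul_cancel₀ hC0, ENNReal.coe_one]
      calc ∫⁻ t, g t * f t ∂(leb T) = C * ∫⁻ t, (C⁻¹ : ℝ≥0) * g t * f t ∂(leb T) := by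
            rw [← lintegral_const_mul'' _ ((hg.const_mul _).fun_mul hf)]
            refine lintegral_congr fun t => ?_
            rw [← mul_assoc, ← mul_assoc, ← ENNReal.coe_mul, mul_inv_cancel₀ hC0, ENNReal.coe_one,
              one_mul]
        _ ≤ _ := by gcongr; exact lintegral_le_assocNorm (hg.const_mul _) h2 f
  exact (hρ.le_assocNorm_assocNorm hf).trans_lt
    (h1.trans_lt (ENNReal.mul_lt_top ENNReal.coe_lt_top hfin))

/-- The associate norm of an optimal space is equivalent to the associate functional of `K`. -/
lemma IsOptimal.assocNorm_equiv {ρ₀ : (ℝ → ℝ≥0∞) → ℝ≥0∞} (h : IsOptimal T K ρK ρ₀) (hT : 0 < T)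
    (hR : IsGBFSNorm T (assocNorm T ρK)) (htop : ∀ f, ρK f < ∞ → f ∈ K)
    (hemb : ConeEmbeds K ρK (assocNorm T (assocNorm T ρK))) :
    ∃ C : ℝ≥0, ∀ g, AEMeasurable g (leb T) →
      assocNorm T ρK g ≤ C * assocNorm T ρ₀ g ∧ assocNorm T ρ₀ g ≤ C * assocNorm T ρK g := by
  obtain ⟨C₁, hC₁⟩ := h.embeds.assocNorm_le h.isGBFS htop
  obtain ⟨C₂, hC₂⟩ := h.isGBFS.exists_le_mul_of_subset (hR.assoc hT)
    (h.subset _ (hR.assoc hT) hemb)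
  refine ⟨max C₁ C₂, fun g hg => ⟨(hC₁ g hg).trans (by gcongr; exact le_max_left _ _), ?_⟩⟩
  refine le_trans (b := C₂ * assocNorm T ρK g) ?_ (by gcongr; exact le_max_right _ _)
  refine assocNorm_le fun f hf hf1 => ?_
  -- The bounded inclusion puts f in the ball of radius C₂ of R'. Hölder's inequality between R and
  -- R' remains, with the values 0 and ∞ of R(g) treated apart.
  have hf2 : assocNorm T (assocNorm T ρK) f ≤ C₂ := (hC₂ f hf).trans (mul_le_of_le_one_right' hf1)
  set a := assocNorm T ρK g with ha
  rcases eq_or_ne a 0 with h0 | h0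
  · have := (hR.eq_zero_iff g hg).1 h0
    rw [lintegral_congr_ae (g := fun _ => 0) (this.mono fun t ht => by simp [ht])]
    simp
  rcases eq_or_ne a ∞ with hT' | hT'
  · rcases eq_or_ne C₂ 0 with rfl | hC0
    · have h1 : assocNorm T (assocNorm T ρK) f = 0 := by simpa using hf2
      have := ((hR.assoc hT).eq_zero_iff f hf).1 h1
      rw [lintegral_congr_ae (g := fun _ => 0) (this.mono fun t ht => by simp [ht])]
      simp
    · rw [hT', ENNReal.mul_top (by simpa using hC0)]; exact le_top
  have h1 : assocNorm T ρK (fun t => a⁻¹ * g t) ≤ 1 := by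
    rw [assocNorm_smul _ hg, ← ha, ENNReal.inv_mul_cancel h0 hT']
  calc ∫⁻ t, f t * g t ∂(leb T) = a * ∫⁻ t, a⁻¹ * g t * f t ∂(leb T) := by
        rw [← lintegral_const_mul'' _ ((hg.const_mul _).fun_mul hf)]
        refine lintegral_congr fun t => ?_
        rw [← mul_assoc, ← mul_assoc, ENNReal.mul_inv_cancel h0 hT', one_mul, mul_comm]
    _ ≤ a * assocNorm T (assocNorm T ρK) f := by
        gcongr; exact lintegral_le_assocNorm (hg.const_mul _) h1 f
    _ ≤ a * C₂ := by gcongr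
    _ = _ := mul_comm _ _

end Optimal

/-! ### Decreasing rearrangement of decreasing functions -/

section Rearrangement

variable {T : ℝ} {σ : ℝ → ℝ≥0∞}

lemma rearr_indicator_of_le (σ : ℝ → ℝ≥0∞) {t : ℝ} (ht : T ≤ t) :
    rearr ((Ioo 0 T).indicator σ) t = 0 := by
  refine le_antisymm (sInf_le ?_) zero_le
  have h : {x | 0 < (Ioo 0 T).indicator σ x} ⊆ Ioo 0 T := fun x hx => by
    by_contra hn
    simp [hn] at hx
  refine (measure_mono h).trans ?_
  simpa using ENNReal.ofReal_le_ofReal ht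

lemma rearr_indicator_le (hσ : AntitoneOn σ (Ioo 0 T)) {t : ℝ} (ht : t ∈ Ioo 0 T) :
    rearr ((Ioo 0 T).indicator σ) t ≤ σ t := by
  refine sInf_le ?_
  have h : {x | σ t < (Ioo 0 T).indicator σ x} ⊆ Ioo 0 t := fun x hx => by
    by_cases hxT : x ∈ Ioo 0 T
    · refine ⟨hxT.1, not_le.1 fun hle => ?_⟩
      have := hσ ht hxT hle
      simp only [mem_ofPred_eq, indicator_of_mem hxT] at hx
      exact hx.not_ge this
    · simp [hxT] at hx
  refine (measure_mono h).trans ?_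
  simp

/-- The point s must lie strictly to the right of t: the rearrangement is right-continuous, and σ
need not be. -/
lemma le_rearr_indicator (hσ : AntitoneOn σ (Ioo 0 T)) {t s : ℝ} (ht : 0 < t) (hts : t < s)
    (hs : s < T) : σ s ≤ rearr ((Ioo 0 T).indicator σ) t := by
  refine le_sInf fun a ha => not_lt.1 fun hlt => ?_
  have h : Ioc 0 s ⊆ {x | a < (Ioo 0 T).indicator σ x} := fun x hx => by
    have hxT : x ∈ Ioo 0 T := ⟨hx.1, hx.2.trans_lt hs⟩
    simp only [mem_ofPred_eq, indicator_of_mem hxT]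
    exact hlt.trans_le (hσ hxT ⟨ht.trans hts, hs⟩ hx.2)
  have h2 := (measure_mono h).trans ha
  simp only [Real.volume_Ioc, sub_zero] at h2
  exact hts.not_ge ((ENNReal.ofReal_le_ofReal_iff ht.le).1 h2)

lemma rearr_indicator_eq (hσ : AntitoneOn σ (Ioo 0 T)) {t : ℝ} (ht : t ∈ Ioo 0 T)
    (hc : ContinuousWithinAt σ (Ioo 0 T) t) : rearr ((Ioo 0 T).indicator σ) t = σ t := by
  refine le_antisymm (rearr_indicator_le hσ ht) ?_
  have h1 : Filter.Tendsto σ (nhdsWithin t (Ioo t T)) (nhds (σ t)) :=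
    hc.mono_left (nhdsWithin_mono _ (Ioo_subset_Ioo_left ht.1.le))
  have : (nhdsWithin t (Ioo t T)).NeBot := by
    rw [nhdsWithin_Ioo_eq_nhdsGT ht.2]; infer_instance
  refine le_of_tendsto h1 ?_
  filter_upwards [self_mem_nhdsWithin] with s hs
  exact le_rearr_indicator hσ ht.1 hs.1 hs.2

lemma ae_rearr_indicator_eq (hσ : AntitoneOn σ (Ioo 0 T)) :
    ∀ᵐ t, t ∈ Ioo 0 T → rearr ((Ioo 0 T).indicator σ) t = σ t := by
  have h := (hσ.countable_not_continuousWithinAt).measure_zero volume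
  filter_upwards [compl_mem_ae_iff.2 h] with t ht htT
  refine rearr_indicator_eq hσ htT ?_
  by_contra hn
  exact ht ⟨htT, hn⟩

/-- A decreasing function has only countably many discontinuities, so it agrees a.e. with its
rearrangement. After this the cone norm is a plain weighted L_q norm. -/
lemma lorentzOn_eq {q : ℝ} (hq : 0 < q) (v : ℝ → ℝ) (hσ : AntitoneOn σ (Ioo 0 T)) :
    lorentzOn T q v σ = (∫⁻ t, σ t ^ q * ENNReal.ofReal (v t) ∂(leb T)) ^ (1 / q) := by
  unfold lorentzOn lorentz
  congr 1
  have h : ∀ᵐ t ∂(volume.restrict (Ioi 0)), rearr ((Ioo 0 T).indicator σ) t ^ q *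
      ENNReal.ofReal (v t) =
      (Ioo 0 T).indicator (fun t => σ t ^ q * ENNReal.ofReal (v t)) t := by
    rw [ae_restrict_iff' measurableSet_Ioi]
    filter_upwards [ae_rearr_indicator_eq hσ] with t ht ht0
    by_cases hT : t ∈ Ioo 0 T
    · rw [ht hT, indicator_of_mem hT]
    · have : T ≤ t := by
        by_contra hlt
        exact hT ⟨ht0, not_le.1 hlt⟩
      rw [rearr_indicator_of_le σ this, indicator_of_notMem hT, ENNReal.zero_rpow_of_pos hq,
        zero_mul]
  rw [lintegral_congr_ae h, setLIntegral_indicator measurableSet_Ioo]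
  congr 2
  exact inter_eq_left.2 fun t ht => ht.1

lemma aemeasurable_leb_of_antitoneOn (hσ : AntitoneOn σ (Ioo 0 T)) : AEMeasurable σ (leb T) :=
  aemeasurable_restrict_of_antitoneOn measurableSet_Ioo hσ

end Rearrangement

/-! ### Tonelli's theorem on plane sets -/

section Tonelli

variable {μ ν : Measure ℝ} [SFinite μ] [SFinite ν] {a b : ℝ → ℝ≥0∞}

lemma lintegral_mul_setLIntegral_swap {S : Set (ℝ × ℝ)} (hS : MeasurableSet S)
    (ha : AEMeasurable a μ) (hb : AEMeasurable b ν) :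
    ∫⁻ x, a x * ∫⁻ y in {y | (x, y) ∈ S}, b y ∂ν ∂μ =
      ∫⁻ y, b y * ∫⁻ x in {x | (x, y) ∈ S}, a x ∂μ ∂ν := by
  have h1 : ∀ x, a x * ∫⁻ y in {y | (x, y) ∈ S}, b y ∂ν =
      ∫⁻ y, S.indicator (fun z => a z.1 * b z.2) (x, y) ∂ν := fun x => by
    have hm : MeasurableSet {y | (x, y) ∈ S} := measurable_prodMk_left hS
    rw [← lintegral_indicator hm, ← lintegral_const_mul'' _ (hb.indicator hm)]
    refine lintegral_congr fun y => ?_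
    by_cases h : (x, y) ∈ S
    · simp [indicator, h]
    · simp [indicator, h]
  have h2 : ∀ y, b y * ∫⁻ x in {x | (x, y) ∈ S}, a x ∂μ =
      ∫⁻ x, S.indicator (fun z => a z.1 * b z.2) (x, y) ∂μ := fun y => by
    have hm : MeasurableSet {x | (x, y) ∈ S} := measurable_prodMk_right hS
    rw [← lintegral_indicator hm, ← lintegral_const_mul'' _ (ha.indicator hm)]
    refine lintegral_congr fun x => ?_
    by_cases h : (x, y) ∈ S
    · simp [indicator, h, mul_comm]
    · simp [indicator, h]
  simp only [h1, h2]
  exact lintegral_lintegral_swap ((ha.comp_fst.fun_mul hb.comp_snd).indicator hS)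

lemma lintegral_mul_setLIntegral_Ioi (ha : AEMeasurable a μ) (hb : AEMeasurable b ν) :
    ∫⁻ x, a x * ∫⁻ y in Ioi x, b y ∂ν ∂μ = ∫⁻ y, b y * ∫⁻ x in Iio y, a x ∂μ ∂ν :=
  lintegral_mul_setLIntegral_swap (measurableSet_lt measurable_fst measurable_snd) ha hb

end Tonelli

/-! ### Power integrals -/

lemma lintegral_rpow_Ioo {R a : ℝ} (hR : 0 < R) (ha : -1 < a) :
    ∫⁻ x in Ioo 0 R, ENNReal.ofReal (x ^ a) = ENNReal.ofReal (R ^ (a + 1) / (a + 1)) := by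
  have hi : IntegrableOn (fun x : ℝ => x ^ a) (Ioo 0 R) := by
    rw [← integrableOn_Ioc_iff_integrableOn_Ioo,
      ← intervalIntegrable_iff_integrableOn_Ioc_of_le hR.le]
    exact intervalIntegral.intervalIntegrable_rpow' ha
  rw [← ofReal_integral_eq_lintegral_ofReal hi]
  · rw [← integral_Ioc_eq_integral_Ioo, ← intervalIntegral.integral_of_le hR.le,
      integral_rpow (Or.inl ha), Real.zero_rpow (by linarith), sub_zero]
  · exact (ae_restrict_iff' measurableSet_Ioo).2
      (Filter.Eventually.of_forall fun x hx => Real.rpow_nonneg hx.1.le _)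

lemma lintegral_rpow_Ioi {c a : ℝ} (hc : 0 < c) (ha : 0 < a) :
    ∫⁻ x in Ioi c, ENNReal.ofReal (x ^ (-a - 1)) = ENNReal.ofReal (c ^ (-a) / a) := by
  rw [← ofReal_integral_eq_lintegral_ofReal (integrableOn_Ioi_rpow_of_lt (by linarith) hc)]
  · rw [integral_Ioi_rpow_of_lt (by linarith) hc]
    congr 1
    rw [sub_add_cancel, neg_div_neg_eq]
  · exact (ae_restrict_iff' measurableSet_Ioi).2
      (Filter.Eventually.of_forall fun x hx => Real.rpow_nonneg (hc.trans hx).le _)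

/-! ### Weights -/

structure IsWeight (v : ℝ → ℝ) : Prop where
  meas : AEMeasurable v (volume.restrict (Ioi 0))
  pos : ∀ t : ℝ, 0 < t → 0 < v t
  fin : ∀ t : ℝ, 0 < t → primV v t < ∞

/-- The measure `v dt` on `(0,T)`. -/
noncomputable def wMeas (T : ℝ) (v : ℝ → ℝ) : Measure ℝ :=
  (leb T).withDensity fun t => ENNReal.ofReal (v t)

section Weight

variable {v : ℝ → ℝ} {T : ℝ}

lemma primV_mono (v : ℝ → ℝ) : Monotone (primV v) := fun _ _ h =>
  lintegral_mono_set (Ioo_subset_Ioo_right h)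

lemma primV_of_nonpos (v : ℝ → ℝ) {t : ℝ} (ht : t ≤ 0) : primV v t = 0 := by
  simp [primV, Ioo_eq_empty ht.not_gt]

lemma IsWeight.aemeasurable (hv : IsWeight v) (T : ℝ) :
    AEMeasurable (fun t => ENNReal.ofReal (v t)) (leb T) :=
  (hv.meas.mono_measure (Measure.restrict_mono (fun _ h => h.1) le_rfl)).ennreal_ofReal

lemma wMeas_ac : wMeas T v ≪ leb T := withDensity_absolutelyContinuous _ _

lemma IsWeight.lintegral_wMeas (hv : IsWeight v) {f : ℝ → ℝ≥0∞} (hf : AEMeasurable f (leb T)) :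
    ∫⁻ t, f t ∂(wMeas T v) = ∫⁻ t, f t * ENNReal.ofReal (v t) ∂(leb T) := by
  unfold wMeas
  rw [lintegral_withDensity_eq_lintegral_mul₀ (hv.aemeasurable T) hf]
  exact lintegral_congr fun t => mul_comm _ _

lemma leb_restrict_Iio {t : ℝ} (ht : t ≤ T) : (leb T).restrict (Iio t) = volume.restrict (Ioo 0 t) := by
  unfold leb
  rw [Measure.restrict_restrict measurableSet_Iio]
  congr 1
  ext x
  simp only [mem_inter_iff, mem_Iio, mem_Ioo]
  constructor
  · rintro ⟨h1, h2, -⟩; exact ⟨h2, h1⟩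
  · rintro ⟨h1, h2⟩; exact ⟨h2, h1, h2.trans_le ht⟩

lemma leb_restrict_Ioi {t : ℝ} (ht : 0 ≤ t) : (leb T).restrict (Ioi t) = volume.restrict (Ioo t T) := by
  unfold leb
  rw [Measure.restrict_restrict measurableSet_Ioi]
  congr 1
  ext x
  simp only [mem_inter_iff, mem_Ioi, mem_Ioo]
  constructor
  · rintro ⟨h1, h2, h3⟩; exact ⟨h1, h3⟩
  · rintro ⟨h1, h2⟩; exact ⟨h1, ht.trans_lt h1, h2⟩

lemma wMeas_Iio {t : ℝ} (ht : t ≤ T) : wMeas T v (Iio t) = primV v t := by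
  unfold wMeas primV
  rw [withDensity_apply _ measurableSet_Iio, leb_restrict_Iio ht]

lemma ae_leb_mem : ∀ᵐ t ∂(leb T), t ∈ Ioo 0 T := ae_restrict_mem measurableSet_Ioo

lemma ae_wMeas_mem : ∀ᵐ t ∂(wMeas T v), t ∈ Ioo 0 T := wMeas_ac.ae_le ae_leb_mem

instance wMeas_noAtoms : NullSingletonClass (wMeas T v) :=
  ⟨fun x => wMeas_ac (by simp [leb])⟩

lemma wMeas_univ : wMeas T v univ = primV v T := by
  rw [← wMeas_Iio (T := T) le_rfl]
  refine measure_congr ?_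
  filter_upwards [ae_wMeas_mem] with t ht
  exact propext ⟨fun _ => ht.2, fun _ => trivial⟩

lemma IsWeight.isFiniteMeasure (hv : IsWeight v) (hT : 0 < T) : IsFiniteMeasure (wMeas T v) :=
  ⟨by rw [wMeas_univ]; exact hv.fin T hT⟩

lemma wMeas_Iic {t : ℝ} (ht : t ≤ T) : wMeas T v (Iic t) = primV v t := by
  rw [← wMeas_Iio ht]
  exact (measure_congr Iio_ae_eq_Iic).symm

lemma IsWeight.primV_ne_top (hv : IsWeight v) (t : ℝ) : primV v t ≠ ∞ := by
  rcases le_or_gt t 0 with h | h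
  · simp [primV_of_nonpos v h]
  · exact (hv.fin t h).ne

/-- Mass of an interval. -/
lemma primV_add {s t : ℝ} (hst : s ≤ t) (ht : t ≤ T) :
    primV v t = primV v s + wMeas T v (Ioo s t) := by
  rw [← wMeas_Iio ht, ← wMeas_Iio (hst.trans ht), measure_congr (Ioo_ae_eq_Ico (a := s) (b := t)),
    ← measure_union _ measurableSet_Ico, Iio_union_Ico_eq_Iio hst]
  exact disjoint_left.2 fun x hx hx' => hx.not_ge hx'.1

lemma IsWeight.wMeas_Ioo_pos (hv : IsWeight v) {s t : ℝ} (hs : 0 ≤ s) (hst : s < t) (ht : t ≤ T) :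
    0 < wMeas T v (Ioo s t) := by
  unfold wMeas
  rw [withDensity_apply _ measurableSet_Ioo]
  have h1 : (leb T).restrict (Ioo s t) = volume.restrict (Ioo s t) := by
    unfold leb
    rw [Measure.restrict_restrict measurableSet_Ioo, inter_eq_left.2 (Ioo_subset_Ioo hs ht)]
  rw [h1, pos_iff_ne_zero, ne_eq,
    lintegral_eq_zero_iff' (by rw [← h1]; exact (hv.aemeasurable T).restrict)]
  intro h0
  have h2 : ∀ᵐ x ∂(volume.restrict (Ioo s t)), False := by
    filter_upwards [h0, ae_restrict_mem measurableSet_Ioo] with x hx hxs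
    have := hv.pos x (hs.trans_lt hxs.1)
    simp only [Pi.zero_apply, ENNReal.ofReal_eq_zero] at hx
    linarith
  have h3 := ae_iff.1 h2
  simp only [not_false_eq_true, ofPred_true, Measure.restrict_apply_univ, Real.volume_Ioo,
    ENNReal.ofReal_eq_zero] at h3
  linarith

lemma IsWeight.primV_lt (hv : IsWeight v) {s t : ℝ} (hs : 0 ≤ s) (hst : s < t) :
    primV v s < primV v t := by
  rw [primV_add hst.le le_rfl]
  exact ENNReal.lt_add_right (hv.primV_ne_top s) (hv.wMeas_Ioo_pos hs hst le_rfl).ne'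

lemma IsWeight.primV_pos (hv : IsWeight v) {t : ℝ} (ht : 0 < t) : 0 < primV v t :=
  zero_le.trans_lt (hv.primV_lt le_rfl ht)

lemma IsWeight.continuousOn_primV (hv : IsWeight v) (hT : 0 < T) :
    ContinuousOn (fun t => (primV v t).toReal) (Icc 0 T) := by
  have hi : IntegrableOn v (Icc 0 T) := by
    rw [integrableOn_Icc_iff_integrableOn_Ioo]
    refine ⟨(hv.meas.mono_measure (Measure.restrict_mono (fun _ h => h.1) le_rfl)).aestronglyMeasurable, ?_⟩
    rw [hasFiniteIntegral_iff_ofReal]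
    · exact hv.fin T hT
    · exact (ae_restrict_iff' measurableSet_Ioo).2
        (Filter.Eventually.of_forall fun x hx => (hv.pos x hx.1).le)
  refine (intervalIntegral.continuousOn_primitive hi).congr fun t ht => ?_
  simp only
  rw [integral_Ioc_eq_integral_Ioo, integral_eq_lintegral_of_nonneg_ae]
  · rfl
  · exact (ae_restrict_iff' measurableSet_Ioo).2
        (Filter.Eventually.of_forall fun x hx => (hv.pos x hx.1).le)
  · exact (hv.meas.mono_measure (Measure.restrict_mono (fun _ h => h.1) le_rfl)).aestronglyMeasurable

lemma IsWeight.exists_primV_eq (hv : IsWeight v) (hT : 0 < T) {x : ℝ≥0∞} (hx : x ≤ primV v T) :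
    ∃ y ∈ Icc 0 T, primV v y = x := by
  have h := intermediate_value_Icc hT.le (hv.continuousOn_primV hT)
  have hxt : x ≠ ∞ := (hx.trans_lt (hv.fin T hT)).ne
  obtain ⟨y, hy, hyx⟩ := h (show x.toReal ∈ _ from
    ⟨by simp [primV_of_nonpos v le_rfl], ENNReal.toReal_mono (hv.primV_ne_top T) hx⟩)
  exact ⟨y, hy, (ENNReal.toReal_eq_toReal_iff' (hv.primV_ne_top y) hxt).1 hyx⟩

lemma IsWeight.monotone_toReal (hv : IsWeight v) : Monotone fun t => (primV v t).toReal :=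
  fun _ t h => ENNReal.toReal_mono (hv.primV_ne_top t) (primV_mono v h)

/-- The primitive of the weight transports the weighted measure to Lebesgue measure. -/
lemma IsWeight.map_primV (hv : IsWeight v) (hT : 0 < T) :
    (wMeas T v).map (fun t => (primV v t).toReal) = leb (primV v T).toReal := by
  have hm := hv.monotone_toReal.measurable
  have hfin := hv.isFiniteMeasure hT
  have hfm : IsFiniteMeasure ((wMeas T v).map (fun t => (primV v t).toReal)) :=
    Measure.isFiniteMeasure_map _ _
  -- It suffices to compare half-lines. For x between 0 and V(T), continuity gives y with V(y) = x,
  -- and strict monotonicity identifies the preimage with the half-line up to y.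
  refine Measure.ext_of_Iic _ _ fun x => ?_
  rw [Measure.map_apply hm measurableSet_Iic]
  rcases le_or_gt x 0 with hx | hx
  · have h1 : leb (primV v T).toReal (Iic x) = 0 := by
      unfold leb
      rw [Measure.restrict_apply measurableSet_Iic]
      convert measure_empty (μ := volume)
      ext y; simp only [mem_inter_iff, mem_Iic, mem_Ioo, mem_empty_iff_false, iff_false]
      rintro ⟨h1, h2, -⟩; linarith
    rw [h1]
    refine measure_mono_null (t := {t | t ∉ Ioo 0 T}) (fun t ht htT => ?_) (ae_iff.1 ae_wMeas_mem)
    have := ENNReal.toReal_pos (hv.primV_pos htT.1).ne' (hv.primV_ne_top t)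
    simp only [mem_preimage, mem_Iic] at ht
    linarith
  rcases le_or_gt (primV v T).toReal x with hx' | hx'
  · have h1 : leb (primV v T).toReal (Iic x) = primV v T := by
      unfold leb
      rw [Measure.restrict_apply measurableSet_Iic, inter_eq_right.2]
      · simp [hv.primV_ne_top T]
      · exact fun y hy => hy.2.le.trans hx'
    rw [h1, ← wMeas_univ]
    refine measure_congr ?_
    filter_upwards [ae_wMeas_mem] with t ht
    exact propext ⟨fun _ => trivial, fun _ => (hv.monotone_toReal ht.2.le).trans hx'⟩
  · have h1 : leb (primV v T).toReal (Iic x) = ENNReal.ofReal x := by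
      unfold leb
      rw [Measure.restrict_apply measurableSet_Iic]
      have : Iic x ∩ Ioo 0 (primV v T).toReal = Ioc 0 x := by
        ext y; simp only [mem_inter_iff, mem_Iic, mem_Ioo, mem_Ioc]
        constructor
        · rintro ⟨h1, h2, -⟩; exact ⟨h2, h1⟩
        · rintro ⟨h1, h2⟩; exact ⟨h2, h1, h2.trans_lt hx'⟩
      rw [this]; simp
    obtain ⟨y, hy, hyx⟩ := hv.exists_primV_eq hT (x := ENNReal.ofReal x)
      (by rw [← ENNReal.ofReal_toReal (hv.primV_ne_top T)]; exact ENNReal.ofReal_le_ofReal hx'.le)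
    have hyx' : (primV v y).toReal = x := by rw [hyx, ENNReal.toReal_ofReal hx.le]
    rw [h1, ← hyx, ← wMeas_Iic hy.2]
    congr 1
    ext t
    simp only [mem_preimage, mem_Iic]
    constructor
    · intro h
      by_contra hlt
      have := hv.primV_lt hy.1 (not_le.1 hlt)
      have := (ENNReal.toReal_lt_toReal (hv.primV_ne_top _) (hv.primV_ne_top _)).2 this
      linarith
    · intro h
      rw [← hyx']
      exact hv.monotone_toReal h

lemma IsWeight.primV_rpow (hv : IsWeight v) {t : ℝ} (ht : 0 < t) (a : ℝ) :
    primV v t ^ a = ENNReal.ofReal ((primV v t).toReal ^ a) := by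
  rw [← ENNReal.ofReal_rpow_of_pos (ENNReal.toReal_pos (hv.primV_pos ht).ne' (hv.primV_ne_top t)),
    ENNReal.ofReal_toReal (hv.primV_ne_top t)]

lemma IsWeight.setLIntegral_comp (hv : IsWeight v) (hT : 0 < T) {F : ℝ → ℝ≥0∞}
    (hF : Measurable F) {S : Set ℝ} (hS : MeasurableSet S) :
    ∫⁻ t in (fun t => (primV v t).toReal) ⁻¹' S, F (primV v t).toReal ∂(wMeas T v) =
      ∫⁻ x in S, F x ∂(leb (primV v T).toReal) := by
  rw [← hv.map_primV hT, setLIntegral_map hS hF hv.monotone_toReal.measurable]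

/-- The substitution x = V(s) turns v ds into dx, leaving an integral of x^a. -/
lemma IsWeight.lintegral_Iio_rpow (hv : IsWeight v) (hT : 0 < T) {r : ℝ} (hr : r ∈ Ioo 0 T) {a : ℝ}
    (ha : -1 < a) : ∫⁻ s in Iio r, primV v s ^ a ∂(wMeas T v) ≤
      ENNReal.ofReal (1 / (a + 1)) * primV v r ^ (a + 1) := by
  have hR := ENNReal.toReal_pos (hv.primV_pos hr.1).ne' (hv.primV_ne_top r)
  have hF : Measurable fun x : ℝ => ENNReal.ofReal (x ^ a) := by fun_prop
  calc ∫⁻ s in Iio r, primV v s ^ a ∂(wMeas T v)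
      = ∫⁻ s in Iio r, ENNReal.ofReal ((primV v s).toReal ^ a) ∂(wMeas T v) := by
        refine lintegral_congr_ae ?_
        filter_upwards [ae_restrict_of_ae ae_wMeas_mem] with s hs
        exact hv.primV_rpow hs.1 a
    _ ≤ ∫⁻ s in (fun t => (primV v t).toReal) ⁻¹' (Iio (primV v r).toReal),
          ENNReal.ofReal ((primV v s).toReal ^ a) ∂(wMeas T v) := by
        refine lintegral_mono' (Measure.restrict_mono' ?_ le_rfl) le_rfl
        filter_upwards [ae_wMeas_mem] with s hs hsr
        exact (ENNReal.toReal_lt_toReal (hv.primV_ne_top _) (hv.primV_ne_top _)).2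
          (hv.primV_lt hs.1.le hsr)
    _ = ∫⁻ x in Iio (primV v r).toReal, ENNReal.ofReal (x ^ a) ∂(leb (primV v T).toReal) :=
        hv.setLIntegral_comp hT hF measurableSet_Iio
    _ = ENNReal.ofReal ((primV v r).toReal ^ (a + 1) / (a + 1)) := by
        rw [leb_restrict_Iio (hv.monotone_toReal hr.2.le), lintegral_rpow_Ioo hR ha]
    _ = _ := by
        rw [hv.primV_rpow hr.1, ← ENNReal.ofReal_mul (by have : 0 < a + 1 := by linarith
                                                         positivity)]
        congr 1; ring

lemma IsWeight.lintegral_Ioi_rpow (hv : IsWeight v) (hT : 0 < T) {s : ℝ} (hs : 0 < s) {a : ℝ}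
    (ha : 0 < a) : ∫⁻ r in Ioi s, primV v r ^ (-a - 1) ∂(wMeas T v) ≤
      ENNReal.ofReal (1 / a) * primV v s ^ (-a) := by
  have hR := ENNReal.toReal_pos (hv.primV_pos hs).ne' (hv.primV_ne_top s)
  have hF : Measurable fun x : ℝ => ENNReal.ofReal (x ^ (-a - 1)) := by fun_prop
  calc ∫⁻ r in Ioi s, primV v r ^ (-a - 1) ∂(wMeas T v)
      = ∫⁻ r in Ioi s, ENNReal.ofReal ((primV v r).toReal ^ (-a - 1)) ∂(wMeas T v) := by
        refine lintegral_congr_ae ?_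
        filter_upwards [ae_restrict_of_ae ae_wMeas_mem] with s hs
        exact hv.primV_rpow hs.1 _
    _ ≤ ∫⁻ r in (fun t => (primV v t).toReal) ⁻¹' (Ioi (primV v s).toReal),
          ENNReal.ofReal ((primV v r).toReal ^ (-a - 1)) ∂(wMeas T v) := by
        refine lintegral_mono' (Measure.restrict_mono (fun r hr => ?_) le_rfl) le_rfl
        exact (ENNReal.toReal_lt_toReal (hv.primV_ne_top _) (hv.primV_ne_top _)).2
          (hv.primV_lt hs.le hr)
    _ = ∫⁻ x in Ioi (primV v s).toReal, ENNReal.ofReal (x ^ (-a - 1)) ∂(leb (primV v T).toReal) :=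
        hv.setLIntegral_comp hT hF measurableSet_Ioi
    _ ≤ ∫⁻ x in Ioi (primV v s).toReal, ENNReal.ofReal (x ^ (-a - 1)) :=
        lintegral_mono' (Measure.restrict_mono_measure Measure.restrict_le_self _) le_rfl
    _ = _ := by
        rw [lintegral_rpow_Ioi hR ha, hv.primV_rpow hs, ← ENNReal.ofReal_mul (by positivity)]
        congr 1; ring

end Weight

/-! ### Hardy's inequality with respect to v dt -/

section Hardy

variable {v : ℝ → ℝ} {T q : ℝ}

lemma holderConjugate_conjExponent (hq : 1 < q) : q.HolderConjugate q.conjExponent :=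
  Real.HolderConjugate.conjExponent hq

lemma measurable_primV (v : ℝ → ℝ) : Measurable (primV v) := (primV_mono v).measurable

/-- A weighted Hardy inequality for the operator adjoint to averaging against the weight. -/
lemma IsWeight.hardy (hv : IsWeight v) (hT : 0 < T) (hq : 1 < q) :
    ∃ C : ℝ≥0, 0 < C ∧ ∀ a : ℝ → ℝ≥0∞, AEMeasurable a (wMeas T v) →
      ∫⁻ s, (∫⁻ r in Ioi s, a r * (primV v r)⁻¹ ∂(wMeas T v)) ^ q ∂(wMeas T v) ≤
        C * ∫⁻ s, a s ^ q ∂(wMeas T v) := by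
  have hfin := hv.isFiniteMeasure hT
  set p := q.conjExponent with hp
  have hpq : q.HolderConjugate p := holderConjugate_conjExponent hq
  have hq0 : 0 < q := hpq.pos
  have hp0 : 0 < p := hpq.symm.pos
  have hq1 : 0 < q - 1 := by linarith
  have hpe : p = q / (q - 1) := rfl
  -- Hölder splits V^{-1} as V^{-1/(2q)} times V^{-1+1/(2q)}. The second factor raised to the power
  -- p is V^{-γ-1}, and its integrated tail enters the q-th power as V(s)^{-γ(q-1)} = V(s)^{-1/2}.
  set γ : ℝ := 1 / (2 * (q - 1)) with hγ
  have hγ0 : 0 < γ := by positivity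
  set C : ℝ≥0 := Real.toNNReal (1 / γ) ^ (q - 1) with hC
  have hC0 : 0 < C := NNReal.rpow_pos (by simpa using hγ0)
  have hCE : (C : ℝ≥0∞) = ENNReal.ofReal (1 / γ) ^ (q - 1) := by
    rw [hC, ENNReal.coe_rpow_of_nonneg _ hq1.le]; rfl
  refine ⟨2 * C, by positivity, fun a ha => ?_⟩
  set μ := wMeas T v
  have hVm := measurable_primV v
  set b : ℝ → ℝ≥0∞ := fun r => a r ^ q * primV v r ^ (-(1 / 2) : ℝ) with hb
  have hbm : AEMeasurable b μ := (ha.pow_const q).fun_mul (hVm.pow_const _).aemeasurable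
  have hpt : ∀ᵐ s ∂μ, (∫⁻ r in Ioi s, a r * (primV v r)⁻¹ ∂μ) ^ q ≤
      C * (primV v s ^ (-(1 / 2) : ℝ) * ∫⁻ r in Ioi s, b r ∂μ) := by
    filter_upwards [ae_wMeas_mem] with s hs
    have h1 : ∫⁻ r in Ioi s, a r * (primV v r)⁻¹ ∂μ ≤
        (∫⁻ r in Ioi s, b r ∂μ) ^ (1 / q) *
          (∫⁻ r in Ioi s, primV v r ^ (-γ - 1) ∂μ) ^ (1 / p) := by
      refine le_trans (le_of_eq ?_) ((ENNReal.lintegral_mul_le_Lp_mul_Lq (μ.restrict (Ioi s)) hpq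
        (f := fun r => a r * primV v r ^ (-(1 / (2 * q))))
        (g := fun r => primV v r ^ (-1 + 1 / (2 * q)))
        (ha.restrict.fun_mul (hVm.pow_const _).aemeasurable)
        (hVm.pow_const _).aemeasurable).trans (le_of_eq ?_))
      · refine lintegral_congr_ae ?_
        filter_upwards [ae_restrict_of_ae ae_wMeas_mem] with r hr
        have h0 := (hv.primV_pos hr.1).ne'
        have ht := hv.primV_ne_top r
        simp only [Pi.mul_apply]
        rw [mul_assoc, ← ENNReal.rpow_add _ _ h0 ht, ← ENNReal.rpow_neg_one]
        congr 2; ring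
      · congr 2
        · refine lintegral_congr fun r => ?_
          rw [ENNReal.mul_rpow_of_nonneg _ _ hq0.le, ← ENNReal.rpow_mul]
          simp only [hb]
          congr 2; field_simp
        · refine lintegral_congr fun r => ?_
          rw [← ENNReal.rpow_mul]
          congr 1
          rw [hpe, hγ]; field_simp; ring
    calc (∫⁻ r in Ioi s, a r * (primV v r)⁻¹ ∂μ) ^ q
        ≤ ((∫⁻ r in Ioi s, b r ∂μ) ^ (1 / q) *
          (ENNReal.ofReal (1 / γ) * primV v s ^ (-γ)) ^ (1 / p)) ^ q := by
          gcongr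
          refine h1.trans ?_
          gcongr
          exact hv.lintegral_Ioi_rpow hT hs.1 hγ0
      _ = _ := by
          rw [ENNReal.mul_rpow_of_nonneg _ _ hq0.le, ← ENNReal.rpow_mul, ← ENNReal.rpow_mul,
            one_div_mul_cancel hq0.ne', ENNReal.rpow_one]
          have e1 : 1 / p * q = q - 1 := by rw [hpe]; field_simp
          rw [e1, ENNReal.mul_rpow_of_nonneg _ _ hq1.le, ← ENNReal.rpow_mul, ← hCE]
          have e2 : -γ * (q - 1) = -(1 / 2) := by rw [hγ]; field_simp
          rw [e2]; ring
  calc ∫⁻ s, (∫⁻ r in Ioi s, a r * (primV v r)⁻¹ ∂μ) ^ q ∂μ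
      ≤ ∫⁻ s, C * (primV v s ^ (-(1 / 2) : ℝ) * ∫⁻ r in Ioi s, b r ∂μ) ∂μ := lintegral_mono_ae hpt
    _ = C * ∫⁻ s, primV v s ^ (-(1 / 2) : ℝ) * ∫⁻ r in Ioi s, b r ∂μ ∂μ :=
        lintegral_const_mul' _ _ ENNReal.coe_ne_top
    -- After Tonelli the inner integral of V^{-1/2} is at most 2V(r)^{1/2}, which cancels the factor
    -- V(r)^{-1/2} in b.
    _ = C * ∫⁻ r, b r * ∫⁻ s in Iio r, primV v s ^ (-(1 / 2) : ℝ) ∂μ ∂μ := by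
        rw [lintegral_mul_setLIntegral_Ioi (hVm.pow_const _).aemeasurable hbm]
    _ ≤ C * ∫⁻ r, 2 * a r ^ q ∂μ := by
        refine mul_le_mul_right (lintegral_mono_ae ?_) _
        filter_upwards [ae_wMeas_mem] with r hr
        refine (mul_le_mul_right (hv.lintegral_Iio_rpow hT hr (by norm_num)) _).trans (le_of_eq ?_)
        have h0 := (hv.primV_pos hr.1).ne'
        have ht := hv.primV_ne_top r
        simp only [hb]
        have e1 : primV v r ^ (-(1 / 2) : ℝ) * primV v r ^ (-(1 / 2) + 1 : ℝ) = 1 := by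
          rw [← ENNReal.rpow_add _ _ h0 ht]; norm_num
        have e2 : ENNReal.ofReal (1 / (-(1 / 2) + 1)) = 2 := by norm_num
        rw [e2]
        calc _ = 2 * a r ^ q * (primV v r ^ (-(1 / 2) : ℝ) * primV v r ^ (-(1 / 2) + 1 : ℝ)) := by ring
          _ = _ := by rw [e1, mul_one]
    _ = _ := by
        rw [lintegral_const_mul' _ _ (by simp)]
        push_cast; ring

end Hardy

/-! ### The kernel -/

/-- The profile `φ` as a function with values in `[0,∞]`. -/
noncomputable def ePhi (n : ℕ) (Φ : ℝ → ℝ) (τ : ℝ) : ℝ≥0∞ := ENNReal.ofReal (phi n Φ τ)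

/-- `t ^ a` as an element of `[0,∞]`. -/
noncomputable def ePow (t a : ℝ) : ℝ≥0∞ := ENNReal.ofReal (t ^ a)

section Kernel

variable {k n : ℕ} {Φ : ℝ → ℝ} {T : ℝ}

lemma unitBallVol_pos (hn : 1 ≤ n) : 0 < unitBallVol n := by
  have : Nonempty (Fin n) := ⟨⟨0, hn⟩⟩
  exact ENNReal.toReal_pos (Metric.measure_ball_pos _ _ one_pos).ne' measure_ball_lt_top.ne

lemma phi_arg_pos (hn : 1 ≤ n) {τ : ℝ} (hτ : 0 < τ) :
    0 < (τ / unitBallVol n) ^ (1 / (n : ℝ)) :=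
  Real.rpow_pos_of_pos (div_pos hτ (unitBallVol_pos hn)) _

lemma IsKernelProfile.phi_nonneg (hΦ : IsKernelProfile n Φ) (hn : 1 ≤ n) {τ : ℝ} (hτ : 0 < τ) :
    0 ≤ phi n Φ τ := hΦ.nonneg _ (phi_arg_pos hn hτ)

lemma IsKernelProfile.antitoneOn_phi (hΦ : IsKernelProfile n Φ) (hn : 1 ≤ n) :
    AntitoneOn (phi n Φ) (Ioi 0) := fun s hs t ht hst => by
  refine hΦ.antitoneOn (phi_arg_pos hn hs) (phi_arg_pos hn ht) ?_
  have := unitBallVol_pos hn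
  have hs' : (0 : ℝ) < s := hs
  exact Real.rpow_le_rpow (by positivity) (by gcongr) (by positivity)

lemma IsKernelProfile.antitoneOn_ePhi (hΦ : IsKernelProfile n Φ) (hn : 1 ≤ n) :
    AntitoneOn (ePhi n Φ) (Ioi 0) := fun _ hs _ ht hst =>
  ENNReal.ofReal_le_ofReal (hΦ.antitoneOn_phi hn hs ht hst)

lemma IsKernelProfile.aemeasurable_phi (hΦ : IsKernelProfile n Φ) (hn : 1 ≤ n) :
    AEMeasurable (phi n Φ) (leb T) :=
  aemeasurable_restrict_of_antitoneOn measurableSet_Ioo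
    ((hΦ.antitoneOn_phi hn).mono fun _ h => h.1)

lemma IsKernelProfile.aemeasurable_ePhi (hΦ : IsKernelProfile n Φ) (hn : 1 ≤ n) :
    AEMeasurable (ePhi n Φ) (leb T) := (hΦ.aemeasurable_phi hn).ennreal_ofReal

/-- The profile is positive near the origin. -/
lemma IsKernelProfile.exists_ePhi_pos (hΦ : IsKernelProfile n Φ) (hn : 1 ≤ n) :
    ∃ δ > 0, ∀ τ, 0 < τ → τ ≤ δ → 0 < ePhi n Φ τ := by
  obtain ⟨z, hz, hΦz⟩ : ∃ z, 0 < z ∧ 0 < Φ z := by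
    by_contra! hcon
    have h := hΦ.integral_pos
    rw [setLIntegral_congr_fun (g := fun _ => 0) measurableSet_Ioi] at h
    · simp at h
    · intro z hz
      have : Φ z = 0 := le_antisymm (hcon z hz) (hΦ.nonneg z hz)
      simp [this]
  have hV := unitBallVol_pos hn
  have hn0 : (n : ℝ) ≠ 0 := by positivity
  refine ⟨unitBallVol n * z ^ (n : ℝ), by positivity, fun τ hτ hle => ?_⟩
  refine ENNReal.ofReal_pos.2 (hΦz.trans_le ?_)
  refine hΦ.antitoneOn (phi_arg_pos hn hτ) hz ?_
  calc (τ / unitBallVol n) ^ (1 / (n : ℝ)) ≤ (z ^ (n : ℝ)) ^ (1 / (n : ℝ)) := by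
        refine Real.rpow_le_rpow (by positivity) ?_ (by positivity)
        rw [div_le_iff₀ hV]; linarith
    _ = z := by rw [← Real.rpow_mul hz.le, mul_one_div_cancel hn0, Real.rpow_one]

lemma primPhi_eq {t : ℝ} (ht : t ≤ T) :
    primPhi n Φ t = ∫⁻ τ in Iio t, ePhi n Φ τ ∂(leb T) := by
  rw [leb_restrict_Iio ht]; rfl

lemma primPhi_mono (n : ℕ) (Φ : ℝ → ℝ) : Monotone (primPhi n Φ) := fun _ _ h =>
  lintegral_mono_set (Ioo_subset_Ioo_right h)

/-- The denominator 1 + (τ/t)^κ is at least each of its terms. `omega_le` is used for τ < t and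
`omega_le'` for τ > t; from below, only the part τ ≤ t will be kept. -/
lemma IsKernelProfile.omega_le (hΦ : IsKernelProfile n Φ) (hn : 1 ≤ n) {t τ : ℝ} (ht : 0 < t)
    (hτ : 0 < τ) : Omega k n Φ t τ ≤ ePhi n Φ τ := by
  refine ENNReal.ofReal_le_ofReal (div_le_self (hΦ.phi_nonneg hn hτ) ?_)
  have : 0 ≤ (τ / t) ^ ((k : ℝ) / n) := by positivity
  linarith

lemma IsKernelProfile.omega_le' (hΦ : IsKernelProfile n Φ) (hn : 1 ≤ n) {t τ : ℝ} (ht : 0 < t)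
    (hτ : 0 < τ) : Omega k n Φ t τ ≤
      ePow t ((k : ℝ) / n) * (ePhi n Φ τ * ePow τ (-((k : ℝ) / n))) := by
  have h0 := hΦ.phi_nonneg hn hτ
  unfold ePow ePhi Omega
  rw [← ENNReal.ofReal_mul h0, ← ENNReal.ofReal_mul (by positivity)]
  refine ENNReal.ofReal_le_ofReal ?_
  rw [Real.rpow_neg hτ.le, Real.div_rpow hτ.le ht.le]
  have h1 : 0 < τ ^ ((k : ℝ) / n) := by positivity
  have h2 : 0 < t ^ ((k : ℝ) / n) := by positivity
  calc phi n Φ τ / (1 + τ ^ ((k : ℝ) / n) / t ^ ((k : ℝ) / n))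
      ≤ phi n Φ τ / (τ ^ ((k : ℝ) / n) / t ^ ((k : ℝ) / n)) := by
        gcongr; linarith
    _ = _ := by field_simp

lemma IsKernelProfile.le_omega (hΦ : IsKernelProfile n Φ) (hn : 1 ≤ n) {t τ : ℝ}
    (hτ : 0 < τ) (hτt : τ ≤ t) : 2⁻¹ * ePhi n Φ τ ≤ Omega k n Φ t τ := by
  have h0 := hΦ.phi_nonneg hn hτ
  have ht := hτ.trans_le hτt
  have h2 : (2⁻¹ : ℝ≥0∞) = ENNReal.ofReal 2⁻¹ := by
    rw [ENNReal.ofReal_inv_of_pos two_pos]; simp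
  unfold ePhi Omega
  rw [h2, ← ENNReal.ofReal_mul (by norm_num)]
  refine ENNReal.ofReal_le_ofReal ?_
  have h1 : (τ / t) ^ ((k : ℝ) / n) ≤ 1 :=
    Real.rpow_le_one (by positivity) ((div_le_one ht).2 hτt) (by positivity)
  have h3 : 0 ≤ (τ / t) ^ ((k : ℝ) / n) := by positivity
  rw [inv_mul_eq_div]
  gcongr
  linarith

lemma Represents.aemeasurable {σ h : ℝ → ℝ≥0∞} (hr : Represents k n Φ T σ h)
    (hΦ : IsKernelProfile n Φ) (hn : 1 ≤ n) (hσ : AntitoneOn σ (Ioo 0 T)) :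
    AEMeasurable h (leb T) := by
  have h1 : AEMeasurable (fun z : ℝ × ℝ => Omega k n Φ z.1 z.2 * σ z.2) ((leb T).prod (leb T)) := by
    refine AEMeasurable.fun_mul ?_ (aemeasurable_leb_of_antitoneOn hσ).comp_snd
    have h2 : Measurable fun z : ℝ × ℝ => 1 + (z.2 / z.1) ^ ((k : ℝ) / n) := by fun_prop
    exact ((hΦ.aemeasurable_phi hn).comp_snd.div h2.aemeasurable).ennreal_ofReal
  refine h1.lintegral_prod_right'.congr ?_
  filter_upwards [ae_leb_mem] with t ht
  exact (hr t ht).symm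

/-- The pairing with a function of the cone, from below. -/
lemma Represents.le_lintegral {σ h g : ℝ → ℝ≥0∞} (hr : Represents k n Φ T σ h)
    (hΦ : IsKernelProfile n Φ) (hn : 1 ≤ n) (hσ : AntitoneOn σ (Ioo 0 T))
    (hg : AEMeasurable g (leb T)) :
    2⁻¹ * ∫⁻ τ, ePhi n Φ τ * σ τ * ∫⁻ s in Ioi τ, g s ∂(leb T) ∂(leb T) ≤
      ∫⁻ t, h t * g t ∂(leb T) := by
  have hm : AEMeasurable (fun τ => ePhi n Φ τ * σ τ) (leb T) :=
    (hΦ.aemeasurable_ePhi hn).fun_mul (aemeasurable_leb_of_antitoneOn hσ)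
  rw [lintegral_mul_setLIntegral_Ioi hm hg, ← lintegral_const_mul' _ _ (by simp)]
  refine lintegral_mono_ae ?_
  filter_upwards [ae_leb_mem] with t ht
  rw [hr t ht, mul_comm (g t), ← mul_assoc]
  gcongr
  rw [← lintegral_const_mul' _ _ (by simp)]
  calc ∫⁻ τ in Iio t, 2⁻¹ * (ePhi n Φ τ * σ τ) ∂(leb T)
      ≤ ∫⁻ τ in Iio t, Omega k n Φ t τ * σ τ ∂(leb T) := by
        refine lintegral_mono_ae ?_
        filter_upwards [ae_restrict_of_ae ae_leb_mem, ae_restrict_mem measurableSet_Iio]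
          with τ hτ hτt
        rw [← mul_assoc]
        gcongr
        exact hΦ.le_omega hn hτ.1 hτt.le
    _ ≤ _ := lintegral_mono' Measure.restrict_le_self le_rfl

/-- The pairing with a function of the cone, from above. -/
lemma Represents.lintegral_le {σ h g : ℝ → ℝ≥0∞} (hr : Represents k n Φ T σ h)
    (hΦ : IsKernelProfile n Φ) (hn : 1 ≤ n) (hσ : AntitoneOn σ (Ioo 0 T))
    (hg : AEMeasurable g (leb T)) :
    ∫⁻ t, h t * g t ∂(leb T) ≤
      ∫⁻ τ, ePhi n Φ τ * σ τ * ∫⁻ s in Ioi τ, g s ∂(leb T) ∂(leb T) +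
      ∫⁻ t, g t * (ePow t ((k : ℝ) / n) *
        ∫⁻ τ in Ioi t, ePhi n Φ τ * ePow τ (-((k : ℝ) / n)) * σ τ ∂(leb T)) ∂(leb T) := by
  have hm : AEMeasurable (fun τ => ePhi n Φ τ * σ τ) (leb T) :=
    (hΦ.aemeasurable_ePhi hn).fun_mul (aemeasurable_leb_of_antitoneOn hσ)
  rw [lintegral_mul_setLIntegral_Ioi hm hg]
  have hm2 : AEMeasurable (fun t => g t * ∫⁻ τ in Iio t, ePhi n Φ τ * σ τ ∂(leb T)) (leb T) := by
    refine hg.fun_mul (Monotone.measurable fun s t hst => ?_).aemeasurable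
    exact lintegral_mono_set (Iio_subset_Iio hst)
  rw [← lintegral_add_left' hm2]
  refine lintegral_mono_ae ?_
  filter_upwards [ae_leb_mem] with t ht
  rw [hr t ht, mul_comm _ (g t), ← mul_add]
  gcongr
  have hsplit : ∫⁻ τ in Ioo 0 T, Omega k n Φ t τ * σ τ =
      ∫⁻ τ in Iio t, Omega k n Φ t τ * σ τ ∂(leb T) +
      ∫⁻ τ in Ioi t, Omega k n Φ t τ * σ τ ∂(leb T) := by
    have h1 := lintegral_add_compl (μ := leb T) (fun τ => Omega k n Φ t τ * σ τ)
      (measurableSet_Iio (a := t))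
    have : NullSingletonClass (leb T) := by unfold leb; infer_instance
    rw [compl_Iio, setLIntegral_congr Ioi_ae_eq_Ici.symm] at h1
    exact h1.symm
  rw [hsplit]
  refine add_le_add ?_ ?_
  · refine lintegral_mono_ae ?_
    filter_upwards [ae_restrict_of_ae ae_leb_mem] with τ hτ
    gcongr
    exact hΦ.omega_le hn ht.1 hτ.1
  · rw [← lintegral_const_mul' _ _ (by simp [ePow])]
    refine lintegral_mono_ae ?_
    filter_upwards [ae_restrict_of_ae ae_leb_mem] with τ hτ
    rw [← mul_assoc]
    gcongr
    exact hΦ.omega_le' hn ht.1 hτ.1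

end Kernel

/-! ### Lower estimate of the associate functional of the cone -/

section RhoTilde

variable {k n : ℕ} {Φ v : ℝ → ℝ} {T q : ℝ}

/-- The tail integral `∫_t^T g`. -/
noncomputable def tailInt (T : ℝ) (g : ℝ → ℝ≥0∞) (t : ℝ) : ℝ≥0∞ := ∫⁻ s in Ioi t, g s ∂(leb T)

lemma tailInt_antitone (T : ℝ) (g : ℝ → ℝ≥0∞) : Antitone (tailInt T g) := fun _ _ h =>
  lintegral_mono_set (Ioi_subset_Ioi h)

lemma measurable_tailInt (T : ℝ) (g : ℝ → ℝ≥0∞) : Measurable (tailInt T g) :=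
  (tailInt_antitone T g).measurable

lemma tailInt_eq (g : ℝ → ℝ≥0∞) {t : ℝ} (ht : 0 ≤ t) : tailInt T g t = ∫⁻ s in Ioo t T, g s := by
  rw [tailInt, leb_restrict_Ioi ht]

lemma tailInt_le (g : ℝ → ℝ≥0∞) (t : ℝ) : tailInt T g t ≤ ∫⁻ s, g s ∂(leb T) :=
  lintegral_mono' Measure.restrict_le_self le_rfl

lemma measurable_fnW (n : ℕ) (Φ v : ℝ → ℝ) : Measurable (fnW n Φ v) :=
  (measurable_primV v).inv.mul (primPhi_mono n Φ).measurable

lemma rhoTilde_one (g : ℝ → ℝ≥0∞) :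
    rhoTilde n Φ v T 1 g = ⨆ t ∈ Ioc 0 T, fnW n Φ v t * tailInt T g t := by
  rw [rhoTilde, if_pos rfl]
  refine iSup_congr fun t => iSup_congr fun ht => ?_
  rw [tailInt_eq g ht.1.le]; rfl

lemma IsWeight.rhoTilde_of_one_lt (hv : IsWeight v) (hq : 1 < q) (g : ℝ → ℝ≥0∞) :
    rhoTilde n Φ v T q g =
      (∫⁻ t, (fnW n Φ v t * tailInt T g t) ^ q.conjExponent ∂(wMeas T v)) ^
        (1 / q.conjExponent) := by
  rw [rhoTilde, if_neg hq.ne']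
  have hp0 := (holderConjugate_conjExponent hq).symm.pos
  rw [hv.lintegral_wMeas (((measurable_fnW n Φ v).fun_mul
    (measurable_tailInt T g)).pow_const _).aemeasurable]
  congr 1
  refine setLIntegral_congr_fun measurableSet_Ioo fun t ht => ?_
  simp only [fnw, fnW]
  rw [← tailInt_eq g ht.1.le, ← mul_assoc, mul_comm _ (primV v t ^ _), ENNReal.rpow_neg,
    ← ENNReal.inv_rpow, ← ENNReal.mul_rpow_of_nonneg _ _ hp0.le, mul_assoc]

/-- Makes `rhoTilde` finite at bounded functions. This is where the assumption on Ψ_q(T) enters: it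
lets R be finite at a positive function and permits division by finite integrals. -/
lemma IsWeight.rhoTilde_le (hv : IsWeight v) (hq : 1 ≤ q) (g : ℝ → ℝ≥0∞) :
    rhoTilde n Φ v T q g ≤ (∫⁻ t, g t ∂(leb T)) * Psi n Φ v q T := by
  rcases hq.eq_or_lt with rfl | hq
  · rw [rhoTilde_one, Psi, if_pos rfl]
    refine iSup₂_le fun t ht => ?_
    rw [mul_comm]
    gcongr
    · exact tailInt_le g t
    · exact le_iSup₂ (f := fun τ (_ : τ ∈ Ioc 0 T) => fnW n Φ v τ) t ht
  · have hp0 := (holderConjugate_conjExponent hq).symm.pos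
    rw [hv.rhoTilde_of_one_lt hq, Psi, if_neg hq.ne']
    set p := q.conjExponent
    have h1 : (∫⁻ t, g t ∂(leb T)) =
        ((∫⁻ t, g t ∂(leb T)) ^ p) ^ (1 / p) := by
      rw [← ENNReal.rpow_mul, mul_one_div_cancel hp0.ne', ENNReal.rpow_one]
    have h2 : ∫⁻ τ in Ioo 0 T, fnW n Φ v τ ^ p * ENNReal.ofReal (v τ) =
        ∫⁻ τ, fnW n Φ v τ ^ p ∂(wMeas T v) := by
      rw [hv.lintegral_wMeas ((measurable_fnW n Φ v).pow_const _).aemeasurable]; rfl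
    rw [h1, h2, ← ENNReal.mul_rpow_of_nonneg _ _ (by positivity : 0 ≤ 1 / p),
      ← lintegral_const_mul _ ((measurable_fnW n Φ v).pow_const _)]
    gcongr with t
    rw [← ENNReal.mul_rpow_of_nonneg _ _ hp0.le, mul_comm]
    gcongr
    exact tailInt_le g t

/-- Homogeneity: a bound on the Lorentz functional of a representing function bounds pairings. -/
lemma lintegral_le_mul_assocNorm_rhoK {σ h g : ℝ → ℝ≥0∞} {a : ℝ≥0∞} (hq : 1 ≤ q)
    (hΦ : IsKernelProfile n Φ) (hn : 1 ≤ n) (hσ : AntitoneOn σ (Ioo 0 T))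
    (hr : Represents k n Φ T σ h)
    (ha : lorentzOn T q v σ ≤ a) (ha0 : a ≠ 0) (hat : a ≠ ∞) :
    ∫⁻ t, h t * g t ∂(leb T) ≤ a * assocNorm T (rhoK k n Φ T q v) g := by
  have hq0 : 0 < q := by linarith
  have hait : a⁻¹ ≠ ∞ := ENNReal.inv_ne_top.2 ha0
  have hσ' : AntitoneOn (fun t => a⁻¹ * σ t) (Ioo 0 T) := fun s hs t ht hst => by
    have := hσ hs ht hst
    dsimp only; gcongr
  have hr' : Represents k n Φ T (fun t => a⁻¹ * σ t) (fun t => a⁻¹ * h t) := fun t ht => by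
    simp only
    rw [hr t ht, ← lintegral_const_mul' _ _ hait]
    refine lintegral_congr fun τ => ?_
    ring
  have hnorm : lorentzOn T q v (fun t => a⁻¹ * σ t) ≤ 1 := by
    have e : lorentzOn T q v (fun t => a⁻¹ * σ t) = a⁻¹ * lorentzOn T q v σ := by
      rw [lorentzOn_eq hq0 v hσ', lorentzOn_eq hq0 v hσ]
      simp only [ENNReal.mul_rpow_of_nonneg _ _ hq0.le, mul_assoc]
      rw [lintegral_const_mul' _ _ (ENNReal.rpow_ne_top_of_nonneg hq0.le hait),
        ENNReal.mul_rpow_of_nonneg _ _ (by positivity), ← ENNReal.rpow_mul,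
        mul_one_div_cancel hq0.ne', ENNReal.rpow_one]
    rw [e]
    calc a⁻¹ * lorentzOn T q v σ ≤ a⁻¹ * a := by gcongr
      _ = 1 := ENNReal.inv_mul_cancel ha0 hat
  have hh := hr.aemeasurable hΦ hn hσ
  have hrho : rhoK k n Φ T q v (fun t => a⁻¹ * h t) ≤ 1 :=
    (iInf₂_le_of_le (fun t => a⁻¹ * σ t) ⟨hσ', hnorm.trans_lt ENNReal.one_lt_top⟩
      (iInf_le _ hr')).trans hnorm
  calc ∫⁻ t, h t * g t ∂(leb T) = a * ∫⁻ t, a⁻¹ * h t * g t ∂(leb T) := by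
        rw [← lintegral_const_mul' _ _ hat]
        refine lintegral_congr fun t => ?_
        rw [← mul_assoc, ← mul_assoc, ENNReal.mul_inv_cancel ha0 hat, one_mul]
    _ ≤ _ := by gcongr; exact lintegral_le_assocNorm (hh.const_mul _) hrho g

/-- The function of the cone represented by `σ`. -/
noncomputable def coneFn (k n : ℕ) (Φ : ℝ → ℝ) (T : ℝ) (σ : ℝ → ℝ≥0∞) (t : ℝ) : ℝ≥0∞ :=
  ∫⁻ τ in Ioo 0 T, Omega k n Φ t τ * σ τ

lemma represents_coneFn (σ : ℝ → ℝ≥0∞) : Represents k n Φ T σ (coneFn k n Φ T σ) := fun _ _ => rfl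

/-- The indicator of (0,t) has norm V(t), and on (0,t) the tail of g is at least G(t). The factor 2
comes from the lower bound of the kernel. -/
lemma IsWeight.rhoTilde_one_le (hv : IsWeight v) (hΦ : IsKernelProfile n Φ)
    (hn : 1 ≤ n) {g : ℝ → ℝ≥0∞} (hg : AEMeasurable g (leb T)) :
    rhoTilde n Φ v T 1 g ≤ 2 * assocNorm T (rhoK k n Φ T 1 v) g := by
  rw [rhoTilde_one]
  refine iSup₂_le fun t ht => ?_
  set σ : ℝ → ℝ≥0∞ := (Iio t).indicator 1 with hσdef
  have hσ : AntitoneOn σ (Ioo 0 T) := fun a _ b _ hab => by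
    by_cases hb : b < t
    · simp [hσdef, hb, hab.trans_lt hb]
    · simp [hσdef, hb]
  have hV0 := (hv.primV_pos ht.1).ne'
  have hVt := hv.primV_ne_top t
  have hnorm : lorentzOn T 1 v σ ≤ primV v t := by
    rw [lorentzOn_eq one_pos v hσ, one_div_one, ENNReal.rpow_one, ← wMeas_Iio ht.2, wMeas,
      withDensity_apply _ measurableSet_Iio, ← lintegral_indicator measurableSet_Iio]
    refine le_of_eq (lintegral_congr fun s => ?_)
    by_cases hs : s < t
    · simp [hσdef, hs]
    · simp [hσdef, hs]
  have h1 := lintegral_le_mul_assocNorm_rhoK (k := k) le_rfl hΦ hn hσ (represents_coneFn σ) (g := g) hnorm hV0 hVt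
  have h2 := ((represents_coneFn (k := k) σ).le_lintegral hΦ hn hσ hg).trans h1
  have h3 : primPhi n Φ t * tailInt T g t ≤
      ∫⁻ τ, ePhi n Φ τ * σ τ * ∫⁻ s in Ioi τ, g s ∂(leb T) ∂(leb T) := by
    rw [primPhi_eq ht.2, ← lintegral_mul_const'' _ (hΦ.aemeasurable_ePhi hn).restrict,
      ← lintegral_indicator measurableSet_Iio]
    refine lintegral_mono fun τ => ?_
    by_cases hτ : τ < t
    · simp only [hσdef, mem_Iio, hτ, indicator_of_mem, Pi.one_apply, mul_one]
      gcongr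
      exact tailInt_antitone T g hτ.le
    · simp [hτ]
  calc fnW n Φ v t * tailInt T g t
      = 2 * (primV v t)⁻¹ * (2⁻¹ * (primPhi n Φ t * tailInt T g t)) := by
        rw [fnW]
        calc _ = (2 * 2⁻¹) * ((primV v t)⁻¹ * primPhi n Φ t * tailInt T g t) := by
              rw [ENNReal.mul_inv_cancel (by simp) (by simp), one_mul]
          _ = _ := by ring
    _ ≤ 2 * (primV v t)⁻¹ * (primV v t * assocNorm T (rhoK k n Φ T 1 v) g) := by
        exact mul_le_mul_right ((mul_le_mul_right h3 _).trans h2) _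
    _ = 2 * ((primV v t)⁻¹ * primV v t) * assocNorm T (rhoK k n Φ T 1 v) g := by ring
    _ = _ := by rw [ENNReal.inv_mul_cancel hV0 hVt, mul_one]

/-- With Y = WG, the Hölder extremal Y^{p-1} need not decrease. Its tail integral σ against v/V
does, and Hardy's inequality bounds the q-th power of the norm of σ by CI. By Tonelli, σ still pairs
with φG to at least I, whence I ≤ 2(CI)^{1/q} R(g). -/
lemma IsWeight.rhoTilde_rpow_le_of_ne_top (hv : IsWeight v) (hΦ : IsKernelProfile n Φ)
    (hn : 1 ≤ n) (hT : 0 < T) (hq : 1 < q) {C : ℝ≥0} (hC0 : 0 < C)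
    (hC : ∀ a : ℝ → ℝ≥0∞, AEMeasurable a (wMeas T v) →
      ∫⁻ s, (∫⁻ r in Ioi s, a r * (primV v r)⁻¹ ∂(wMeas T v)) ^ q ∂(wMeas T v) ≤
        C * ∫⁻ s, a s ^ q ∂(wMeas T v)) {g : ℝ → ℝ≥0∞}
    (hg : AEMeasurable g (leb T))
    (hfin : ∫⁻ t, (fnW n Φ v t * tailInt T g t) ^ q.conjExponent ∂(wMeas T v) ≠ ∞) :
    ∫⁻ t, (fnW n Φ v t * tailInt T g t) ^ q.conjExponent ∂(wMeas T v) ≤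
      (2 * (C : ℝ≥0∞) ^ (1 / q) * assocNorm T (rhoK k n Φ T q v) g) ^ q.conjExponent := by
  have hfinm := hv.isFiniteMeasure hT
  have hpq := holderConjugate_conjExponent hq
  have hq0 := hpq.pos
  have hp0 := hpq.symm.pos
  have hp1 := hpq.symm.lt
  set p := q.conjExponent with hp
  set Y : ℝ → ℝ≥0∞ := fun t => fnW n Φ v t * tailInt T g t with hY
  have hYm : Measurable Y := (measurable_fnW n Φ v).mul (measurable_tailInt T g)
  set I := ∫⁻ t, Y t ^ p ∂(wMeas T v) with hI
  rcases eq_or_ne I 0 with h0 | h0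
  · rw [h0]; exact zero_le
  set a : ℝ → ℝ≥0∞ := fun t => Y t ^ (p - 1) with ha
  have ham : Measurable a := hYm.pow_const _
  have hVm := measurable_primV v
  set σ : ℝ → ℝ≥0∞ := fun s => ∫⁻ r in Ioi s, a r * (primV v r)⁻¹ ∂(wMeas T v) with hσdef
  have hσA : Antitone σ := fun s t hst => lintegral_mono_set (Ioi_subset_Ioi hst)
  have hσ : AntitoneOn σ (Ioo 0 T) := hσA.antitoneOn _
  set A : ℝ≥0∞ := ((C : ℝ≥0∞) * I) ^ (1 / q) with hA
  have hnorm : lorentzOn T q v σ ≤ A := by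
    rw [lorentzOn_eq hq0 v hσ, ← hv.lintegral_wMeas (hσA.measurable.pow_const _).aemeasurable]
    refine ENNReal.rpow_le_rpow ((hC a ham.aemeasurable).trans (le_of_eq ?_)) (by positivity)
    rw [hI]
    congr 1
    refine lintegral_congr fun t => ?_
    simp only [ha]
    rw [← ENNReal.rpow_mul]
    congr 1
    have := hpq.symm.sub_one_mul_conj
    linarith
  have hCE : (C : ℝ≥0∞) ≠ 0 := by simpa using hC0.ne'
  have hA0 : A ≠ 0 := by
    rw [hA, ne_eq, ENNReal.rpow_eq_zero_iff_of_pos (by positivity)]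
    exact mul_ne_zero hCE h0
  have hAt : A ≠ ∞ := ENNReal.rpow_ne_top_of_nonneg (by positivity)
    (ENNReal.mul_ne_top ENNReal.coe_ne_top hfin)
  have h1 := lintegral_le_mul_assocNorm_rhoK (k := k) hq.le hΦ hn hσ (represents_coneFn σ) (g := g) hnorm hA0 hAt
  have h2 := ((represents_coneFn (k := k) σ).le_lintegral hΦ hn hσ hg).trans h1
  have hm1 : AEMeasurable (fun τ => ePhi n Φ τ * tailInt T g τ) (leb T) :=
    (hΦ.aemeasurable_ePhi hn).fun_mul (measurable_tailInt T g).aemeasurable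
  -- Exchanging the integrals puts ∫_0^r φG inside; as G decreases this is at least G(r) ∫_0^r φ.
  have h3 : I ≤ ∫⁻ τ, ePhi n Φ τ * σ τ * ∫⁻ s in Ioi τ, g s ∂(leb T) ∂(leb T) := by
    calc I ≤ ∫⁻ r, a r * (primV v r)⁻¹ * ∫⁻ τ in Iio r, ePhi n Φ τ * tailInt T g τ ∂(leb T)
            ∂(wMeas T v) := by
          refine lintegral_mono_ae ?_
          filter_upwards [ae_wMeas_mem] with r hr
          calc Y r ^ p = a r * Y r := by
                simp only [ha]
                conv_rhs => rw [← ENNReal.rpow_one (Y r), ← ENNReal.rpow_mul,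
                  ← ENNReal.rpow_add_of_nonneg _ _ (by linarith) zero_le_one]
                congr 1; ring
            _ = a r * (primV v r)⁻¹ * (primPhi n Φ r * tailInt T g r) := by
                simp only [hY, fnW]; ring
            _ ≤ _ := by
                rw [primPhi_eq hr.2.le, ← lintegral_mul_const'' _ (hΦ.aemeasurable_ePhi hn).restrict]
                refine mul_le_mul_right (setLIntegral_mono' measurableSet_Iio fun τ hτ => ?_) _
                gcongr
                exact tailInt_antitone T g (le_of_lt hτ)
      _ = ∫⁻ τ, ePhi n Φ τ * tailInt T g τ * σ τ ∂(leb T) :=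
          (lintegral_mul_setLIntegral_Ioi hm1 (ham.mul hVm.inv).aemeasurable).symm
      _ = _ := lintegral_congr fun τ => by simp only [tailInt]; ring
  have h4 : I ≤ 2 * (A * assocNorm T (rhoK k n Φ T q v) g) := by
    calc I = 2 * (2⁻¹ * I) := by
          rw [← mul_assoc, ENNReal.mul_inv_cancel (by simp) (by simp), one_mul]
      _ ≤ _ := by
          exact mul_le_mul_right ((mul_le_mul_right h3 _).trans h2) _
  -- Division by I^{1/q}, possible because I is neither 0 nor ∞.
  have h5 : I ^ (1 / p) ≤ 2 * (C : ℝ≥0∞) ^ (1 / q) * assocNorm T (rhoK k n Φ T q v) g := by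
    have e1 : I ^ (1 / p) = I * I ^ (-(1 / q)) := by
      conv_rhs => rw [← ENNReal.rpow_one I, ← ENNReal.rpow_mul, ← ENNReal.rpow_add _ _ h0 hfin]
      congr 1
      have := hpq.inv_add_inv_eq_one
      simp only [one_div]; linarith
    have e2 : I ^ (1 / q) * I ^ (-(1 / q)) = 1 := by
      rw [← ENNReal.rpow_add _ _ h0 hfin]; simp
    rw [e1]
    calc I * I ^ (-(1 / q)) ≤ 2 * (A * assocNorm T (rhoK k n Φ T q v) g) * I ^ (-(1 / q)) := by
          gcongr
      _ = 2 * (C : ℝ≥0∞) ^ (1 / q) * assocNorm T (rhoK k n Φ T q v) g *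
          (I ^ (1 / q) * I ^ (-(1 / q))) := by
          rw [hA, ENNReal.mul_rpow_of_nonneg _ _ (by positivity)]; ring
      _ = _ := by rw [e2, mul_one]
  calc I = (I ^ (1 / p)) ^ p := by
        rw [← ENNReal.rpow_mul, one_div_mul_cancel hp0.ne', ENNReal.rpow_one]
    _ ≤ _ := by gcongr

/-- The lower estimate: `ϱ̃₀` is dominated by the associate functional of the cone. -/
lemma IsWeight.exists_rhoTilde_le (hv : IsWeight v) (hΦ : IsKernelProfile n Φ)
    (hn : 1 ≤ n) (hT : 0 < T) (hq : 1 ≤ q) (hΨ : Psi n Φ v q T < ∞) :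
    ∃ C : ℝ≥0, 0 < C ∧ ∀ g, AEMeasurable g (leb T) →
      rhoTilde n Φ v T q g ≤ C * assocNorm T (rhoK k n Φ T q v) g := by
  rcases hq.eq_or_lt with rfl | hq
  · exact ⟨2, two_pos, fun g hg => hv.rhoTilde_one_le hΦ hn hg⟩
  obtain ⟨C, hC0, hC⟩ := hv.hardy hT hq
  have hpq := holderConjugate_conjExponent hq
  have hq0 := hpq.pos
  have hp0 := hpq.symm.pos
  refine ⟨2 * C ^ (1 / q), mul_pos two_pos (NNReal.rpow_pos hC0), fun g hg => ?_⟩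
  have hCE : ((2 * C ^ (1 / q) : ℝ≥0) : ℝ≥0∞) = 2 * (C : ℝ≥0∞) ^ (1 / q) := by
    rw [ENNReal.coe_mul, ENNReal.coe_rpow_of_nonneg _ (by positivity)]; rfl
  rw [hCE, hv.rhoTilde_of_one_lt hq]
  set p := q.conjExponent with hp
  -- The previous lemma needs a finite integral. Truncations of g have one by the assumption on
  -- Ψ_q(T), and the bound passes to the limit by monotone convergence.
  set G : ℕ → ℝ → ℝ≥0∞ := fun j t => min (g t) j with hG
  have hGm : ∀ j, AEMeasurable (G j) (leb T) := fun j => hg.min aemeasurable_const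
  have hGmono : ∀ t, Monotone fun j => G j t := fun t i j hij => by
    simp only [hG]; gcongr
  have hGsup : ∀ t, ⨆ j, G j t = g t := fun t => by
    refine le_antisymm (iSup_le fun j => min_le_left _ _) ?_
    rcases eq_or_ne (g t) ∞ with h1 | h1
    · simp [hG, h1, ENNReal.iSup_natCast]
    · obtain ⟨j, hj⟩ := ENNReal.exists_nat_gt h1
      exact le_iSup_of_le j (le_min le_rfl hj.le)
  have htail : ∀ t, tailInt T g t = ⨆ j, tailInt T (G j) t := fun t => by
    simp only [tailInt, ← hGsup]
    exact lintegral_iSup' (fun j => (hGm j).restrict) (Filter.Eventually.of_forall hGmono)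
  have htmono : ∀ t, Monotone fun j => tailInt T (G j) t := fun t i j hij =>
    lintegral_mono fun s => hGmono s hij
  have h1 : ∫⁻ t, (fnW n Φ v t * tailInt T g t) ^ p ∂(wMeas T v) =
      ⨆ j, ∫⁻ t, (fnW n Φ v t * tailInt T (G j) t) ^ p ∂(wMeas T v) := by
    rw [← lintegral_iSup (fun j => ((measurable_fnW n Φ v).fun_mul (measurable_tailInt T _)).pow_const p)]
    · refine lintegral_congr fun t => ?_
      rw [htail, ENNReal.mul_iSup]
      exact (ENNReal.orderIsoRpow p hp0).map_iSup _
    · intro i j hij t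
      have := htmono t hij
      dsimp only at this ⊢
      gcongr
  have h2 : ∀ j, ∫⁻ t, (fnW n Φ v t * tailInt T (G j) t) ^ p ∂(wMeas T v) ≤
      (2 * (C : ℝ≥0∞) ^ (1 / q) * assocNorm T (rhoK k n Φ T q v) g) ^ p := fun j => by
    have hfin : ∫⁻ t, (fnW n Φ v t * tailInt T (G j) t) ^ p ∂(wMeas T v) ≠ ∞ := by
      intro htop
      have h3 : rhoTilde n Φ v T q (G j) < ∞ := by
        refine (hv.rhoTilde_le hq.le _).trans_lt (ENNReal.mul_lt_top ?_ hΨ)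
        calc ∫⁻ t, G j t ∂(leb T) ≤ ∫⁻ _, (j : ℝ≥0∞) ∂(leb T) := lintegral_mono fun t => min_le_right _ _
          _ < ∞ := by
            rw [lintegral_const]
            exact ENNReal.mul_lt_top (ENNReal.natCast_lt_top j) (measure_lt_top _ _)
      rw [hv.rhoTilde_of_one_lt hq, ← hp, htop, ENNReal.top_rpow_of_pos (by positivity)] at h3
      exact lt_irrefl _ h3
    refine (hv.rhoTilde_rpow_le_of_ne_top (k := k) hΦ hn hT hq hC0 hC (hGm j) hfin).trans ?_
    gcongr
    exact assocNorm_mono (Filter.Eventually.of_forall fun t => min_le_left _ _)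
  calc (∫⁻ t, (fnW n Φ v t * tailInt T g t) ^ p ∂(wMeas T v)) ^ (1 / p)
      ≤ ((2 * (C : ℝ≥0∞) ^ (1 / q) * assocNorm T (rhoK k n Φ T q v) g) ^ p) ^ (1 / p) := by
        gcongr
        rw [h1]; exact iSup_le h2
    _ = _ := by rw [← ENNReal.rpow_mul, mul_one_div_cancel hp0.ne', ENNReal.rpow_one]

end RhoTilde

/-! ### Powers -/

section Powers

lemma ePow_ne_top (t a : ℝ) : ePow t a ≠ ∞ := ENNReal.ofReal_ne_top

lemma ePow_ne_zero {t : ℝ} (ht : 0 < t) (a : ℝ) : ePow t a ≠ 0 := by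
  simpa [ePow] using Real.rpow_pos_of_pos ht a

lemma ePow_mul_ePow {t : ℝ} (ht : 0 < t) (a b : ℝ) : ePow t a * ePow t b = ePow t (a + b) := by
  unfold ePow
  rw [← ENNReal.ofReal_mul (by positivity), ← Real.rpow_add ht]

lemma ePow_zero (t : ℝ) : ePow t 0 = 1 := by simp [ePow]

lemma ePow_mul_neg {t : ℝ} (ht : 0 < t) (a : ℝ) : ePow t a * ePow t (-a) = 1 := by
  rw [ePow_mul_ePow ht, add_neg_cancel, ePow_zero]

lemma ePow_rpow {t : ℝ} (ht : 0 < t) (a b : ℝ) : ePow t a ^ b = ePow t (a * b) := by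
  unfold ePow
  rw [ENNReal.ofReal_rpow_of_pos (by positivity), ← Real.rpow_mul ht.le]

lemma ePow_mul_base {s t : ℝ} (hs : 0 ≤ s) (ht : 0 ≤ t) (a : ℝ) :
    ePow (s * t) a = ePow s a * ePow t a := by
  unfold ePow
  rw [← ENNReal.ofReal_mul (by positivity), ← Real.mul_rpow hs ht]

lemma ePow_le_ePow {s t a : ℝ} (hs : 0 ≤ s) (hst : s ≤ t) (ha : 0 ≤ a) : ePow s a ≤ ePow t a :=
  ENNReal.ofReal_le_ofReal (Real.rpow_le_rpow hs hst ha)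

lemma ePow_le_ePow_of_nonpos {s t a : ℝ} (hs : 0 < s) (hst : s ≤ t) (ha : a ≤ 0) :
    ePow t a ≤ ePow s a :=
  ENNReal.ofReal_le_ofReal (Real.rpow_le_rpow_of_nonpos hs hst ha)

lemma ePow_one (t : ℝ) : ePow t 1 = ENNReal.ofReal t := by simp [ePow]

lemma measurable_ePow (a : ℝ) : Measurable fun t => ePow t a := by
  unfold ePow; fun_prop

lemma setLIntegral_ePow_Ioo {R a : ℝ} (hR : 0 < R) (ha : -1 < a) :
    ∫⁻ x in Ioo 0 R, ePow x a = ENNReal.ofReal (1 / (a + 1)) * ePow R (a + 1) := by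
  have : 0 < a + 1 := by linarith
  unfold ePow
  rw [lintegral_rpow_Ioo hR ha, ← ENNReal.ofReal_mul (by positivity)]
  congr 1; ring

end Powers

/-! ### Comparison of measures on logarithmic blocks -/

section Blocks

variable {T : ℝ}

/-- The τ whose block contains r fill [r, Nr). The crude bound 1/τ ≤ 1/r gives N - 1 in place of log
N. -/
lemma setLIntegral_block_le {N r : ℝ} (hN : 1 < N) (hr : 0 < r) :
    ∫⁻ τ in {τ | r ∈ Ioc (τ / N) τ}, ePow τ (-1) ∂(leb T) ≤ ENNReal.ofReal (N - 1) := by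
  have hS : {τ | r ∈ Ioc (τ / N) τ} = Ico r (N * r) := by
    ext τ
    simp only [mem_ofPred_eq, mem_Ioc, mem_Ico]
    rw [div_lt_iff₀ (by linarith), mul_comm r N]
    tauto
  rw [hS]
  calc ∫⁻ τ in Ico r (N * r), ePow τ (-1) ∂(leb T) ≤ ∫⁻ τ in Ico r (N * r), ePow τ (-1) :=
        lintegral_mono' (Measure.restrict_mono_measure Measure.restrict_le_self _) le_rfl
    _ ≤ ∫⁻ _ in Ico r (N * r), ePow r (-1) :=
        setLIntegral_mono' measurableSet_Ico fun τ hτ =>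
          ePow_le_ePow_of_nonpos hr hτ.1 (by norm_num)
    _ = ENNReal.ofReal (N - 1) := by
        rw [setLIntegral_const, Real.volume_Ico, ePow, ← ENNReal.ofReal_mul (by positivity)]
        congr 1
        rw [Real.rpow_neg_one]
        field_simp

/-- If `Y` is controlled on each block `(s/N, s]` by the integral of `Z`, then the logarithmic
integral of `Y` is controlled by the integral of `Z`. -/
lemma lintegral_mul_inv_le_of_block {m : Measure ℝ} [SFinite m] (hm : ∀ᵐ r ∂m, 0 < r) {N : ℝ}
    (hN : 1 < N) {Y Z : ℝ → ℝ≥0∞} (hZ : AEMeasurable Z m)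
    (h : ∀ s ∈ Ioo 0 T, Y s ≤ ∫⁻ r in Ioc (s / N) s, Z r ∂m) :
    ∫⁻ s, Y s * ePow s (-1) ∂(leb T) ≤ ENNReal.ofReal (N - 1) * ∫⁻ r, Z r ∂m := by
  have hS : MeasurableSet {z : ℝ × ℝ | z.2 ∈ Ioc (z.1 / N) z.1} :=
    (measurableSet_lt (by fun_prop) measurable_snd).inter (measurableSet_le measurable_snd measurable_fst)
  calc ∫⁻ s, Y s * ePow s (-1) ∂(leb T)
      ≤ ∫⁻ s, ePow s (-1) * ∫⁻ r in {r | (s, r) ∈ {z : ℝ × ℝ | z.2 ∈ Ioc (z.1 / N) z.1}}, Z r ∂m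
          ∂(leb T) := by
        refine lintegral_mono_ae ?_
        filter_upwards [ae_leb_mem] with s hs
        rw [mul_comm]
        exact mul_le_mul_right (h s hs) _
    _ = ∫⁻ r, Z r * ∫⁻ s in {s | r ∈ Ioc (s / N) s}, ePow s (-1) ∂(leb T) ∂m :=
        lintegral_mul_setLIntegral_swap hS (measurable_ePow _).aemeasurable hZ
    _ ≤ ∫⁻ r, Z r * ENNReal.ofReal (N - 1) ∂m := by
        refine lintegral_mono_ae ?_
        filter_upwards [hm] with r hr
        exact mul_le_mul_right (setLIntegral_block_le hN hr) _
    _ = _ := by rw [lintegral_mul_const' _ _ ENNReal.ofReal_ne_top, mul_comm]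

/-- The primitive of the weight at least doubles under a fixed dilation. -/
def ReverseDoubling (T : ℝ) (v : ℝ → ℝ) : Prop :=
  ∃ N : ℝ, 1 < N ∧ ∀ t ∈ Ioc 0 T, 2 * primV v (t / N) ≤ primV v t

variable {v : ℝ → ℝ}

/-- Reverse doubling says that the mass below t/N does not exceed the mass of the block (t/N, t]. -/
lemma IsWeight.primV_le_two_mul_block (hv : IsWeight v) {N : ℝ} (hN : 1 < N) {t : ℝ}
    (ht : t ∈ Ioc 0 T) (h : 2 * primV v (t / N) ≤ primV v t) :
    primV v t ≤ 2 * wMeas T v (Ioc (t / N) t) := by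
  have hle : t / N ≤ t := div_le_self ht.1.le hN.le
  have h1 := primV_add (v := v) hle ht.2
  rw [h1, two_mul] at h
  have h2 := (ENNReal.add_le_add_iff_left (hv.primV_ne_top _)).1 h
  calc primV v t = primV v (t / N) + wMeas T v (Ioo (t / N) t) := h1
    _ ≤ wMeas T v (Ioo (t / N) t) + wMeas T v (Ioo (t / N) t) := by gcongr
    _ = 2 * wMeas T v (Ioo (t / N) t) := (two_mul _).symm
    _ ≤ _ := by gcongr; exact Ioo_subset_Ioc_self

/-- Under reverse doubling the logarithmic integral of a function that does not grow too fast is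
controlled by its integral against `v / V`. -/
lemma IsWeight.lintegral_mul_inv_le (hv : IsWeight v) (hT : 0 < T) {N : ℝ} (hN : 1 < N)
    (hV : ∀ t ∈ Ioc 0 T, 2 * primV v (t / N) ≤ primV v t) {X : ℝ → ℝ≥0∞} (C : ℝ≥0∞)
    (hX : AEMeasurable X (leb T))
    (h : ∀ τ ∈ Ioo 0 T, ∀ r ∈ Ioc (τ / N) τ, X τ ≤ C * X r) :
    ∫⁻ τ, X τ * ePow τ (-1) ∂(leb T) ≤
      ENNReal.ofReal (N - 1) * (2 * C) * ∫⁻ r, (primV v r)⁻¹ * X r ∂(wMeas T v) := by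
  have hfin := hv.isFiniteMeasure hT
  have hZ : AEMeasurable (fun r => (primV v r)⁻¹ * X r) (wMeas T v) :=
    (measurable_primV v).inv.aemeasurable.fun_mul (hX.mono_ac wMeas_ac)
  rw [mul_assoc, ← lintegral_const_mul'' _ hZ]
  refine lintegral_mul_inv_le_of_block (ae_wMeas_mem.mono fun r hr => hr.1) hN
    (hZ.const_mul _) fun s hs => ?_
  have hs' : s ∈ Ioc 0 T := ⟨hs.1, hs.2.le⟩
  have hV0 := (hv.primV_pos hs.1).ne'
  -- V(s) is at most twice the mass of the block, so X(s) is bounded by an integral over the block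
  -- of 2X(s)/V(s). There 1/V(s) ≤ 1/V(r), and `h` compares X(s) with X(r).
  calc X s = primV v s * ((primV v s)⁻¹ * X s) := by
        rw [← mul_assoc, ENNReal.mul_inv_cancel hV0 (hv.primV_ne_top s), one_mul]
    _ ≤ 2 * wMeas T v (Ioc (s / N) s) * ((primV v s)⁻¹ * X s) := by
        gcongr; exact hv.primV_le_two_mul_block hN hs' (hV s hs')
    _ = ∫⁻ _ in Ioc (s / N) s, 2 * ((primV v s)⁻¹ * X s) ∂(wMeas T v) := by
        rw [setLIntegral_const]; ring
    _ ≤ _ := by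
        refine setLIntegral_mono' measurableSet_Ioc fun r hr => ?_
        calc 2 * ((primV v s)⁻¹ * X s) ≤ 2 * ((primV v r)⁻¹ * (C * X r)) := by
              gcongr
              · exact primV_mono v hr.2
              · exact h s hs r hr
          _ = _ := by ring

end Blocks

/-! ### The dual functional -/

section DualNorm

variable {v : ℝ → ℝ} {T q : ℝ} {n : ℕ} {Φ : ℝ → ℝ}

/-- The functional dual to `L_q` with the weight `v` on `(0,T)`. -/
noncomputable def dualNorm (T q : ℝ) (v : ℝ → ℝ) (Y : ℝ → ℝ≥0∞) : ℝ≥0∞ :=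
  if q = 1 then ⨆ t ∈ Ioc 0 T, Y t
  else (∫⁻ t, Y t ^ q.conjExponent ∂(wMeas T v)) ^ (1 / q.conjExponent)

lemma IsWeight.rhoTilde_eq_dualNorm (hv : IsWeight v) (hq : 1 ≤ q) (g : ℝ → ℝ≥0∞) :
    rhoTilde n Φ v T q g = dualNorm T q v fun t => fnW n Φ v t * tailInt T g t := by
  rcases hq.eq_or_lt with rfl | hq
  · rw [rhoTilde_one, dualNorm, if_pos rfl]
  · rw [hv.rhoTilde_of_one_lt hq, dualNorm, if_neg hq.ne']

lemma IsWeight.lintegral_mul_le_dualNorm (hv : IsWeight v) (hq : 1 ≤ q) {Y σ : ℝ → ℝ≥0∞}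
    (hY : AEMeasurable Y (leb T)) (hσ : AntitoneOn σ (Ioo 0 T)) :
    ∫⁻ t, Y t * σ t ∂(wMeas T v) ≤ dualNorm T q v Y * lorentzOn T q v σ := by
  have hσm := aemeasurable_leb_of_antitoneOn hσ
  rcases hq.eq_or_lt with rfl | hq
  · rw [lorentzOn_eq one_pos v hσ, dualNorm, if_pos rfl]
    simp only [ENNReal.rpow_one, one_div_one]
    rw [← hv.lintegral_wMeas hσm, ← lintegral_const_mul'' _ (hσm.mono_ac wMeas_ac)]
    refine lintegral_mono_ae ?_
    filter_upwards [ae_wMeas_mem] with t ht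
    gcongr
    exact le_iSup₂ (f := fun t (_ : t ∈ Ioc 0 T) => Y t) t ⟨ht.1, ht.2.le⟩
  · have hpq := holderConjugate_conjExponent hq
    rw [lorentzOn_eq hpq.pos v hσ, dualNorm, if_neg hq.ne',
      ← hv.lintegral_wMeas (hσm.pow_const _)]
    exact ENNReal.lintegral_mul_le_Lp_mul_Lq _ hpq.symm (hY.mono_ac wMeas_ac)
      (hσm.mono_ac wMeas_ac)

end DualNorm

/-! ### Elementary estimates for the profile -/

section Profile

variable {k n : ℕ} {Φ v : ℝ → ℝ} {T q : ℝ}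

lemma IsKernelProfile.mul_ePhi_le (hΦ : IsKernelProfile n Φ) (hn : 1 ≤ n) {t : ℝ} (ht : 0 < t) :
    ENNReal.ofReal t * ePhi n Φ t ≤ primPhi n Φ t := by
  calc ENNReal.ofReal t * ePhi n Φ t = ∫⁻ _ in Ioo 0 t, ePhi n Φ t := by
        rw [setLIntegral_const, Real.volume_Ioo, sub_zero, mul_comm]
    _ ≤ _ := setLIntegral_mono' measurableSet_Ioo fun τ hτ =>
        hΦ.antitoneOn_ePhi hn hτ.1 ht hτ.2.le

lemma IsKernelProfile.ePhi_le (hΦ : IsKernelProfile n Φ) (hn : 1 ≤ n) {t : ℝ} (ht : 0 < t) :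
    ePhi n Φ t ≤ primPhi n Φ t * ePow t (-1) := by
  have h := mul_le_mul_left (hΦ.mul_ePhi_le hn ht) (ePow t (-1))
  rw [← ePow_one, mul_right_comm, ePow_mul_neg ht, one_mul] at h
  exact h

/-- The mean of a decreasing function over (0,t) decreases in t: beyond r, φ is at most its mean
over (0,r). -/
lemma IsKernelProfile.primPhi_le_mul (hΦ : IsKernelProfile n Φ) (hn : 1 ≤ n) {r t : ℝ}
    (hr : 0 < r) (hrt : r ≤ t) : primPhi n Φ t ≤ ENNReal.ofReal (t / r) * primPhi n Φ r := by
  have h1 : primPhi n Φ t ≤ primPhi n Φ r + ∫⁻ τ in Ico r t, ePhi n Φ τ := by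
    refine le_trans (lintegral_mono_set fun τ hτ => ?_) (lintegral_union_le _ _ _)
    rcases lt_or_ge τ r with h | h
    · exact Or.inl ⟨hτ.1, h⟩
    · exact Or.inr ⟨h, hτ.2⟩
  have h2 : ∫⁻ τ in Ico r t, ePhi n Φ τ ≤ ENNReal.ofReal ((t - r) / r) * primPhi n Φ r := by
    calc ∫⁻ τ in Ico r t, ePhi n Φ τ ≤ ∫⁻ _ in Ico r t, ePhi n Φ r :=
          setLIntegral_mono' measurableSet_Ico fun τ hτ =>
            hΦ.antitoneOn_ePhi hn hr (hr.trans_le hτ.1) hτ.1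
      _ = ENNReal.ofReal (t - r) * ePhi n Φ r := by
          rw [setLIntegral_const, Real.volume_Ico, mul_comm]
      _ ≤ ENNReal.ofReal (t - r) * (primPhi n Φ r * ePow r (-1)) := by
          gcongr; exact hΦ.ePhi_le hn hr
      _ = _ := by
          rw [ePow, Real.rpow_neg_one, div_eq_mul_inv, ENNReal.ofReal_mul (by linarith)]; ring
  calc primPhi n Φ t ≤ 1 * primPhi n Φ r + ENNReal.ofReal ((t - r) / r) * primPhi n Φ r := by
        rw [one_mul]; exact h1.trans (by gcongr)
    _ = _ := by
        rw [← add_mul, ← ENNReal.ofReal_one, ← ENNReal.ofReal_add zero_le_one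
          (div_nonneg (by linarith) hr.le)]
        congr 2; field_simp; ring

end Profile

/-! ### The upper estimate under the first condition -/

section CaseA

variable {k n : ℕ} {Φ v : ℝ → ℝ} {T q : ℝ}

/-- V grows at least like t^ε, so the dilation N with N^ε = 2 works. -/
lemma reverseDoubling_of_antitoneOn {ε : ℝ} (hε : 0 < ε)
    (h : AntitoneOn (fun t => ENNReal.ofReal (t ^ ε) * (primV v t)⁻¹) (Ioc 0 T)) :
    ReverseDoubling T v := by
  set N : ℝ := 2 ^ (1 / ε) with hN
  have hN1 : 1 < N := Real.one_lt_rpow one_lt_two (by positivity)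
  have hN0 : 0 < N := by linarith
  refine ⟨N, hN1, fun t ht => ?_⟩
  have hs : t / N ∈ Ioc 0 T := ⟨div_pos ht.1 hN0, (div_le_self ht.1.le hN1.le).trans ht.2⟩
  have h1 := h hs ht (div_le_self ht.1.le hN1.le)
  simp only at h1
  have hNε : N ^ ε = 2 := by
    rw [hN, ← Real.rpow_mul two_pos.le, one_div_mul_cancel hε.ne', Real.rpow_one]
  have e1 : t ^ ε = 2 * (t / N) ^ ε := by
    rw [Real.div_rpow ht.1.le hN0.le, hNε]; ring
  have hp : 0 < (t / N) ^ ε := Real.rpow_pos_of_pos hs.1 _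
  rw [e1, ENNReal.ofReal_mul two_pos.le, mul_comm (ENNReal.ofReal 2), mul_assoc,
    ENNReal.mul_le_mul_iff_right (by simpa using hp) ENNReal.ofReal_ne_top] at h1
  have h2 := ENNReal.inv_le_inv.2 h1
  rw [inv_inv, ENNReal.mul_inv (Or.inl (by simp)) (Or.inl (by simp)), inv_inv] at h2
  calc 2 * primV v (t / N) ≤ 2 * ((ENNReal.ofReal 2)⁻¹ * primV v t) := by gcongr
    _ = _ := by
      rw [← mul_assoc, ENNReal.ofReal_ofNat, ENNReal.mul_inv_cancel (by simp) (by simp), one_mul]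

lemma CondA.exists_lintegral_le (hA : CondA k n Φ v T) (hv : IsWeight v)
    (hΦ : IsKernelProfile n Φ) (hn : 1 ≤ n) (hT : 0 < T) (hq : 1 ≤ q) :
    ∃ C : ℝ≥0, ∀ σ h g : ℝ → ℝ≥0∞, AntitoneOn σ (Ioo 0 T) → Represents k n Φ T σ h →
      AEMeasurable g (leb T) →
      ∫⁻ t, h t * g t ∂(leb T) ≤ C * (lorentzOn T q v σ * rhoTilde n Φ v T q g) := by
  obtain ⟨⟨d, hd0, hd⟩, ε, hε, hant⟩ := hA
  obtain ⟨N, hN, hV⟩ := reverseDoubling_of_antitoneOn hε hant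
  refine ⟨(1 + d) * (Real.toNNReal (N - 1) * (2 * Real.toNNReal N)), fun σ h g hσ hr hg => ?_⟩
  have hσm := aemeasurable_leb_of_antitoneOn hσ
  have hm : AEMeasurable (fun τ => ePhi n Φ τ * σ τ) (leb T) := (hΦ.aemeasurable_ePhi hn).fun_mul hσm
  set J := ∫⁻ τ, ePhi n Φ τ * σ τ * ∫⁻ s in Ioi τ, g s ∂(leb T) ∂(leb T) with hJ
  set κ : ℝ := (k : ℝ) / n with hκ
  -- For τ > t, σ(τ) ≤ σ(t), so the integral condition applies with σ(t) taken out. Then σ(t) goes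
  -- back under the integral of φ over (0,t), where σ is larger.
  have h2 : ∫⁻ t, g t * (ePow t κ * ∫⁻ τ in Ioi t, ePhi n Φ τ * ePow τ (-κ) * σ τ ∂(leb T))
      ∂(leb T) ≤ d * J := by
    rw [hJ, lintegral_mul_setLIntegral_Ioi hm hg, ← lintegral_const_mul' _ _ ENNReal.coe_ne_top]
    refine lintegral_mono_ae ?_
    filter_upwards [ae_leb_mem] with t ht
    have e1 : ∫⁻ τ in Ioi t, ePhi n Φ τ * ePow τ (-κ) * σ τ ∂(leb T) ≤
        d * (ePow t (-κ) * primPhi n Φ t) * σ t := by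
      rw [leb_restrict_Ioi ht.1.le]
      calc ∫⁻ τ in Ioo t T, ePhi n Φ τ * ePow τ (-κ) * σ τ
          ≤ ∫⁻ τ in Ioo t T, ENNReal.ofReal (τ ^ (-κ) * phi n Φ τ) * σ t := by
            refine setLIntegral_mono' measurableSet_Ioo fun τ hτ => ?_
            have hτ0 := ht.1.trans hτ.1
            rw [mul_comm (ePhi n Φ τ), ePow, ePhi, ← ENNReal.ofReal_mul (by positivity)]
            gcongr
            exact hσ ht ⟨hτ0, hτ.2⟩ hτ.1.le
        _ = (∫⁻ τ in Ioo t T, ENNReal.ofReal (τ ^ (-κ) * phi n Φ τ)) * σ t := by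
            refine lintegral_mul_const'' _ ?_
            have h3 : AEMeasurable (fun τ => τ ^ (-κ) * phi n Φ τ) (leb T) :=
              (by fun_prop : Measurable fun τ : ℝ => τ ^ (-κ)).aemeasurable.mul
                (hΦ.aemeasurable_phi hn)
            exact h3.ennreal_ofReal.mono_measure
              (Measure.restrict_mono (Ioo_subset_Ioo_left ht.1.le) le_rfl)
        _ ≤ _ := by gcongr; exact hd t ⟨ht.1, ht.2.le⟩
    have e2 : primPhi n Φ t * σ t ≤ ∫⁻ τ in Iio t, ePhi n Φ τ * σ τ ∂(leb T) := by
      rw [leb_restrict_Iio ht.2.le]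
      calc primPhi n Φ t * σ t = ∫⁻ τ in Ioo 0 t, ePhi n Φ τ * σ t := by
            refine (lintegral_mul_const'' _ ?_).symm
            exact (hΦ.aemeasurable_ePhi hn).mono_measure
              (Measure.restrict_mono (Ioo_subset_Ioo_right ht.2.le) le_rfl)
        _ ≤ _ := by
            refine setLIntegral_mono' measurableSet_Ioo fun τ hτ => ?_
            gcongr
            exact hσ ⟨hτ.1, hτ.2.trans ht.2⟩ ht hτ.2.le
    calc g t * (ePow t κ * ∫⁻ τ in Ioi t, ePhi n Φ τ * ePow τ (-κ) * σ τ ∂(leb T))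
        ≤ g t * (ePow t κ * (d * (ePow t (-κ) * primPhi n Φ t) * σ t)) := by gcongr
      _ = d * (g t * (ePow t κ * ePow t (-κ) * (primPhi n Φ t * σ t))) := by ring
      _ ≤ _ := by
          rw [ePow_mul_neg ht.1, one_mul]
          gcongr
  set X : ℝ → ℝ≥0∞ := fun τ => primPhi n Φ τ * tailInt T g τ * σ τ with hX
  have hXm : AEMeasurable X (leb T) :=
    ((primPhi_mono n Φ).measurable.fun_mul (measurable_tailInt T g)).aemeasurable.fun_mul hσm
  have h3 : J ≤ ∫⁻ τ, X τ * ePow τ (-1) ∂(leb T) := by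
    refine lintegral_mono_ae ?_
    filter_upwards [ae_leb_mem] with τ hτ
    calc ePhi n Φ τ * σ τ * tailInt T g τ
        ≤ primPhi n Φ τ * ePow τ (-1) * σ τ * tailInt T g τ := by
          gcongr; exact hΦ.ePhi_le hn hτ.1
      _ = _ := by simp only [hX]; ring
  -- Going from r up to τ < Nr, the primitive of φ grows at most by the factor N, while σ and G
  -- decrease.
  have h4 := hv.lintegral_mul_inv_le hT hN hV (ENNReal.ofReal N) hXm fun τ hτ r hr => by
    have hr0 : 0 < r := (div_pos hτ.1 (by linarith)).trans hr.1
    have e : primPhi n Φ τ ≤ ENNReal.ofReal N * primPhi n Φ r := by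
      refine (hΦ.primPhi_le_mul hn hr0 hr.2).trans ?_
      gcongr
      rw [div_le_iff₀ hr0]
      have := (div_lt_iff₀ (by linarith : (0:ℝ) < N)).1 hr.1
      linarith
    calc X τ ≤ ENNReal.ofReal N * primPhi n Φ r * tailInt T g r * σ r := by
          simp only [hX]
          gcongr
          · exact tailInt_antitone T g hr.2
          · exact hσ ⟨hr0, hr.2.trans_lt hτ.2⟩ hτ hr.2
      _ = _ := by simp only [hX]; ring
  have h5 : ∫⁻ r, (primV v r)⁻¹ * X r ∂(wMeas T v) ≤ rhoTilde n Φ v T q g * lorentzOn T q v σ := by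
    rw [hv.rhoTilde_eq_dualNorm hq]
    refine le_trans (le_of_eq ?_) (hv.lintegral_mul_le_dualNorm hq
      ((measurable_fnW n Φ v).fun_mul (measurable_tailInt T g)).aemeasurable hσ)
    refine lintegral_congr fun r => ?_
    simp only [hX, fnW]; ring
  calc ∫⁻ t, h t * g t ∂(leb T) ≤ J + d * J :=
        (hr.lintegral_le hΦ hn hσ hg).trans (by gcongr)
    _ = (1 + d) * J := by ring
    _ ≤ (1 + d) * (ENNReal.ofReal (N - 1) * (2 * ENNReal.ofReal N) *
        (rhoTilde n Φ v T q g * lorentzOn T q v σ)) := by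
        gcongr
        exact h3.trans (h4.trans (by gcongr))
    _ = _ := by
        rw [ENNReal.coe_mul, ENNReal.coe_mul, ENNReal.coe_mul, ENNReal.coe_add]
        simp only [ENNReal.ofReal, ENNReal.coe_one, ENNReal.coe_ofNat]
        ring

end CaseA

/-! ### Doubling of the primitive of the weight -/

section Doubling

variable {v : ℝ → ℝ} {q : ℝ}

/-- For q = 1 the bound on V(2t)/(2t) gives 2c. For q > 1, τ^{-q} ≥ (2t)^{-q} on (t,2t), so the tail
condition controls V(2t) - V(t) by 2^q c V(t). -/
lemma NormableWeight.exists_doubling (h : NormableWeight q v) (hv : IsWeight v) (hq : 1 ≤ q) :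
    ∃ D : ℝ≥0, 0 < D ∧ ∀ t, 0 < t → primV v (2 * t) ≤ D * primV v t := by
  obtain ⟨c, hc, h1, h2⟩ := h
  rcases hq.eq_or_lt with rfl | hq
  · refine ⟨2 * c, by positivity, fun t ht => ?_⟩
    have h3 := h1 rfl t (2 * t) ht (by linarith)
    rw [ENNReal.div_le_iff (by simpa using ht) ENNReal.ofReal_ne_top] at h3
    refine h3.trans (le_of_eq ?_)
    have ht' : ENNReal.ofReal t ≠ 0 := by simpa using ht
    rw [ENNReal.ofReal_mul two_pos.le, ENNReal.ofReal_ofNat, ENNReal.div_eq_inv_mul]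
    push_cast
    calc (c : ℝ≥0∞) * ((ENNReal.ofReal t)⁻¹ * primV v t) * (2 * ENNReal.ofReal t)
        = ((ENNReal.ofReal t)⁻¹ * ENNReal.ofReal t) * (2 * c * primV v t) := by ring
      _ = _ := by rw [ENNReal.inv_mul_cancel ht' ENNReal.ofReal_ne_top, one_mul]
  · refine ⟨1 + Real.toNNReal (2 ^ q) * c, by positivity, fun t ht => ?_⟩
    have h3 := h2 hq t ht
    have h4 : wMeas (2 * t) v (Ioo t (2 * t)) ≤ ENNReal.ofReal (2 ^ q) * (c * primV v t) := by
      have e0 : wMeas (2 * t) v (Ioo t (2 * t)) = ∫⁻ τ in Ioo t (2 * t), ENNReal.ofReal (v τ) := by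
        rw [wMeas, withDensity_apply _ measurableSet_Ioo]
        unfold leb
        rw [Measure.restrict_restrict measurableSet_Ioo,
          inter_eq_left.2 (Ioo_subset_Ioo_left ht.le)]
      rw [e0]
      calc ∫⁻ τ in Ioo t (2 * t), ENNReal.ofReal (v τ)
          ≤ ∫⁻ τ in Ioo t (2 * t), ENNReal.ofReal ((2 * t) ^ q) * ENNReal.ofReal (τ ^ (-q) * v τ) := by
            refine setLIntegral_mono' measurableSet_Ioo fun τ hτ => ?_
            have hτ0 := ht.trans hτ.1
            rw [← ENNReal.ofReal_mul (by positivity)]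
            refine ENNReal.ofReal_le_ofReal ?_
            have hvτ := (hv.pos τ hτ0).le
            rw [← mul_assoc]
            refine le_mul_of_one_le_left hvτ ?_
            rw [Real.rpow_neg hτ0.le, ← div_eq_mul_inv, one_le_div (by positivity)]
            exact Real.rpow_le_rpow hτ0.le hτ.2.le (by linarith)
        _ ≤ ∫⁻ τ in Ioi t, ENNReal.ofReal ((2 * t) ^ q) * ENNReal.ofReal (τ ^ (-q) * v τ) :=
            lintegral_mono_set fun τ hτ => hτ.1
        _ = ENNReal.ofReal (2 ^ q) *
            (ENNReal.ofReal (t ^ q) * ∫⁻ τ in Ioi t, ENNReal.ofReal (τ ^ (-q) * v τ)) := by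
            rw [lintegral_const_mul' _ _ ENNReal.ofReal_ne_top, Real.mul_rpow two_pos.le ht.le,
              ENNReal.ofReal_mul (by positivity), mul_assoc]
        _ ≤ _ := by gcongr
    rw [primV_add (v := v) (T := 2 * t) (by linarith : t ≤ 2 * t) le_rfl]
    refine (add_le_add_right h4 _).trans (le_of_eq ?_)
    push_cast
    simp only [ENNReal.ofReal]
    ring

end Doubling

/-! ### The second condition -/

/-- The function `t^{1-k/n} φ(t)`. -/
noncomputable def fnE (k n : ℕ) (Φ : ℝ → ℝ) (t : ℝ) : ℝ≥0∞ :=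
  ENNReal.ofReal (t ^ (1 - (k : ℝ) / n) * phi n Φ t)

section CaseB

variable {k n : ℕ} {Φ v : ℝ → ℝ} {T q : ℝ}

lemma fnWt_eq (t : ℝ) : fnWt k n Φ v t = (primV v t)⁻¹ * fnE k n Φ t := rfl

lemma fnE_ne_top (t : ℝ) : fnE k n Φ t ≠ ∞ := ENNReal.ofReal_ne_top

lemma fnE_eq {t : ℝ} (ht : 0 < t) :
    fnE k n Φ t = ENNReal.ofReal t * (ePow t (-((k : ℝ) / n)) * ePhi n Φ t) := by
  have e : t ^ (1 - (k : ℝ) / n) = t * t ^ (-((k : ℝ) / n)) := by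
    rw [sub_eq_add_neg, Real.rpow_add ht, Real.rpow_one]
  rw [fnE, e, mul_assoc, ENNReal.ofReal_mul ht.le, ENNReal.ofReal_mul (by positivity)]; rfl

lemma IsKernelProfile.aemeasurable_fnE (hΦ : IsKernelProfile n Φ) (hn : 1 ≤ n) :
    AEMeasurable (fnE k n Φ) (leb T) :=
  ((by fun_prop : Measurable fun t : ℝ => t ^ (1 - (k : ℝ) / n)).aemeasurable.mul
    (hΦ.aemeasurable_phi hn)).ennreal_ofReal

lemma IsKernelProfile.aemeasurable_fnWt (hΦ : IsKernelProfile n Φ) (hn : 1 ≤ n) :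
    AEMeasurable (fnWt k n Φ v) (leb T) :=
  (measurable_primV v).inv.aemeasurable.mul (hΦ.aemeasurable_fnE hn)

/-- `t^{k/n} W̃ ≤ W`. -/
lemma IsKernelProfile.ePow_mul_fnWt_le (hΦ : IsKernelProfile n Φ) (hn : 1 ≤ n) {t : ℝ}
    (ht : 0 < t) : ePow t ((k : ℝ) / n) * fnWt k n Φ v t ≤ fnW n Φ v t := by
  rw [fnWt_eq, fnE_eq ht, fnW]
  calc _ = (primV v t)⁻¹ * (ePow t ((k : ℝ) / n) * ePow t (-((k : ℝ) / n)) *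
        (ENNReal.ofReal t * ePhi n Φ t)) := by ring
    _ ≤ _ := by
      rw [ePow_mul_neg ht, one_mul]
      gcongr
      exact hΦ.mul_ePhi_le hn ht

/-- `E` grows at most linearly on blocks. -/
lemma IsKernelProfile.fnE_le_mul (hΦ : IsKernelProfile n Φ) (hn : 1 ≤ n) {N r t : ℝ}
    (hr : 0 < r) (hrt : r ≤ t) (htN : t ≤ N * r) : fnE k n Φ t ≤ ENNReal.ofReal N * fnE k n Φ r := by
  have ht := hr.trans_le hrt
  rw [fnE_eq ht, fnE_eq hr, ← mul_assoc (ENNReal.ofReal N),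
    ← ENNReal.ofReal_mul (by by_contra hn; nlinarith)]
  gcongr
  · exact ePow_le_ePow_of_nonpos hr hrt (by rw [neg_nonpos]; positivity)
  · exact hΦ.antitoneOn_ePhi hn hr ht hrt

/-- Under the second condition `E` almost increases. -/
lemma IsKernelProfile.fnE_le (hΦ : IsKernelProfile n Φ) (hn : 1 ≤ n) {d : ℝ≥0}
    (hd : ∀ t ∈ Ioc 0 T, ∫⁻ τ in Ioo 0 t, ENNReal.ofReal (τ ^ (-((k : ℝ) / n)) * phi n Φ τ) ≤
      d * ENNReal.ofReal (t ^ (1 - (k : ℝ) / n) * phi n Φ t)) {s t : ℝ} (hs : 0 < s)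
    (hst : s ≤ t) (ht : t ≤ T) : fnE k n Φ s ≤ d * fnE k n Φ t := by
  refine le_trans ?_ (hd t ⟨hs.trans_le hst, ht⟩)
  -- E(s) is s times the value at s of the decreasing function τ^{-κ} φ(τ), hence at most its
  -- integral over (0,s).
  calc fnE k n Φ s = ∫⁻ _ in Ioo 0 s, ePow s (-((k : ℝ) / n)) * ePhi n Φ s := by
        rw [fnE_eq hs, setLIntegral_const, Real.volume_Ioo, sub_zero, mul_comm]
    _ ≤ ∫⁻ τ in Ioo 0 s, ENNReal.ofReal (τ ^ (-((k : ℝ) / n)) * phi n Φ τ) := by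
        refine setLIntegral_mono' measurableSet_Ioo fun τ hτ => ?_
        have hτ0 := hτ.1
        rw [ENNReal.ofReal_mul (by positivity)]
        gcongr
        · exact ePow_le_ePow_of_nonpos hτ.1 hτ.2.le (by rw [neg_nonpos]; positivity)
        · exact hΦ.antitoneOn_ePhi hn hτ.1 hs hτ.2.le
    _ ≤ _ := lintegral_mono_set (Ioo_subset_Ioo_right hst)

/-- φ is positive near 0, and the almost increase of E carries positivity to all of (0,T]. -/
lemma IsKernelProfile.fnE_ne_zero (hΦ : IsKernelProfile n Φ) (hn : 1 ≤ n) {d : ℝ≥0}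
    (hd : ∀ t ∈ Ioc 0 T, ∫⁻ τ in Ioo 0 t, ENNReal.ofReal (τ ^ (-((k : ℝ) / n)) * phi n Φ τ) ≤
      d * ENNReal.ofReal (t ^ (1 - (k : ℝ) / n) * phi n Φ t)) {t : ℝ} (ht : t ∈ Ioc 0 T) :
    fnE k n Φ t ≠ 0 := by
  obtain ⟨δ, hδ, hpos⟩ := hΦ.exists_ePhi_pos hn
  have hs : 0 < min δ t := lt_min hδ ht.1
  have h1 := hΦ.fnE_le hn hd hs (min_le_right _ _) ht.2
  intro h0
  rw [h0, mul_zero, fnE_eq hs] at h1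
  have h2 : ENNReal.ofReal (min δ t) * (ePow (min δ t) (-((k : ℝ) / n)) * ePhi n Φ (min δ t)) ≠ 0 :=
    mul_ne_zero (by rw [ne_eq, ENNReal.ofReal_eq_zero, not_le]; exact hs)
      (mul_ne_zero (ePow_ne_zero hs _) (hpos _ hs (min_le_left _ _)).ne')
  exact h2 (le_antisymm h1 zero_le)

/-- `W̃` on a block is controlled by its value at the right end. -/
lemma IsKernelProfile.fnWt_le_of_block (hΦ : IsKernelProfile n Φ) (hn : 1 ≤ n) {d D : ℝ≥0}
    (hd : ∀ t ∈ Ioc 0 T, ∫⁻ τ in Ioo 0 t, ENNReal.ofReal (τ ^ (-((k : ℝ) / n)) * phi n Φ τ) ≤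
      d * ENNReal.ofReal (t ^ (1 - (k : ℝ) / n) * phi n Φ t))
    (hv : IsWeight v) (hD : ∀ t, 0 < t → primV v (2 * t) ≤ D * primV v t) {s τ : ℝ}
    (hs : s ∈ Ioc 0 T) (hτ : τ ∈ Icc (s / 2) s) :
    fnWt k n Φ v τ ≤ d * D * fnWt k n Φ v s := by
  have hs2 : 0 < s / 2 := by linarith [hs.1]
  have hτ0 : 0 < τ := hs2.trans_le hτ.1
  have h1 : primV v s ≤ D * primV v τ := by
    refine (primV_mono v ?_).trans (hD τ hτ0)
    linarith [hτ.1]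
  have h2 : (primV v τ)⁻¹ ≤ D * (primV v s)⁻¹ := by
    calc (primV v τ)⁻¹ = (primV v τ)⁻¹ * ((primV v s)⁻¹ * primV v s) := by
          rw [ENNReal.inv_mul_cancel (hv.primV_pos hs.1).ne' (hv.primV_ne_top s), mul_one]
      _ ≤ (primV v τ)⁻¹ * ((primV v s)⁻¹ * (D * primV v τ)) := by gcongr
      _ = D * (primV v s)⁻¹ * ((primV v τ)⁻¹ * primV v τ) := by ring
      _ = _ := by rw [ENNReal.inv_mul_cancel (hv.primV_pos hτ0).ne' (hv.primV_ne_top τ), mul_one]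
  rw [fnWt_eq, fnWt_eq]
  calc (primV v τ)⁻¹ * fnE k n Φ τ ≤ (D * (primV v s)⁻¹) * (d * fnE k n Φ s) := by
        gcongr; exact hΦ.fnE_le hn hd hτ0 hτ.2 hs.2
    _ = _ := by ring

/-! #### The case `q = 1` -/

lemma fnU_one (t : ℝ) : fnU k n Φ v T 1 t = ⨆ τ ∈ Icc t T, fnWt k n Φ v τ := by
  rw [fnU, if_pos rfl]

lemma fnWt_le_fnU_one {s τ : ℝ} (hτ : τ ∈ Icc s T) : fnWt k n Φ v τ ≤ fnU k n Φ v T 1 s := by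
  rw [fnU_one]
  exact le_iSup₂ (f := fun τ (_ : τ ∈ Icc s T) => fnWt k n Φ v τ) τ hτ

/-- From τ^κ W̃ ≤ W and τ^{-κ} ≤ s^{-κ} for τ ≥ s. Finiteness allows U to be cancelled in the decay
inequality. -/
lemma IsKernelProfile.fnU_one_ne_top (hΦ : IsKernelProfile n Φ) (hn : 1 ≤ n)
    (hΨ : Psi n Φ v 1 T < ∞) {s : ℝ} (hs : 0 < s) : fnU k n Φ v T 1 s ≠ ∞ := by
  refine ne_top_of_le_ne_top (ENNReal.mul_ne_top (ePow_ne_top s (-((k : ℝ) / n))) hΨ.ne) ?_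
  rw [fnU_one, Psi, if_pos rfl]
  refine iSup₂_le fun τ hτ => ?_
  have hτ0 := hs.trans_le hτ.1
  calc fnWt k n Φ v τ = ePow τ (-((k : ℝ) / n)) * (ePow τ ((k : ℝ) / n) * fnWt k n Φ v τ) := by
        rw [← mul_assoc, mul_comm (ePow τ _) (ePow τ _), ePow_mul_neg hτ0, one_mul]
    _ ≤ ePow s (-((k : ℝ) / n)) * fnW n Φ v τ := by
        gcongr
        · exact ePow_le_ePow_of_nonpos hs hτ.1 (by rw [neg_nonpos]; positivity)
        · exact hΦ.ePow_mul_fnWt_le hn hτ0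
    _ ≤ _ := by
        gcongr
        exact le_iSup₂ (f := fun τ (_ : τ ∈ Ioc 0 T) => fnW n Φ v τ) τ ⟨hτ0, hτ.2⟩

/-- The tail supremum is already attained on the preceding block. -/
lemma fnU_one_le_block {ε : ℝ} (hε : 0 < ε)
    (hant : AntitoneOn (fun t => ENNReal.ofReal (t ^ ε) * fnU k n Φ v T 1 t) (Ioc 0 T)) {s : ℝ}
    (hs : s ∈ Ioc 0 T) (hfin : fnU k n Φ v T 1 s ≠ ∞) :
    fnU k n Φ v T 1 s ≤ ⨆ τ ∈ Icc (s / 2) s, fnWt k n Φ v τ := by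
  by_contra! hlt
  have hs0 := hs.1
  have hs2 : s / 2 ∈ Ioc 0 T := ⟨by linarith, by linarith [hs.2]⟩
  -- If every value on the block lies below U(s), then U(s/2) ≤ U(s). The decay gives s^ε U(s) ≤
  -- (s/2)^ε U(s/2), which forces s^ε ≤ (s/2)^ε.
  have h1 : fnU k n Φ v T 1 (s / 2) ≤ fnU k n Φ v T 1 s := by
    conv_lhs => rw [fnU_one]
    refine iSup₂_le fun τ hτ => ?_
    rcases le_total s τ with h | h
    · exact fnWt_le_fnU_one ⟨h, hτ.2⟩
    · exact (le_iSup₂ (f := fun τ (_ : τ ∈ Icc (s / 2) s) => fnWt k n Φ v τ) τ ⟨hτ.1, h⟩).trans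
        hlt.le
  have h2 := (hant hs2 hs (by linarith)).trans (mul_le_mul_right h1 _)
  have h0 : fnU k n Φ v T 1 s ≠ 0 := (zero_le.trans_lt hlt).ne'
  rw [ENNReal.mul_le_mul_iff_left h0 hfin,
    ENNReal.ofReal_le_ofReal_iff (by positivity)] at h2
  exact h2.not_gt (Real.rpow_lt_rpow hs2.1.le (by linarith) hε)

/-- The tail supremum is attained up to constants at the point itself: U(s) ≤ dD W̃(s). Decay of U
then gives t^ε W̃(t) ≤ dD s^ε W̃(s), and W̃ = E/V with E(s) ≤ d E(t) turns decay of W̃ into growth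
of V. -/
lemma IsKernelProfile.reverseDoubling_one (hΦ : IsKernelProfile n Φ) (hn : 1 ≤ n) {d D : ℝ≥0}
    (hd : ∀ t ∈ Ioc 0 T, ∫⁻ τ in Ioo 0 t, ENNReal.ofReal (τ ^ (-((k : ℝ) / n)) * phi n Φ τ) ≤
      d * ENNReal.ofReal (t ^ (1 - (k : ℝ) / n) * phi n Φ t))
    (hv : IsWeight v) (hD : ∀ t, 0 < t → primV v (2 * t) ≤ D * primV v t)
    (hΨ : Psi n Φ v 1 T < ∞) {ε : ℝ} (hε : 0 < ε)
    (hant : AntitoneOn (fun t => ENNReal.ofReal (t ^ ε) * fnU k n Φ v T 1 t) (Ioc 0 T)) :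
    ReverseDoubling T v := by
  -- For (t/s)^ε = B the comparison reads B V(s) ≤ d²D V(t); any B > 2d²D excludes V(t) < 2V(s).
  set B : ℝ := 2 * (d * D * d) + 2 with hB
  have hB0 : 1 < B := by have : (0 : ℝ) ≤ d * D * d := by positivity
                         linarith
  set N : ℝ := B ^ (1 / ε) with hN
  have hN1 : 1 < N := Real.one_lt_rpow hB0 (by positivity)
  have hN0 : 0 < N := by linarith
  refine ⟨N, hN1, fun t ht => ?_⟩
  set s := t / N with hs
  have hsT : s ∈ Ioc 0 T := ⟨div_pos ht.1 hN0, (div_le_self ht.1.le hN1.le).trans ht.2⟩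
  have hst : s ≤ t := div_le_self ht.1.le hN1.le
  have hNε : N ^ ε = B := by
    rw [hN, ← Real.rpow_mul (by linarith), one_div_mul_cancel hε.ne', Real.rpow_one]
  have hts : ePow t ε = ENNReal.ofReal B * ePow s ε := by
    rw [ePow, ePow, ← ENNReal.ofReal_mul (by linarith), hs, Real.div_rpow ht.1.le hN0.le, hNε]
    congr 1; field_simp
  have h1 : fnU k n Φ v T 1 s ≤ d * D * fnWt k n Φ v s :=
    (fnU_one_le_block hε hant hsT (hΦ.fnU_one_ne_top hn hΨ hsT.1)).trans
      (iSup₂_le fun τ hτ => hΦ.fnWt_le_of_block hn hd hv hD hsT hτ)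
  have h2 : ePow t ε * fnWt k n Φ v t ≤ ePow s ε * (d * D * fnWt k n Φ v s) :=
    calc ePow t ε * fnWt k n Φ v t ≤ ePow t ε * fnU k n Φ v T 1 t := by
          gcongr; exact fnWt_le_fnU_one ⟨le_rfl, ht.2⟩
      _ ≤ ePow s ε * fnU k n Φ v T 1 s := hant hsT ht hst
      _ ≤ _ := by gcongr
  have hEt := hΦ.fnE_ne_zero hn hd ht
  have hEs := hΦ.fnE_le hn hd hsT.1 hst ht.2
  have hVt0 := (hv.primV_pos ht.1).ne'
  have hVs0 := (hv.primV_pos hsT.1).ne'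
  have hVt := hv.primV_ne_top t
  have hVs := hv.primV_ne_top s
  have hp0 := ePow_ne_zero hsT.1 ε
  have h3 : ENNReal.ofReal B * primV v s * (ePow s ε * fnE k n Φ t) ≤
      (d * D * d) * primV v t * (ePow s ε * fnE k n Φ t) := by
    calc ENNReal.ofReal B * primV v s * (ePow s ε * fnE k n Φ t)
        = primV v s * primV v t * (ePow t ε * fnWt k n Φ v t) := by
          rw [hts, fnWt_eq]
          calc _ = ENNReal.ofReal B * primV v s * (ePow s ε * fnE k n Φ t) *
                (primV v t * (primV v t)⁻¹) := by rw [ENNReal.mul_inv_cancel hVt0 hVt, mul_one]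
            _ = _ := by ring
      _ ≤ primV v s * primV v t * (ePow s ε * (d * D * ((primV v s)⁻¹ * (d * fnE k n Φ t)))) := by
          refine mul_le_mul_right (h2.trans ?_) _
          rw [fnWt_eq]
          gcongr
      _ = (primV v s * (primV v s)⁻¹) * ((d * D * d) * primV v t * (ePow s ε * fnE k n Φ t)) := by
          ring
      _ = _ := by rw [ENNReal.mul_inv_cancel hVs0 hVs, one_mul]
  rw [ENNReal.mul_le_mul_iff_left (mul_ne_zero hp0 hEt)
    (ENNReal.mul_ne_top (ePow_ne_top _ _) (fnE_ne_top _))] at h3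
  by_contra! hcon
  have h4 : ENNReal.ofReal B * primV v s ≤ (d * D * d) * (2 * primV v s) :=
    h3.trans (by gcongr)
  rw [← mul_assoc, ENNReal.mul_le_mul_iff_left hVs0 hVs] at h4
  have h5 : ((d : ℝ≥0∞) * D * d) * 2 = ENNReal.ofReal (d * D * d * 2) := by
    rw [ENNReal.ofReal_mul (by positivity), ENNReal.ofReal_mul (by positivity),
      ENNReal.ofReal_mul (by positivity)]
    simp
  rw [h5, ENNReal.ofReal_le_ofReal_iff (by positivity)] at h4
  linarith

/-! #### The case `q > 1` -/

/-- The measure `W̃^{q'} v dt` on `(0,T)`. -/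
noncomputable def tailMeas (k n : ℕ) (Φ v : ℝ → ℝ) (T q : ℝ) : Measure ℝ :=
  (wMeas T v).withDensity fun t => fnWt k n Φ v t ^ q.conjExponent

lemma tailMeas_ac : tailMeas k n Φ v T q ≪ wMeas T v := withDensity_absolutelyContinuous _ _

lemma IsWeight.tailMeas_Ioi (hv : IsWeight v) (hΦ : IsKernelProfile n Φ) (hn : 1 ≤ n)
    (hq : 1 < q) {t : ℝ} (ht : 0 ≤ t) :
    tailMeas k n Φ v T q (Ioi t) = fnU k n Φ v T q t ^ q.conjExponent := by
  have hp0 := (holderConjugate_conjExponent hq).symm.pos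
  rw [fnU, if_neg hq.ne', ← ENNReal.rpow_mul, one_div_mul_cancel hp0.ne', ENNReal.rpow_one,
    tailMeas, withDensity_apply _ measurableSet_Ioi, ← lintegral_indicator measurableSet_Ioi,
    hv.lintegral_wMeas (((hΦ.aemeasurable_fnWt hn).pow_const _).indicator measurableSet_Ioi),
    ← leb_restrict_Ioi ht, ← lintegral_indicator measurableSet_Ioi]
  refine lintegral_congr fun τ => ?_
  by_cases h : τ ∈ Ioi t
  · simp [h]
  · simp [h]

lemma IsWeight.tailMeas_Ioi_ne_top (hv : IsWeight v) (hΦ : IsKernelProfile n Φ) (hn : 1 ≤ n)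
    (hq : 1 < q) (hΨ : Psi n Φ v q T < ∞) {t : ℝ} (ht : 0 < t) :
    tailMeas k n Φ v T q (Ioi t) ≠ ∞ := by
  have hp0 := (holderConjugate_conjExponent hq).symm.pos
  set p := q.conjExponent with hp
  have h1 : ∫⁻ τ, fnW n Φ v τ ^ p ∂(wMeas T v) ≠ ∞ := by
    intro h
    rw [Psi, if_neg hq.ne', ← hp] at hΨ
    rw [hv.lintegral_wMeas ((measurable_fnW n Φ v).pow_const _).aemeasurable] at h
    unfold leb at h
    rw [h, ENNReal.top_rpow_of_pos (by positivity)] at hΨ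
    exact lt_irrefl _ hΨ
  rw [tailMeas, withDensity_apply _ measurableSet_Ioi]
  refine ne_top_of_le_ne_top (ENNReal.mul_ne_top
    (ENNReal.rpow_ne_top_of_nonneg hp0.le (ePow_ne_top t (-((k : ℝ) / n)))) h1) ?_
  rw [← lintegral_const_mul _ ((measurable_fnW n Φ v).pow_const _)]
  calc ∫⁻ τ in Ioi t, fnWt k n Φ v τ ^ p ∂(wMeas T v)
      ≤ ∫⁻ τ in Ioi t, ePow t (-((k : ℝ) / n)) ^ p * fnW n Φ v τ ^ p ∂(wMeas T v) := by
        refine setLIntegral_mono' measurableSet_Ioi fun τ hτ => ?_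
        have hτ0 : 0 < τ := ht.trans hτ
        rw [← ENNReal.mul_rpow_of_nonneg _ _ hp0.le]
        gcongr
        calc fnWt k n Φ v τ = ePow τ (-((k : ℝ) / n)) * (ePow τ ((k : ℝ) / n) * fnWt k n Φ v τ) := by
              rw [← mul_assoc, mul_comm (ePow τ _) (ePow τ _), ePow_mul_neg hτ0, one_mul]
          _ ≤ _ := by
              gcongr
              · exact ePow_le_ePow_of_nonpos ht (le_of_lt hτ) (by rw [neg_nonpos]; positivity)
              · exact hΦ.ePow_mul_fnWt_le hn hτ0
    _ ≤ _ := lintegral_mono' Measure.restrict_le_self le_rfl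

lemma IsWeight.antitoneOn_tailMeas (hv : IsWeight v) (hΦ : IsKernelProfile n Φ) (hn : 1 ≤ n)
    (hq : 1 < q) {ε : ℝ}
    (hant : AntitoneOn (fun t => ENNReal.ofReal (t ^ ε) * fnU k n Φ v T q t) (Ioc 0 T)) :
    AntitoneOn (fun t => ePow t (ε * q.conjExponent) * tailMeas k n Φ v T q (Ioi t)) (Ioc 0 T) := by
  have hp0 := (holderConjugate_conjExponent hq).symm.pos
  intro s hs t ht hst
  have h := ENNReal.rpow_le_rpow (hant hs ht hst) hp0.le
  simp only [ENNReal.mul_rpow_of_nonneg _ _ hp0.le] at h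
  dsimp only
  rw [hv.tailMeas_Ioi hΦ hn hq hs.1.le, hv.tailMeas_Ioi hΦ hn hq ht.1.le, ← ePow_rpow hs.1,
    ← ePow_rpow ht.1]
  exact h

/-- A measure with power decay of the tails puts a fixed share of each tail on the preceding
block. -/
lemma mul_tail_le_block {m : Measure ℝ} {η : ℝ} (hη : 0 < η)
    (hm : AntitoneOn (fun t => ePow t η * m (Ioi t)) (Ioc 0 T))
    (hfin : ∀ t, 0 < t → m (Ioi t) ≠ ∞) {s : ℝ} (hs : s ∈ Ioc 0 T) :
    ENNReal.ofReal (2 ^ η - 1) * m (Ioi s) ≤ m (Ioc (s / 2) s) := by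
  have hs0 := hs.1
  have hs2 : s / 2 ∈ Ioc 0 T := ⟨by linarith, by linarith [hs.2]⟩
  have h1 := hm hs2 hs (by linarith)
  have e1 : ePow s η = ePow (s / 2) η * ENNReal.ofReal (2 ^ η) := by
    have : s = s / 2 * 2 := by ring
    conv_lhs => rw [this]
    rw [ePow_mul_base hs2.1.le two_pos.le]; rfl
  -- The decay now reads 2^η m(Ioi s) ≤ m(Ioi (s/2)), and the right side is the block plus the
  -- finite tail m(Ioi s).
  simp only [e1, mul_assoc] at h1
  rw [ENNReal.mul_le_mul_iff_right (ePow_ne_zero hs2.1 _) (ePow_ne_top _ _)] at h1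
  have h2 : m (Ioi (s / 2)) = m (Ioc (s / 2) s) + m (Ioi s) := by
    rw [← measure_union _ measurableSet_Ioi, Ioc_union_Ioi_eq_Ioi (by linarith)]
    exact disjoint_left.2 fun x hx hx' => hx.2.not_gt hx'
  have h3 : (2 : ℝ) ^ η = (2 ^ η - 1) + 1 := by ring
  have h4 : 1 < (2 : ℝ) ^ η := Real.one_lt_rpow one_lt_two hη
  rw [h2, h3, ENNReal.ofReal_add (by linarith) zero_le_one, ENNReal.ofReal_one, add_mul, one_mul] at h1
  exact (ENNReal.add_le_add_iff_right (hfin s hs0)).1 h1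

lemma setLIntegral_Iio_add_Ioi (f : ℝ → ℝ≥0∞) (s : ℝ) :
    ∫⁻ x in Iio s, f x ∂(leb T) + ∫⁻ x in Ioi s, f x ∂(leb T) = ∫⁻ x, f x ∂(leb T) := by
  have : NullSingletonClass (leb T) := by unfold leb; infer_instance
  have h := lintegral_add_compl (μ := leb T) f (measurableSet_Iio (a := s))
  rwa [compl_Iio, setLIntegral_congr Ioi_ae_eq_Ici.symm] at h

/-- The tail mass is bounded at s above, and at t below, by a multiple of W̃^p V at the same point;
the lower bound needs V to double once more inside (0,T). If V did not double between s = t/N and t,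
these quantities would be comparable at s and t, against the decay t^{-η} of the tails for large N.
-/
lemma IsKernelProfile.reverseDoubling_of_one_lt (hΦ : IsKernelProfile n Φ) (hn : 1 ≤ n)
    {d D : ℝ≥0}
    (hd : ∀ t ∈ Ioc 0 T, ∫⁻ τ in Ioo 0 t, ENNReal.ofReal (τ ^ (-((k : ℝ) / n)) * phi n Φ τ) ≤
      d * ENNReal.ofReal (t ^ (1 - (k : ℝ) / n) * phi n Φ t))
    (hv : IsWeight v) (hD : ∀ t, 0 < t → primV v (2 * t) ≤ D * primV v t) (hT : 0 < T) (hq : 1 < q)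
    (hΨ : Psi n Φ v q T < ∞) {ε : ℝ} (hε : 0 < ε)
    (hant : AntitoneOn (fun t => ENNReal.ofReal (t ^ ε) * fnU k n Φ v T q t) (Ioc 0 T)) :
    ReverseDoubling T v := by
  have hp0 := (holderConjugate_conjExponent hq).symm.pos
  have hanti := hv.antitoneOn_tailMeas hΦ hn hq hant
  set p := q.conjExponent with hp
  set η : ℝ := ε * p with hη
  have hη0 : 0 < η := by positivity
  set m := tailMeas k n Φ v T q with hm
  have hfin : ∀ t, 0 < t → m (Ioi t) ≠ ∞ := fun t ht => hv.tailMeas_Ioi_ne_top hΦ hn hq hΨ ht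
  set W := fnWt k n Φ v with hW
  have hblock : ∀ s ∈ Ioc 0 T, m (Ioc (s / 2) s) ≤ (d * D * W s) ^ p * primV v s := by
    intro s hs
    rw [hm, tailMeas, withDensity_apply _ measurableSet_Ioc]
    calc ∫⁻ τ in Ioc (s / 2) s, fnWt k n Φ v τ ^ p ∂(wMeas T v)
        ≤ ∫⁻ _ in Ioc (s / 2) s, (d * D * W s) ^ p ∂(wMeas T v) := by
          refine setLIntegral_mono' measurableSet_Ioc fun τ hτ => ?_
          gcongr
          exact hΦ.fnWt_le_of_block hn hd hv hD hs ⟨hτ.1.le, hτ.2⟩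
      _ ≤ _ := by
          rw [setLIntegral_const, ← wMeas_Iic hs.2]
          gcongr
          exact fun x hx => hx.2
  -- With V(y) = 2V(t), the interval (t,y) has mass V(t), and on it W̃(t) ≤ 2d W̃(τ): E almost
  -- increases and V at most doubles.
  have hlow : ∀ t ∈ Ioc 0 T, 2 * primV v t ≤ primV v T →
      W t ^ p * primV v t ≤ (2 * d) ^ p * m (Ioi t) := by
    intro t ht hle
    obtain ⟨y, hy, hyV⟩ := hv.exists_primV_eq hT hle
    have hV0 := (hv.primV_pos ht.1).ne'
    have hty : t < y := by
      by_contra hcon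
      have h1 := primV_mono v (not_lt.1 hcon)
      rw [hyV, two_mul] at h1
      exact h1.not_gt (ENNReal.lt_add_right (hv.primV_ne_top t) hV0)
    have h2 : wMeas T v (Ioo t y) = primV v t := by
      have h3 := primV_add (v := v) hty.le hy.2
      rw [hyV, two_mul] at h3
      exact ((ENNReal.add_right_inj (hv.primV_ne_top t)).1 h3).symm
    calc W t ^ p * primV v t = ∫⁻ _ in Ioo t y, W t ^ p ∂(wMeas T v) := by
          rw [setLIntegral_const, h2]
      _ ≤ ∫⁻ τ in Ioo t y, (2 * d) ^ p * W τ ^ p ∂(wMeas T v) := by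
          refine setLIntegral_mono' measurableSet_Ioo fun τ hτ => ?_
          rw [← ENNReal.mul_rpow_of_nonneg _ _ hp0.le]
          gcongr
          have hτ0 := ht.1.trans hτ.1
          have hVτ0 := (hv.primV_pos hτ0).ne'
          have hVτ := hv.primV_ne_top τ
          have h4 : primV v τ ≤ 2 * primV v t := hyV ▸ primV_mono v hτ.2.le
          rw [hW, fnWt_eq, fnWt_eq]
          calc (primV v t)⁻¹ * fnE k n Φ t
              = (primV v t)⁻¹ * ((primV v τ)⁻¹ * primV v τ) * fnE k n Φ t := by
                rw [ENNReal.inv_mul_cancel hVτ0 hVτ, mul_one]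
            _ ≤ (primV v t)⁻¹ * ((primV v τ)⁻¹ * (2 * primV v t)) * (d * fnE k n Φ τ) := by
                gcongr
                exact hΦ.fnE_le hn hd ht.1 hτ.1.le (hτ.2.le.trans hy.2)
            _ = ((primV v t)⁻¹ * primV v t) * (2 * d * ((primV v τ)⁻¹ * fnE k n Φ τ)) := by ring
            _ = _ := by rw [ENNReal.inv_mul_cancel hV0 (hv.primV_ne_top t), one_mul]
      _ = (2 * d) ^ p * m (Ioo t y) := by
          rw [lintegral_const_mul' _ _ (ENNReal.rpow_ne_top_of_nonneg hp0.le
            (ENNReal.mul_ne_top (by simp) ENNReal.coe_ne_top)), hm, tailMeas,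
            withDensity_apply _ measurableSet_Ioo]
      _ ≤ _ := by gcongr; exact fun x hx => hx.1
  -- choice of the dilation factor
  have hc0 : (0 : ℝ) < 2 ^ η - 1 := by
    have := Real.one_lt_rpow one_lt_two hη0
    linarith
  set A : ℝ≥0 := (2 * d) ^ p * (d * D * (2 * d)) ^ p with hA
  set B : ℝ := (A + 1) / (2 ^ η - 1) + 1 with hB
  have hB1 : 1 < B := by
    have : 0 < ((A : ℝ) + 1) / (2 ^ η - 1) := by positivity
    linarith
  have hAB : (A : ℝ) < (2 ^ η - 1) * B := by
    rw [hB, mul_add, mul_div_cancel₀ _ hc0.ne']; linarith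
  set N : ℝ := B ^ (1 / η) with hN
  have hN1 : 1 < N := Real.one_lt_rpow hB1 (by positivity)
  have hN0 : 0 < N := by linarith
  have hNη : N ^ η = B := by
    rw [hN, ← Real.rpow_mul (by linarith), one_div_mul_cancel hη0.ne', Real.rpow_one]
  have hsmall : ∀ t ∈ Ioc 0 T, 2 * primV v t ≤ primV v T →
      2 * primV v (t / N) ≤ primV v t := by
    intro t ht hle
    by_contra! hcon
    set s := t / N with hs
    have hsT : s ∈ Ioc 0 T := ⟨div_pos ht.1 hN0, (div_le_self ht.1.le hN1.le).trans ht.2⟩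
    have hst : s ≤ t := div_le_self ht.1.le hN1.le
    have hVs0 := (hv.primV_pos hsT.1).ne'
    have hVt0 := (hv.primV_pos ht.1).ne'
    have hts : ePow t η = ENNReal.ofReal B * ePow s η := by
      rw [ePow, ePow, ← ENNReal.ofReal_mul (by linarith), hs, Real.div_rpow ht.1.le hN0.le, hNη]
      congr 1; field_simp
    have hWst : W s ≤ 2 * d * W t := by
      rw [hW, fnWt_eq, fnWt_eq]
      calc (primV v s)⁻¹ * fnE k n Φ s
          = (primV v s)⁻¹ * ((primV v t)⁻¹ * primV v t) * fnE k n Φ s := by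
            rw [ENNReal.inv_mul_cancel hVt0 (hv.primV_ne_top t), mul_one]
        _ ≤ (primV v s)⁻¹ * ((primV v t)⁻¹ * (2 * primV v s)) * (d * fnE k n Φ t) := by
            gcongr
            exact hΦ.fnE_le hn hd hsT.1 hst ht.2
        _ = ((primV v s)⁻¹ * primV v s) * (2 * d * ((primV v t)⁻¹ * fnE k n Φ t)) := by ring
        _ = _ := by rw [ENNReal.inv_mul_cancel hVs0 (hv.primV_ne_top s), one_mul]
    have hWt0 : W t ≠ 0 := mul_ne_zero (ENNReal.inv_ne_zero.2 (hv.primV_ne_top t))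
      (hΦ.fnE_ne_zero hn hd ht)
    have hWtt : W t ≠ ∞ := ENNReal.mul_ne_top (ENNReal.inv_ne_top.2 hVt0) (fnE_ne_top t)
    set c₀ := ENNReal.ofReal (2 ^ η - 1) with hc₀
    set Z : ℝ≥0∞ := ePow s η * (W t ^ p * primV v t) with hZ
    have hZ0 : Z ≠ 0 := mul_ne_zero (ePow_ne_zero hsT.1 _) (mul_ne_zero
      (by rw [ne_eq, ENNReal.rpow_eq_zero_iff_of_pos hp0]; exact hWt0) hVt0)
    have hZt : Z ≠ ∞ := ENNReal.mul_ne_top (ePow_ne_top _ _) (ENNReal.mul_ne_top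
      (ENNReal.rpow_ne_top_of_nonneg hp0.le hWtt) (hv.primV_ne_top t))
    -- The chain runs from W̃(t)^p V(t) to the tail at t, by decay to the tail at s, to the block
    -- below s, and back to W̃(t)^p V(t). It yields c₀B ≤ A, against the choice of B.
    have h1 : c₀ * ENNReal.ofReal B * Z ≤ A * Z := by
      calc c₀ * ENNReal.ofReal B * Z = c₀ * (ePow t η * (W t ^ p * primV v t)) := by
            rw [hts, hZ]; ring
        _ ≤ c₀ * (ePow t η * ((2 * d) ^ p * m (Ioi t))) := 
            mul_le_mul_right (mul_le_mul_right (hlow t ht hle) _) _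
        _ = c₀ * (2 * d) ^ p * (ePow t η * m (Ioi t)) := by ring
        _ ≤ c₀ * (2 * d) ^ p * (ePow s η * m (Ioi s)) :=
            mul_le_mul_right (hanti hsT ht hst) _
        _ = (2 * d) ^ p * ePow s η * (c₀ * m (Ioi s)) := by ring
        _ ≤ (2 * d) ^ p * ePow s η * ((d * D * (2 * d * W t)) ^ p * primV v t) := by
            refine mul_le_mul_right (((mul_tail_le_block hη0 hanti hfin hsT).trans
              (hblock s hsT)).trans ?_) _
            gcongr
            exact primV_mono v hst
        _ = A * Z := by
            rw [hA, ENNReal.coe_mul, ENNReal.coe_rpow_of_nonneg _ hp0.le,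
              ENNReal.coe_rpow_of_nonneg _ hp0.le]
            push_cast
            rw [← mul_assoc ((d : ℝ≥0∞) * D), ENNReal.mul_rpow_of_nonneg _ (W t) hp0.le, hZ]
            ring
    rw [ENNReal.mul_le_mul_iff_left hZ0 hZt, hc₀, ← ENNReal.ofReal_mul hc0.le,
      ENNReal.ofReal_le_iff_le_toReal ENNReal.coe_ne_top, ENNReal.coe_toReal] at h1
    linarith
  -- For t with 2V(t) ≥ V(T), a dilation by T/y brings t below y, where V is at most V(T)/4.
  obtain ⟨y, hy, hyV⟩ := hv.exists_primV_eq hT (x := primV v T / 4) (ENNReal.div_le_of_le_mul (by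
    calc primV v T = primV v T * 1 := (mul_one _).symm
      _ ≤ _ := by gcongr; norm_num))
  have hVT0 := (hv.primV_pos hT).ne'
  have hy0 : 0 < y := by
    rcases hy.1.eq_or_lt with h | h
    · rw [← h, primV_of_nonpos v le_rfl] at hyV
      exact absurd hyV.symm (ENNReal.div_pos hVT0 (by simp)).ne'
    · exact h
  refine ⟨max N (T / y), lt_max_of_lt_left hN1, fun t ht => ?_⟩
  rcases le_total (2 * primV v t) (primV v T) with h | h
  · refine le_trans ?_ (hsmall t ht h)
    gcongr
    exact primV_mono v (div_le_div_of_nonneg_left ht.1.le hN0 (le_max_left _ _))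
  · have h1 : t / max N (T / y) ≤ y := by
      rw [div_le_iff₀ (lt_max_of_lt_left hN0)]
      calc t ≤ T := ht.2
        _ = y * (T / y) := by field_simp
        _ ≤ _ := by gcongr; exact le_max_right _ _
    have h2 : primV v (t / max N (T / y)) ≤ primV v T / 4 := hyV ▸ primV_mono v h1
    calc 2 * primV v (t / max N (T / y)) ≤ 2 * (2 * primV v t / 4) := by
          gcongr
          exact h2.trans (by gcongr)
      _ = primV v t * (4 / 4) := by
          rw [ENNReal.div_eq_inv_mul, ENNReal.div_eq_inv_mul]; ring
      _ = primV v t := by rw [ENNReal.div_self (by simp) (by simp), mul_one]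

/-! #### Hardy's inequality for measures with power decay -/

/-- Layer cake with θ = ε(p-1): τ^θ = θ ∫_0^τ x^{θ-1} dx. For x < s the restricted tail is at most
m(Ioi s) and contributes 1/θ; for x > s the decay leaves x^{-ε-1} and contributes 1/ε. Finally θ(1/θ
+ 1/ε) = p. -/
lemma setLIntegral_ePow_tail_le {m : Measure ℝ} [SFinite m] (hmT : ∀ᵐ t ∂m, t ∈ Ioo 0 T)
    {ε p : ℝ} (hε : 0 < ε) (hp : 1 < p)
    (hm : AntitoneOn (fun t => ePow t (ε * p) * m (Ioi t)) (Ioc 0 T)) {s : ℝ} (hs : s ∈ Ioo 0 T) :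
    ∫⁻ τ in Ioi s, ePow τ (ε * (p - 1)) ∂m ≤
      ENNReal.ofReal p * (ePow s (ε * (p - 1)) * m (Ioi s)) := by
  set θ := ε * (p - 1) with hθ
  have hθ0 : 0 < θ := mul_pos hε (by linarith)
  have hs' : s ∈ Ioc 0 T := ⟨hs.1, hs.2.le⟩
  set M := m (Ioi s) with hM
  have h1 : ∫⁻ τ in Ioi s, ePow τ θ ∂m =
      ENNReal.ofReal θ * ∫⁻ x, ePow x (θ - 1) * (m.restrict (Ioi s)) (Ioi x) ∂(leb T) := by
    have h2 := lintegral_mul_setLIntegral_Ioi (μ := leb T) (ν := m.restrict (Ioi s))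
      (a := fun x => ePow x (θ - 1)) (b := fun _ => 1) (measurable_ePow _).aemeasurable
      aemeasurable_const
    simp only [lintegral_const, one_mul, Measure.restrict_apply_univ] at h2
    rw [h2, ← lintegral_const_mul' _ _ ENNReal.ofReal_ne_top]
    refine lintegral_congr_ae ?_
    filter_upwards [ae_restrict_of_ae hmT] with τ hτ
    rw [leb_restrict_Iio hτ.2.le, setLIntegral_ePow_Ioo hτ.1 (by linarith), sub_add_cancel,
      ← mul_assoc, ← ENNReal.ofReal_mul hθ0.le, mul_one_div_cancel hθ0.ne', ENNReal.ofReal_one,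
      one_mul]
  have h3 : ∫⁻ x in Iio s, ePow x (θ - 1) * (m.restrict (Ioi s)) (Ioi x) ∂(leb T) ≤
      ENNReal.ofReal (1 / θ) * (ePow s θ * M) := by
    rw [leb_restrict_Iio hs.2.le]
    calc ∫⁻ x in Ioo 0 s, ePow x (θ - 1) * (m.restrict (Ioi s)) (Ioi x)
        ≤ ∫⁻ x in Ioo 0 s, ePow x (θ - 1) * M := by
          gcongr with x
          rw [hM, ← Measure.restrict_apply_univ (Ioi s)]
          exact measure_mono (subset_univ _)
      _ = _ := by
          rw [lintegral_mul_const _ (measurable_ePow _), setLIntegral_ePow_Ioo hs.1 (by linarith),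
            sub_add_cancel, mul_assoc]
  have h4 : ∫⁻ x in Ioi s, ePow x (θ - 1) * (m.restrict (Ioi s)) (Ioi x) ∂(leb T) ≤
      ENNReal.ofReal (1 / ε) * (ePow s θ * M) := by
    rw [leb_restrict_Ioi hs.1.le]
    calc ∫⁻ x in Ioo s T, ePow x (θ - 1) * (m.restrict (Ioi s)) (Ioi x)
        ≤ ∫⁻ x in Ioo s T, ENNReal.ofReal (x ^ (-ε - 1)) * (ePow s (ε * p) * M) := by
          refine setLIntegral_mono' measurableSet_Ioo fun x hx => ?_
          have hx0 := hs.1.trans hx.1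
          have h5 := hm hs' ⟨hx0, hx.2.le⟩ hx.1.le
          calc ePow x (θ - 1) * (m.restrict (Ioi s)) (Ioi x)
              ≤ ePow x (θ - 1) * m (Ioi x) := by gcongr; exact Measure.restrict_le_self
            _ = ePow x (-ε - 1) * (ePow x (ε * p) * m (Ioi x)) := by
                rw [← mul_assoc, ePow_mul_ePow hx0]
                congr 2
                rw [hθ]; ring
            _ ≤ ePow x (-ε - 1) * (ePow s (ε * p) * M) := mul_le_mul_right h5 _
      _ ≤ ∫⁻ x in Ioi s, ENNReal.ofReal (x ^ (-ε - 1)) * (ePow s (ε * p) * M) :=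
          lintegral_mono_set fun x hx => hx.1
      _ = ENNReal.ofReal (1 / ε) * (ePow s (-ε) * ePow s (ε * p) * M) := by
          rw [lintegral_mul_const _ (by fun_prop), lintegral_rpow_Ioi hs.1 hε, div_eq_mul_one_div,
            mul_comm (s ^ (-ε)), ENNReal.ofReal_mul (by positivity)]
          simp only [ePow]; ring
      _ = _ := by
          rw [ePow_mul_ePow hs.1]
          congr 3
          rw [hθ]; ring
  rw [h1, ← setLIntegral_Iio_add_Ioi _ s]
  calc ENNReal.ofReal θ * (∫⁻ x in Iio s, ePow x (θ - 1) * (m.restrict (Ioi s)) (Ioi x) ∂(leb T) +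
        ∫⁻ x in Ioi s, ePow x (θ - 1) * (m.restrict (Ioi s)) (Ioi x) ∂(leb T))
      ≤ ENNReal.ofReal θ * (ENNReal.ofReal (1 / θ) * (ePow s θ * M) +
        ENNReal.ofReal (1 / ε) * (ePow s θ * M)) := by gcongr
    _ = ENNReal.ofReal p * (ePow s θ * M) := by
        rw [← add_mul, ← mul_assoc, ← ENNReal.ofReal_add (by positivity) (by positivity),
          ← ENNReal.ofReal_mul hθ0.le]
        congr 2
        rw [hθ]
        have : p - 1 ≠ 0 := by linarith
        field_simp
        ring

/-- The primitive of `κ s^{κ-1} G(s)`. -/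
noncomputable def powPrim (T κ : ℝ) (G : ℝ → ℝ≥0∞) (τ : ℝ) : ℝ≥0∞ :=
  ENNReal.ofReal κ * ∫⁻ s in Iio τ, ePow s (κ - 1) * G s ∂(leb T)

lemma measurable_powPrim (T κ : ℝ) (G : ℝ → ℝ≥0∞) : Measurable (powPrim T κ G) := by
  refine Monotone.measurable fun s t hst => ?_
  unfold powPrim
  gcongr

/-- Hölder, with s^{κ-1} split so that the factor without G, raised to the conjugate power, is
s^{ε-1}, which integrates to τ^ε/ε. -/
lemma powPrim_rpow_le {κ ε p : ℝ} (hε : 0 < ε) (hp : 1 < p) {G : ℝ → ℝ≥0∞} (hG : Measurable G)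
    {τ : ℝ} (hτ : τ ∈ Ioo 0 T) :
    powPrim T κ G τ ^ p ≤ ENNReal.ofReal κ ^ p * ENNReal.ofReal (1 / ε) ^ (p - 1) *
      (ePow τ (ε * (p - 1)) *
        ∫⁻ s in Iio τ, ePow s ((κ - ε) * p + ε - 1) * G s ^ p ∂(leb T)) := by
  have hpq := Real.HolderConjugate.conjExponent hp
  have hp0 := hpq.pos
  have hr0 := hpq.symm.pos
  set r := p.conjExponent with hr
  have hre : r = p / (p - 1) := rfl
  have hp1 : 0 < p - 1 := by linarith
  rw [powPrim, ENNReal.mul_rpow_of_nonneg _ _ hp0.le, mul_assoc]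
  refine mul_le_mul_right ?_ _
  set F := ∫⁻ s in Iio τ, ePow s ((κ - ε) * p + ε - 1) * G s ^ p ∂(leb T) with hF
  have h1 : ∫⁻ s in Iio τ, ePow s (κ - 1) * G s ∂(leb T) ≤
      F ^ (1 / p) * (ENNReal.ofReal (1 / ε) * ePow τ ε) ^ (1 / r) := by
    refine le_trans (le_of_eq ?_) ((ENNReal.lintegral_mul_le_Lp_mul_Lq ((leb T).restrict (Iio τ)) hpq
      (f := fun s => ePow s (κ - ε + (ε - 1) / p) * G s) (g := fun s => ePow s ((ε - 1) / r))
      ((measurable_ePow _).fun_mul hG).aemeasurable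
      (measurable_ePow _).aemeasurable).trans (le_of_eq ?_))
    · refine lintegral_congr_ae ?_
      filter_upwards [ae_restrict_of_ae ae_leb_mem] with s hs
      simp only [Pi.mul_apply]
      rw [mul_right_comm, ePow_mul_ePow hs.1]
      congr 2
      rw [hre]; field_simp; ring
    · congr 2
      · refine lintegral_congr_ae ?_
        filter_upwards [ae_restrict_of_ae ae_leb_mem] with s hs
        rw [ENNReal.mul_rpow_of_nonneg _ _ hp0.le, ePow_rpow hs.1]
        congr 2
        field_simp; ring
      · rw [leb_restrict_Iio hτ.2.le, ← sub_add_cancel ε 1, add_sub_cancel_right,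
          ← setLIntegral_ePow_Ioo hτ.1 (by linarith)]
        refine setLIntegral_congr_fun measurableSet_Ioo fun s hs => ?_
        rw [ePow_rpow hs.1, div_mul_cancel₀ _ hr0.ne']
  calc (∫⁻ s in Iio τ, ePow s (κ - 1) * G s ∂(leb T)) ^ p
      ≤ (F ^ (1 / p) * (ENNReal.ofReal (1 / ε) * ePow τ ε) ^ (1 / r)) ^ p := by gcongr
    _ = _ := by
        have e1 : 1 / r * p = p - 1 := by rw [hre]; field_simp
        rw [ENNReal.mul_rpow_of_nonneg _ _ hp0.le, ← ENNReal.rpow_mul, ← ENNReal.rpow_mul,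
          one_div_mul_cancel hp0.ne', ENNReal.rpow_one, e1, ENNReal.mul_rpow_of_nonneg _ _ hp1.le,
          ePow_rpow hτ.1]
        ring

/-- Hardy's inequality for decreasing functions and measures with power decay of the tails. -/
lemma exists_lintegral_powPrim_le {m : Measure ℝ} [SFinite m] (hmT : ∀ᵐ t ∂m, t ∈ Ioo 0 T)
    {κ ε p : ℝ} (hκ : 0 < κ) (hε : 0 < ε) (hp : 1 < p)
    (hm : AntitoneOn (fun t => ePow t (ε * p) * m (Ioi t)) (Ioc 0 T))
    (hfin : ∀ t, 0 < t → m (Ioi t) ≠ ∞) :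
    ∃ C : ℝ≥0∞, C ≠ ∞ ∧ ∀ G : ℝ → ℝ≥0∞, Antitone G →
      ∫⁻ τ, powPrim T κ G τ ^ p ∂m ≤ C * ∫⁻ τ, (ePow τ κ * G τ) ^ p ∂m := by
  have hp0 : 0 < p := by linarith
  have hη0 : 0 < ε * p := by positivity
  set c₀ := ENNReal.ofReal (2 ^ (ε * p) - 1) with hc₀
  have hc0 : c₀ ≠ 0 := by
    have := Real.one_lt_rpow one_lt_two hη0
    rw [hc₀, ne_eq, ENNReal.ofReal_eq_zero]; linarith
  set c₁ := ENNReal.ofReal κ ^ p * ENNReal.ofReal (1 / ε) ^ (p - 1) with hc₁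
  have hc1 : c₁ ≠ ∞ := ENNReal.mul_ne_top (ENNReal.rpow_ne_top_of_nonneg hp0.le ENNReal.ofReal_ne_top)
    (ENNReal.rpow_ne_top_of_nonneg (by linarith) ENNReal.ofReal_ne_top)
  set c₂ := c₀⁻¹ * ePow 2 κ ^ p with hc₂
  have hc2 : c₂ ≠ ∞ := ENNReal.mul_ne_top (ENNReal.inv_ne_top.2 hc0)
    (ENNReal.rpow_ne_top_of_nonneg hp0.le (ePow_ne_top _ _))
  refine ⟨c₁ * (ENNReal.ofReal p * (ENNReal.ofReal (2 - 1) * c₂)),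
    ENNReal.mul_ne_top hc1 (ENNReal.mul_ne_top ENNReal.ofReal_ne_top
      (ENNReal.mul_ne_top ENNReal.ofReal_ne_top hc2)), fun G hG => ?_⟩
  have hGm := hG.measurable
  set a : ℝ → ℝ≥0∞ := fun s => ePow s ((κ - ε) * p + ε - 1) * G s ^ p with ha
  have ham : Measurable a := (measurable_ePow _).mul (hGm.pow_const _)
  set Y : ℝ → ℝ≥0∞ := fun s => (ePow s κ * G s) ^ p * m (Ioi s) with hY
  have hZm : Measurable fun τ => (ePow τ κ * G τ) ^ p := ((measurable_ePow κ).fun_mul hGm).pow_const p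
  -- The decay charges the tail beyond s to the block (s/2, s]; there G is at least G(s) and s^κ ≤
  -- 2^κ r^κ.
  have hblock : ∀ s ∈ Ioo 0 T, Y s ≤ ∫⁻ r in Ioc (s / 2) s, c₂ * (ePow r κ * G r) ^ p ∂m := by
    intro s hs
    have h1 := mul_tail_le_block hη0 hm hfin ⟨hs.1, hs.2.le⟩
    have h2 : m (Ioi s) ≤ c₀⁻¹ * m (Ioc (s / 2) s) := by
      calc m (Ioi s) = c₀⁻¹ * (c₀ * m (Ioi s)) := by
            rw [← mul_assoc, ENNReal.inv_mul_cancel hc0 ENNReal.ofReal_ne_top, one_mul]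
        _ ≤ _ := by gcongr
    calc Y s ≤ (ePow s κ * G s) ^ p * (c₀⁻¹ * m (Ioc (s / 2) s)) := by
          simp only [hY]; gcongr
      _ = ∫⁻ _ in Ioc (s / 2) s, (ePow s κ * G s) ^ p * c₀⁻¹ ∂m := by
          rw [setLIntegral_const]; ring
      _ ≤ _ := by
          refine setLIntegral_mono' measurableSet_Ioc fun r hr => ?_
          have hr0 : 0 < r := lt_trans (by linarith [hs.1]) hr.1
          have h3 : ePow s κ ≤ ePow 2 κ * ePow r κ := by
            rw [← ePow_mul_base two_pos.le hr0.le]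
            exact ePow_le_ePow hs.1.le (by linarith [hr.1]) hκ.le
          calc (ePow s κ * G s) ^ p * c₀⁻¹ ≤ (ePow 2 κ * ePow r κ * G r) ^ p * c₀⁻¹ := by
                gcongr
                exact hG hr.2
            _ = _ := by
                rw [mul_assoc (ePow 2 κ), ENNReal.mul_rpow_of_nonneg _ (ePow r κ * G r) hp0.le]
                ring
  calc ∫⁻ τ, powPrim T κ G τ ^ p ∂m
      ≤ ∫⁻ τ, c₁ * (ePow τ (ε * (p - 1)) * ∫⁻ s in Iio τ, a s ∂(leb T)) ∂m := by
        refine lintegral_mono_ae ?_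
        filter_upwards [hmT] with τ hτ
        exact powPrim_rpow_le hε hp hGm hτ
    _ = c₁ * ∫⁻ τ, ePow τ (ε * (p - 1)) * ∫⁻ s in Iio τ, a s ∂(leb T) ∂m :=
        lintegral_const_mul' _ _ hc1
    _ = c₁ * ∫⁻ s, a s * ∫⁻ τ in Ioi s, ePow τ (ε * (p - 1)) ∂m ∂(leb T) := by
        rw [lintegral_mul_setLIntegral_Ioi ham.aemeasurable (measurable_ePow _).aemeasurable]
    _ ≤ c₁ * ∫⁻ s, ENNReal.ofReal p * (Y s * ePow s (-1)) ∂(leb T) := by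
        refine mul_le_mul_right (lintegral_mono_ae ?_) _
        filter_upwards [ae_leb_mem] with s hs
        calc a s * ∫⁻ τ in Ioi s, ePow τ (ε * (p - 1)) ∂m
            ≤ a s * (ENNReal.ofReal p * (ePow s (ε * (p - 1)) * m (Ioi s))) := by
              gcongr; exact setLIntegral_ePow_tail_le hmT hε hp hm hs
          _ = ENNReal.ofReal p * (ePow s ((κ - ε) * p + ε - 1) * ePow s (ε * (p - 1)) *
              (G s ^ p * m (Ioi s))) := by simp only [ha]; ring
          -- The parameter ε drops out of the exponent: (κ-ε)p + ε - 1 + ε(p-1) = κp - 1.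
          _ = ENNReal.ofReal p * (ePow s (κ * p) * ePow s (-1) * (G s ^ p * m (Ioi s))) := by
              rw [ePow_mul_ePow hs.1, ePow_mul_ePow hs.1]
              congr 3; ring
          _ = _ := by
              simp only [hY]
              rw [ENNReal.mul_rpow_of_nonneg _ _ hp0.le, ePow_rpow hs.1]; ring
    _ = c₁ * (ENNReal.ofReal p * ∫⁻ s, Y s * ePow s (-1) ∂(leb T)) := by
        rw [lintegral_const_mul' _ _ ENNReal.ofReal_ne_top]
    _ ≤ c₁ * (ENNReal.ofReal p * (ENNReal.ofReal (2 - 1) *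
        ∫⁻ r, c₂ * (ePow r κ * G r) ^ p ∂m)) := by
        gcongr
        exact lintegral_mul_inv_le_of_block (hmT.mono fun t ht => ht.1) one_lt_two
          (hZm.const_mul _).aemeasurable hblock
    _ = _ := by rw [lintegral_const_mul' _ _ hc2]; ring

/-- Another form of `powPrim` of a tail integral. -/
lemma powPrim_tailInt_eq {κ : ℝ} (hκ : 0 < κ) {g : ℝ → ℝ≥0∞} (hg : AEMeasurable g (leb T)) {τ : ℝ}
    (hτ : τ ∈ Ioc 0 T) :
    powPrim T κ (tailInt T g) τ = ∫⁻ t, g t * ePow (min t τ) κ ∂(leb T) := by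
  have h1 : ∫⁻ s in Iio τ, ePow s (κ - 1) * tailInt T g s ∂(leb T) =
      ∫⁻ t, g t * ∫⁻ s in Iio t, ePow s (κ - 1) ∂((leb T).restrict (Iio τ)) ∂(leb T) :=
    lintegral_mul_setLIntegral_Ioi (measurable_ePow _).aemeasurable hg
  rw [powPrim, h1, ← lintegral_const_mul' _ _ ENNReal.ofReal_ne_top]
  refine lintegral_congr_ae ?_
  filter_upwards [ae_leb_mem] with t ht
  rw [Measure.restrict_restrict measurableSet_Iio, Iio_inter_Iio,
    leb_restrict_Iio ((min_le_right _ _).trans hτ.2),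
    setLIntegral_ePow_Ioo (lt_min ht.1 hτ.1) (by linarith), sub_add_cancel, mul_left_comm,
    ← mul_assoc (ENNReal.ofReal κ), ← ENNReal.ofReal_mul hκ.le, mul_one_div_cancel hκ.ne',
    ENNReal.ofReal_one, one_mul]

/-- Splits min(t,τ)^κ at t = τ; the left side is the sum in which the two halves of the kernel
appear after Tonelli. -/
lemma powPrim_tailInt_split {κ : ℝ} (hκ : 0 < κ) {g : ℝ → ℝ≥0∞} (hg : AEMeasurable g (leb T)) {τ : ℝ}
    (hτ : τ ∈ Ioc 0 T) :
    ePow τ κ * tailInt T g τ + ∫⁻ t in Iio τ, g t * ePow t κ ∂(leb T) =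
      powPrim T κ (tailInt T g) τ := by
  rw [powPrim_tailInt_eq hκ hg hτ, ← setLIntegral_Iio_add_Ioi _ τ, add_comm]
  congr 1
  · exact setLIntegral_congr_fun measurableSet_Iio fun t ht => by
      rw [min_eq_left (le_of_lt ht)]
  · rw [tailInt, ← lintegral_const_mul' _ _ (ePow_ne_top _ _)]
    exact setLIntegral_congr_fun measurableSet_Ioi fun t ht => by
      rw [min_eq_right (le_of_lt ht), mul_comm]

/-- Here min(t,τ) ≤ N min(t,r). This regularity on blocks lets dτ/τ be replaced by v/V dτ. -/
lemma powPrim_tailInt_le {κ : ℝ} (hκ : 0 < κ) {g : ℝ → ℝ≥0∞} (hg : AEMeasurable g (leb T))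
    {N r τ : ℝ} (hN : 1 ≤ N) (hr : 0 < r) (hrτ : r ≤ τ) (hτN : τ ≤ N * r) (hτ : τ ≤ T) :
    powPrim T κ (tailInt T g) τ ≤ ePow N κ * powPrim T κ (tailInt T g) r := by
  rw [powPrim_tailInt_eq hκ hg ⟨hr.trans_le hrτ, hτ⟩, powPrim_tailInt_eq hκ hg ⟨hr, hrτ.trans hτ⟩,
    ← lintegral_const_mul' _ _ (ePow_ne_top _ _)]
  refine lintegral_mono_ae ?_
  filter_upwards [ae_leb_mem] with t ht
  rw [mul_left_comm, ← ePow_mul_base (by linarith) (le_min ht.1.le hr.le)]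
  gcongr
  refine ePow_le_ePow (le_min ht.1.le (hr.le.trans hrτ)) ?_ hκ.le
  rcases le_total t r with h | h
  · rw [min_eq_left h]
    calc min t τ ≤ 1 * t := by rw [one_mul]; exact min_le_left _ _
      _ ≤ N * t := by have := ht.1.le; gcongr
  · rw [min_eq_right h]
    exact (min_le_right _ _).trans hτN

/-- A supremum version of Hardy's inequality. Since U(s) is reached on (s/2, s], s^κ G(s) U(s) is at
most 2^κ times `rhoTilde`. For s < τ the decay gives W̃(τ) ≤ τ^{-ε} s^ε U(s), and the remaining
s^{ε-1} integrates to τ^ε/ε. -/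
lemma IsKernelProfile.dualNorm_one_le (hΦ : IsKernelProfile n Φ) (hn : 1 ≤ n)
    (hκ : 0 < (k : ℝ) / n) (hv : IsWeight v)
    (hΨ : Psi n Φ v 1 T < ∞) {ε : ℝ} (hε : 0 < ε)
    (hant : AntitoneOn (fun t => ENNReal.ofReal (t ^ ε) * fnU k n Φ v T 1 t) (Ioc 0 T)) :
    ∃ C : ℝ≥0∞, C ≠ ∞ ∧ ∀ g : ℝ → ℝ≥0∞,
      dualNorm T 1 v (fun τ => fnWt k n Φ v τ * powPrim T ((k : ℝ) / n) (tailInt T g) τ) ≤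
        C * rhoTilde n Φ v T 1 g := by
  set κ : ℝ := (k : ℝ) / n with hκdef
  refine ⟨ENNReal.ofReal κ * (ePow 2 κ * ENNReal.ofReal (1 / ε)), ENNReal.mul_ne_top
    ENNReal.ofReal_ne_top (ENNReal.mul_ne_top (ePow_ne_top _ _) ENNReal.ofReal_ne_top),
    fun g => ?_⟩
  rw [dualNorm, if_pos rfl]
  set M := rhoTilde n Φ v T 1 g with hM
  have hW : ∀ t ∈ Ioc 0 T, fnW n Φ v t * tailInt T g t ≤ M := fun t ht => by
    rw [hM, rhoTilde_one]
    exact le_iSup₂ (f := fun t (_ : t ∈ Ioc 0 T) => fnW n Φ v t * tailInt T g t) t ht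
  have hU : ∀ s ∈ Ioc 0 T, ePow s κ * tailInt T g s * fnU k n Φ v T 1 s ≤ ePow 2 κ * M := by
    intro s hs
    refine (mul_le_mul_right (fnU_one_le_block hε hant hs (hΦ.fnU_one_ne_top hn hΨ hs.1)) _).trans ?_
    simp only [ENNReal.mul_iSup]
    refine iSup₂_le fun r hr => ?_
    have hr0 : 0 < r := lt_of_lt_of_le (by linarith [hs.1]) hr.1
    calc ePow s κ * tailInt T g s * fnWt k n Φ v r
        ≤ ePow 2 κ * ePow r κ * tailInt T g r * fnWt k n Φ v r := by
          gcongr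
          · rw [← ePow_mul_base two_pos.le hr0.le]
            exact ePow_le_ePow hs.1.le (by linarith [hr.1]) hκ.le
          · exact tailInt_antitone T g hr.2
      _ = ePow 2 κ * ((ePow r κ * fnWt k n Φ v r) * tailInt T g r) := by ring
      _ ≤ ePow 2 κ * (fnW n Φ v r * tailInt T g r) := by
          gcongr; exact hΦ.ePow_mul_fnWt_le hn hr0
      _ ≤ _ := by gcongr; exact hW r ⟨hr0, hr.2.trans hs.2⟩
  refine iSup₂_le fun τ hτ => ?_
  have hWt : ∀ s, 0 < s → s < τ →
      fnWt k n Φ v τ ≤ ePow τ (-ε) * (ePow s ε * fnU k n Φ v T 1 s) := fun s hs hsτ => by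
    have h1 := hant ⟨hs, hsτ.le.trans hτ.2⟩ hτ hsτ.le
    calc fnWt k n Φ v τ ≤ fnU k n Φ v T 1 τ := fnWt_le_fnU_one ⟨le_rfl, hτ.2⟩
      _ = ePow τ (-ε) * (ePow τ ε * fnU k n Φ v T 1 τ) := by
          rw [← mul_assoc, mul_comm (ePow τ _) (ePow τ _), ePow_mul_neg hτ.1, one_mul]
      _ ≤ _ := mul_le_mul_right h1 _
  have hWtop : fnWt k n Φ v τ ≠ ∞ :=
    ENNReal.mul_ne_top (ENNReal.inv_ne_top.2 (hv.primV_pos hτ.1).ne') (fnE_ne_top τ)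
  rw [powPrim, mul_left_comm, ← lintegral_const_mul' _ _ hWtop, mul_assoc]
  refine mul_le_mul_right ?_ _
  rw [leb_restrict_Iio hτ.2]
  calc ∫⁻ s in Ioo 0 τ, fnWt k n Φ v τ * (ePow s (κ - 1) * tailInt T g s)
      ≤ ∫⁻ s in Ioo 0 τ, ePow s (ε - 1) * (ePow τ (-ε) * (ePow 2 κ * M)) := by
        refine setLIntegral_mono' measurableSet_Ioo fun s hs => ?_
        calc fnWt k n Φ v τ * (ePow s (κ - 1) * tailInt T g s)
            ≤ ePow τ (-ε) * (ePow s ε * fnU k n Φ v T 1 s) * (ePow s (κ - 1) * tailInt T g s) := by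
              gcongr; exact hWt s hs.1 hs.2
          _ = ePow τ (-ε) * (ePow s ε * ePow s (κ - 1)) * (tailInt T g s * fnU k n Φ v T 1 s) := by
              ring
          _ = ePow τ (-ε) * (ePow s (ε - 1) * ePow s κ) * (tailInt T g s * fnU k n Φ v T 1 s) := by
              rw [ePow_mul_ePow hs.1, ePow_mul_ePow hs.1]
              congr 3; ring
          _ = ePow s (ε - 1) * (ePow τ (-ε) *
              (ePow s κ * tailInt T g s * fnU k n Φ v T 1 s)) := by ring
          _ ≤ _ := mul_le_mul_right (mul_le_mul_right (hU s ⟨hs.1, hs.2.le.trans hτ.2⟩) _) _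
    _ = ENNReal.ofReal (1 / ε) * (ePow τ ε * ePow τ (-ε)) * (ePow 2 κ * M) := by
        rw [lintegral_mul_const _ (measurable_ePow _), setLIntegral_ePow_Ioo hτ.1 (by linarith),
          sub_add_cancel]
        ring
    _ = _ := by rw [ePow_mul_neg hτ.1]; ring

/-- Hardy's inequality for the measure W̃^p v, whose tails are U_q^p, applied to the decreasing
function G; then τ^κ W̃ ≤ W. -/
lemma IsKernelProfile.dualNorm_le_of_one_lt (hΦ : IsKernelProfile n Φ) (hn : 1 ≤ n)
    (hκ : 0 < (k : ℝ) / n) (hv : IsWeight v) (hT : 0 < T) (hq : 1 < q)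
    (hΨ : Psi n Φ v q T < ∞) {ε : ℝ} (hε : 0 < ε)
    (hant : AntitoneOn (fun t => ENNReal.ofReal (t ^ ε) * fnU k n Φ v T q t) (Ioc 0 T)) :
    ∃ C : ℝ≥0∞, C ≠ ∞ ∧ ∀ g : ℝ → ℝ≥0∞,
      dualNorm T q v (fun τ => fnWt k n Φ v τ * powPrim T ((k : ℝ) / n) (tailInt T g) τ) ≤
        C * rhoTilde n Φ v T q g := by
  have hfinm := hv.isFiniteMeasure hT
  have hpq := holderConjugate_conjExponent hq
  have hp0 := hpq.symm.pos
  have hp1 := hpq.symm.lt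
  have hanti := hv.antitoneOn_tailMeas hΦ hn hq hant
  have hsf : SFinite (tailMeas k n Φ v T q) := by unfold tailMeas; infer_instance
  obtain ⟨C, hC, hle⟩ := exists_lintegral_powPrim_le (m := tailMeas k n Φ v T q)
    (tailMeas_ac.ae_le ae_wMeas_mem) hκ hε hp1 hanti
    (fun t ht => hv.tailMeas_Ioi_ne_top hΦ hn hq hΨ ht)
  set p := q.conjExponent with hp
  have hconv : ∀ f : ℝ → ℝ≥0∞, Measurable f → ∫⁻ τ, f τ ^ p ∂(tailMeas k n Φ v T q) =
      ∫⁻ τ, (fnWt k n Φ v τ * f τ) ^ p ∂(wMeas T v) := fun f hf => by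
    have hWm : AEMeasurable (fun t => fnWt k n Φ v t ^ p) (wMeas T v) :=
      ((hΦ.aemeasurable_fnWt hn).mono_ac wMeas_ac).pow_const _
    rw [tailMeas, lintegral_withDensity_eq_lintegral_mul₀ hWm (hf.pow_const _).aemeasurable]
    refine lintegral_congr fun τ => ?_
    rw [ENNReal.mul_rpow_of_nonneg _ _ hp0.le]; rfl
  refine ⟨C ^ (1 / p), ENNReal.rpow_ne_top_of_nonneg (by positivity) hC, fun g => ?_⟩
  rw [hv.rhoTilde_of_one_lt hq, dualNorm, if_neg hq.ne', ← hp,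
    ← ENNReal.mul_rpow_of_nonneg _ _ (by positivity : 0 ≤ 1 / p)]
  gcongr
  rw [← hconv _ (measurable_powPrim T _ _)]
  refine (hle _ (tailInt_antitone T g)).trans ?_
  rw [hconv _ ((measurable_ePow _).fun_mul (measurable_tailInt T g))]
  refine mul_le_mul_right (lintegral_mono_ae ?_) _
  filter_upwards [ae_wMeas_mem] with τ hτ
  refine ENNReal.rpow_le_rpow ?_ hp0.le
  calc fnWt k n Φ v τ * (ePow τ ((k : ℝ) / n) * tailInt T g τ)
      = ePow τ ((k : ℝ) / n) * fnWt k n Φ v τ * tailInt T g τ := by ring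
    _ ≤ _ := by gcongr; exact hΦ.ePow_mul_fnWt_le hn hτ.1

lemma CondB.exists_lintegral_le (hB : CondB k n Φ v T q) (hnorm : NormableWeight q v)
    (hv : IsWeight v) (hΦ : IsKernelProfile n Φ) (hk : 1 ≤ k) (hn : 1 ≤ n) (hT : 0 < T)
    (hq : 1 ≤ q) (hΨ : Psi n Φ v q T < ∞) :
    ∃ C : ℝ≥0, ∀ σ h g : ℝ → ℝ≥0∞, AntitoneOn σ (Ioo 0 T) → Represents k n Φ T σ h →
      AEMeasurable g (leb T) →
      ∫⁻ t, h t * g t ∂(leb T) ≤ C * (lorentzOn T q v σ * rhoTilde n Φ v T q g) := by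
  obtain ⟨⟨d, hd0, hd⟩, ε, hε, hant⟩ := hB
  obtain ⟨D, hD0, hD⟩ := hnorm.exists_doubling hv hq
  have hκ : 0 < (k : ℝ) / n := by
    have : (0 : ℝ) < k := by exact_mod_cast hk
    have : (0 : ℝ) < n := by exact_mod_cast hn
    positivity
  obtain ⟨N, hN, hV⟩ : ReverseDoubling T v := by
    rcases hq.eq_or_lt with rfl | hq
    · exact hΦ.reverseDoubling_one hn hd hv hD hΨ hε hant
    · exact hΦ.reverseDoubling_of_one_lt hn hd hv hD hT hq hΨ hε hant
  obtain ⟨C, hC, hCle⟩ : ∃ C : ℝ≥0∞, C ≠ ∞ ∧ ∀ g : ℝ → ℝ≥0∞,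
      dualNorm T q v (fun τ => fnWt k n Φ v τ * powPrim T ((k : ℝ) / n) (tailInt T g) τ) ≤
        C * rhoTilde n Φ v T q g := by
    rcases hq.eq_or_lt with rfl | hq
    · exact hΦ.dualNorm_one_le hn hκ hv hΨ hε hant
    · exact hΦ.dualNorm_le_of_one_lt hn hκ hv hT hq hΨ hε hant
  set κ : ℝ := (k : ℝ) / n with hκdef
  set A : ℝ≥0 := Real.toNNReal N * Real.toNNReal (N ^ κ) with hA
  refine ⟨Real.toNNReal (N - 1) * (2 * A) * C.toNNReal, fun σ h g hσ hr hg => ?_⟩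
  have hσm := aemeasurable_leb_of_antitoneOn hσ
  set P := powPrim T κ (tailInt T g) with hP
  have hPm : Measurable P := measurable_powPrim T κ _
  set X : ℝ → ℝ≥0∞ := fun τ => fnE k n Φ τ * P τ * σ τ with hX
  have hXm : AEMeasurable X (leb T) :=
    ((hΦ.aemeasurable_fnE hn).fun_mul hPm.aemeasurable).fun_mul hσm
  have hm : AEMeasurable (fun τ => ePhi n Φ τ * ePow τ (-κ) * σ τ) (leb T) :=
    ((hΦ.aemeasurable_ePhi hn).fun_mul (measurable_ePow _).aemeasurable).fun_mul hσm
  -- By Tonelli the two halves of the kernel bound add up exactly to the integral of φ τ^{-κ} σ P,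
  -- and φ τ^{-κ} = E/τ.
  have h1 : ∫⁻ t, h t * g t ∂(leb T) ≤ ∫⁻ τ, X τ * ePow τ (-1) ∂(leb T) := by
    refine (hr.lintegral_le hΦ hn hσ hg).trans (le_of_eq ?_)
    have e1 : ∫⁻ t, g t * (ePow t κ * ∫⁻ τ in Ioi t, ePhi n Φ τ * ePow τ (-κ) * σ τ ∂(leb T))
        ∂(leb T) = ∫⁻ τ, ePhi n Φ τ * ePow τ (-κ) * σ τ * ∫⁻ t in Iio τ, g t * ePow t κ ∂(leb T)
        ∂(leb T) := by
      rw [← lintegral_mul_setLIntegral_Ioi (hg.fun_mul (measurable_ePow κ).aemeasurable) hm]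
      exact lintegral_congr fun t => (mul_assoc _ _ _).symm
    have hJm : AEMeasurable (fun τ => ePhi n Φ τ * σ τ * ∫⁻ s in Ioi τ, g s ∂(leb T)) (leb T) :=
      ((hΦ.aemeasurable_ePhi hn).fun_mul hσm).fun_mul (measurable_tailInt T g).aemeasurable
    rw [e1, ← lintegral_add_left' hJm]
    refine lintegral_congr_ae ?_
    filter_upwards [ae_leb_mem] with τ hτ
    have e2 : ePhi n Φ τ = ePhi n Φ τ * (ePow τ (-κ) * ePow τ κ) := by
      rw [mul_comm (ePow τ _), ePow_mul_neg hτ.1, mul_one]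
    have e3 : fnE k n Φ τ * ePow τ (-1) = ePow τ (-κ) * ePhi n Φ τ := by
      rw [fnE_eq hτ.1, ← ePow_one, mul_right_comm, ePow_mul_neg hτ.1, one_mul]
    calc ePhi n Φ τ * σ τ * tailInt T g τ +
          ePhi n Φ τ * ePow τ (-κ) * σ τ * ∫⁻ t in Iio τ, g t * ePow t κ ∂(leb T)
        = ePhi n Φ τ * (ePow τ (-κ) * ePow τ κ) * σ τ * tailInt T g τ +
          ePhi n Φ τ * ePow τ (-κ) * σ τ * ∫⁻ t in Iio τ, g t * ePow t κ ∂(leb T) := by rw [← e2]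
      _ = (ePow τ (-κ) * ePhi n Φ τ) * σ τ *
          (ePow τ κ * tailInt T g τ + ∫⁻ t in Iio τ, g t * ePow t κ ∂(leb T)) := by ring
      _ = _ := by
          rw [powPrim_tailInt_split hκ hg ⟨hτ.1, hτ.2.le⟩, ← e3]
          simp only [hX, hP]; ring
  -- From r up to τ < Nr, E grows at most by N, P at most by N^κ, and σ decreases.
  have h2 := hv.lintegral_mul_inv_le hT hN hV A hXm fun τ hτ r hr => by
    have hN0 : 0 < N := by linarith
    have hr0 : 0 < r := (div_pos hτ.1 hN0).trans hr.1
    have hτN : τ ≤ N * r := by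
      have := (div_lt_iff₀ hN0).1 hr.1
      linarith
    calc X τ ≤ (ENNReal.ofReal N * fnE k n Φ r) * (ePow N κ * P r) * σ r := by
          simp only [hX]
          gcongr
          · exact hΦ.fnE_le_mul hn hr0 hr.2 hτN
          · exact powPrim_tailInt_le hκ hg hN.le hr0 hr.2 hτN hτ.2.le
          · exact hσ ⟨hr0, hr.2.trans_lt hτ.2⟩ hτ hr.2
      _ = _ := by
          simp only [hX, hA, ePow, ENNReal.ofReal, ENNReal.coe_mul]; ring
  have h3 : ∫⁻ r, (primV v r)⁻¹ * X r ∂(wMeas T v) ≤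
      C * rhoTilde n Φ v T q g * lorentzOn T q v σ := by
    refine le_trans (le_of_eq ?_) ((hv.lintegral_mul_le_dualNorm hq
      ((hΦ.aemeasurable_fnWt (k := k) (v := v) hn).fun_mul hPm.aemeasurable) hσ).trans ?_)
    · refine lintegral_congr fun r => ?_
      simp only [hX, fnWt_eq]; ring
    · gcongr
      exact hCle g
  clear_value A
  calc ∫⁻ t, h t * g t ∂(leb T)
      ≤ ENNReal.ofReal (N - 1) * (2 * A) * (C * rhoTilde n Φ v T q g * lorentzOn T q v σ) :=
        h1.trans (h2.trans (by gcongr))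
    _ = _ := by
        have h2A : ((2 * A : ℝ≥0) : ℝ≥0∞) = 2 * A := by rw [ENNReal.coe_mul]; rfl
        rw [ENNReal.coe_mul, ENNReal.coe_mul, ENNReal.coe_toNNReal hC, h2A, ENNReal.ofReal]
        ring

end CaseB

/-! ### The cone and its associate functional -/

section Cone

variable {k n : ℕ} {Φ v : ℝ → ℝ} {T q : ℝ}

lemma mem_coneK_of_rhoK_lt_top {h : ℝ → ℝ≥0∞} (hh : rhoK k n Φ T q v h < ∞) :
    h ∈ coneK k n Φ T q v := by
  obtain ⟨σ, hσ⟩ := iInf_lt_iff.1 hh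
  obtain ⟨hσK, h2⟩ := iInf_lt_iff.1 hσ
  obtain ⟨hr, -⟩ := iInf_lt_iff.1 h2
  exact ⟨σ, hσK, hr⟩

/-- Near the origin φ is positive and the kernel is at least φ/2. Constants σ therefore give
positive functions in the unit ball of the cone, as a function norm requires. -/
lemma IsKernelProfile.coneFn_pos (hΦ : IsKernelProfile n Φ) (hn : 1 ≤ n) {c : ℝ≥0∞} (hc : 0 < c)
    {t : ℝ} (ht : t ∈ Ioo 0 T) : 0 < coneFn k n Φ T (fun _ => c) t := by
  obtain ⟨δ, hδ, hpos⟩ := hΦ.exists_ePhi_pos hn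
  set r := min δ t with hr
  have hr0 : 0 < r := lt_min hδ ht.1
  have h1 : 0 < 2⁻¹ * ePhi n Φ r * c * ENNReal.ofReal r :=
    ENNReal.mul_pos (ENNReal.mul_pos (ENNReal.mul_pos (by simp)
      (hpos r hr0 (min_le_left _ _)).ne').ne' hc.ne').ne' (by simpa using hr0)
  refine h1.trans_le ?_
  calc 2⁻¹ * ePhi n Φ r * c * ENNReal.ofReal r = ∫⁻ _ in Ioo 0 r, 2⁻¹ * ePhi n Φ r * c := by
        rw [setLIntegral_const, Real.volume_Ioo, sub_zero]
    _ ≤ ∫⁻ τ in Ioo 0 r, Omega k n Φ t τ * c := by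
        refine setLIntegral_mono' measurableSet_Ioo fun τ hτ => ?_
        gcongr
        refine le_trans ?_ (hΦ.le_omega hn hτ.1 (hτ.2.le.trans (min_le_right _ _)))
        gcongr
        exact hΦ.antitoneOn_ePhi hn hτ.1 hr0 hτ.2.le
    _ ≤ _ := lintegral_mono_set (Ioo_subset_Ioo_right ((min_le_right _ _).trans ht.2.le))

lemma exists_pos_rhoK_le_one (hΦ : IsKernelProfile n Φ) (hn : 1 ≤ n) (hv : IsWeight v)
    (hT : 0 < T) (hq : 1 ≤ q) :
    ∃ f, AEMeasurable f (leb T) ∧ (∀ᵐ t ∂(leb T), 0 < f t) ∧ rhoK k n Φ T q v f ≤ 1 := by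
  have hq0 : 0 < q := by linarith
  set a : ℝ≥0∞ := primV v T ^ (1 / q) with ha
  have ha0 : a ≠ 0 := by
    rw [ha, ne_eq, ENNReal.rpow_eq_zero_iff_of_pos (by positivity)]
    exact (hv.primV_pos hT).ne'
  have hat : a ≠ ∞ := ENNReal.rpow_ne_top_of_nonneg (by positivity) (hv.primV_ne_top T)
  have hσ : AntitoneOn (fun _ : ℝ => a⁻¹) (Ioo 0 T) := fun _ _ _ _ _ => le_rfl
  have hnorm : lorentzOn T q v (fun _ => a⁻¹) = 1 := by
    rw [lorentzOn_eq hq0 v hσ, lintegral_const_mul' _ _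
      (ENNReal.rpow_ne_top_of_nonneg hq0.le (ENNReal.inv_ne_top.2 ha0))]
    have e : ∫⁻ t, ENNReal.ofReal (v t) ∂(leb T) = primV v T := rfl
    rw [e, ENNReal.mul_rpow_of_nonneg _ _ (by positivity), ← ENNReal.rpow_mul,
      mul_one_div_cancel hq0.ne', ENNReal.rpow_one, ← ha, ENNReal.inv_mul_cancel ha0 hat]
  refine ⟨coneFn k n Φ T fun _ => a⁻¹, (represents_coneFn _).aemeasurable hΦ hn hσ, ?_, ?_⟩
  · filter_upwards [ae_leb_mem] with t ht
    exact hΦ.coneFn_pos hn (ENNReal.inv_pos.2 hat) ht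
  · exact (iInf₂_le_of_le (fun _ => a⁻¹) ⟨hσ, hnorm.trans_lt ENNReal.one_lt_top⟩
      (iInf_le _ (represents_coneFn _))).trans hnorm.le

lemma coneEmbeds_assocNorm_assocNorm (hΦ : IsKernelProfile n Φ) (hn : 1 ≤ n) (hq : 1 ≤ q) :
    ConeEmbeds (coneK k n Φ T q v) (rhoK k n Φ T q v)
      (assocNorm T (assocNorm T (rhoK k n Φ T q v))) := by
  have key : ∀ σ ∈ DecLorentz T q v, ∀ h, Represents k n Φ T σ h →
      assocNorm T (assocNorm T (rhoK k n Φ T q v)) h ≤ lorentzOn T q v σ := by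
    intro σ hσ h hr
    -- Homogeneity needs a nonzero finite bound; any a above the norm of σ works, even if that norm
    -- is 0.
    refine assocNorm_le fun g hg hg1 => le_of_forall_gt_imp_ge_of_dense fun a ha => ?_
    rcases eq_or_ne a ∞ with rfl | hat
    · exact le_top
    calc ∫⁻ t, g t * h t ∂(leb T) = ∫⁻ t, h t * g t ∂(leb T) :=
          lintegral_congr fun t => mul_comm _ _
      _ ≤ a * assocNorm T (rhoK k n Φ T q v) g :=
          lintegral_le_mul_assocNorm_rhoK hq hΦ hn hσ.1 hr ha.le (zero_le.trans_lt ha).ne' hat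
      _ ≤ a := mul_le_of_le_one_right' hg1
  refine ⟨fun h ⟨σ, hσ, hr⟩ => (key σ hσ h hr).trans_lt hσ.2, 1, one_pos, fun h _ => ?_⟩
  rw [ENNReal.coe_one, one_mul]
  exact le_iInf fun σ => le_iInf₂ fun hσ hr => key σ hσ h hr

lemma assocNorm_rhoK_le {C : ℝ≥0}
    (hC : ∀ σ h g : ℝ → ℝ≥0∞, AntitoneOn σ (Ioo 0 T) → Represents k n Φ T σ h →
      AEMeasurable g (leb T) →
      ∫⁻ t, h t * g t ∂(leb T) ≤ C * (lorentzOn T q v σ * rhoTilde n Φ v T q g))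
    {g : ℝ → ℝ≥0∞} (hg : AEMeasurable g (leb T)) :
    assocNorm T (rhoK k n Φ T q v) g ≤ (2 * C : ℝ≥0) * rhoTilde n Φ v T q g := by
  refine assocNorm_le fun h _ hh => ?_
  -- The infimum in `rhoK` need not be attained; a representing σ of norm below 2 exists and
  -- accounts for the factor 2.
  obtain ⟨σ, h1⟩ := iInf_lt_iff.1 (hh.trans_lt ENNReal.one_lt_two)
  obtain ⟨hσ, h2⟩ := iInf_lt_iff.1 h1
  obtain ⟨hr, h3⟩ := iInf_lt_iff.1 h2
  calc ∫⁻ t, h t * g t ∂(leb T) ≤ C * (lorentzOn T q v σ * rhoTilde n Φ v T q g) :=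
        hC σ h g hσ.1 hr hg
    _ ≤ C * (2 * rhoTilde n Φ v T q g) := by gcongr
    _ = _ := by push_cast; ring

end Cone

end OptimalGBFS

theorem theorem4p1 (k n : ℕ) (hk : 1 ≤ k) (hn : 1 ≤ n) (T q : ℝ) (hT : 0 < T) (hq : 1 ≤ q)
    (Φ : ℝ → ℝ) (hΦ : IsKernelProfile n Φ)
    (v : ℝ → ℝ) (hv_meas : AEMeasurable v (volume.restrict (Ioi 0)))
    (hv_pos : ∀ t : ℝ, 0 < t → 0 < v t)
    (hV : ∀ t : ℝ, 0 < t → primV v t < ∞)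
    (hnorm : NormableWeight q v)
    (hΨ : Psi n Φ v q T < ∞)
    (hAB : CondA k n Φ v T ∨ CondB k n Φ v T q) :
    (∃ ρ₀ : (ℝ → ℝ≥0∞) → ℝ≥0∞,
      IsOptimal T (coneK k n Φ T q v) (rhoK k n Φ T q v) ρ₀) ∧
    ∀ ρ₀ : (ℝ → ℝ≥0∞) → ℝ≥0∞,
      IsOptimal T (coneK k n Φ T q v) (rhoK k n Φ T q v) ρ₀ →
      IsGBFSNorm T (assocNorm T ρ₀) ∧
      ∃ c₁ c₂ : ℝ≥0, 0 < c₁ ∧ 0 < c₂ ∧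
        ∀ g : ℝ → ℝ≥0∞, AEMeasurable g (leb T) →
          c₁ * rhoTilde n Φ v T q g ≤ assocNorm T ρ₀ g ∧
          assocNorm T ρ₀ g ≤ c₂ * rhoTilde n Φ v T q g := by
  have hv : IsWeight v := ⟨hv_meas, hv_pos, hV⟩
  obtain ⟨C, hC⟩ : ∃ C : ℝ≥0, ∀ σ h g : ℝ → ℝ≥0∞, AntitoneOn σ (Ioo 0 T) →
      Represents k n Φ T σ h → AEMeasurable g (leb T) →
      ∫⁻ t, h t * g t ∂(leb T) ≤ C * (lorentzOn T q v σ * rhoTilde n Φ v T q g) := by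
    rcases hAB with hA | hB
    · exact hA.exists_lintegral_le hv hΦ hn hT hq
    · exact hB.exists_lintegral_le hnorm hv hΦ hk hn hT hq hΨ
  obtain ⟨D, hD0, hD⟩ := hv.exists_rhoTilde_le (k := k) hΦ hn hT hq hΨ
  -- R is finite at the constant 1: the upper estimate bounds it by `rhoTilde`, which is at most T
  -- times Ψ_q(T).
  have hR : IsGBFSNorm T (assocNorm T (rhoK k n Φ T q v)) := by
    refine assocNorm_isGBFSNorm (exists_pos_rhoK_le_one hΦ hn hv hT hq)
      ⟨fun _ => 1, aemeasurable_const, Filter.Eventually.of_forall fun _ => one_pos, ?_⟩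
    refine (assocNorm_rhoK_le hC aemeasurable_const).trans_lt
      (ENNReal.mul_lt_top ENNReal.coe_lt_top ((hv.rhoTilde_le hq _).trans_lt
        (ENNReal.mul_lt_top ?_ hΨ)))
    rw [lintegral_one]
    exact measure_lt_top _ _
  have hemb := coneEmbeds_assocNorm_assocNorm (k := k) (T := T) (v := v) hΦ hn hq
  have htop : ∀ f, rhoK k n Φ T q v f < ∞ → f ∈ coneK k n Φ T q v :=
    fun f hf => mem_coneK_of_rhoK_lt_top hf
  refine ⟨⟨_, isOptimal_assocNorm_assocNorm hT hR htop hemb⟩, fun ρ₀ hρ₀ =>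
    ⟨hρ₀.isGBFS.assoc hT, ?_⟩⟩
  obtain ⟨E, hE⟩ := hρ₀.assocNorm_equiv hT hR htop hemb
  have hDE : 0 < D * (E + 1) := by positivity
  -- The constants C and E may vanish; adding 1 makes both bounds positive.
  refine ⟨(D * (E + 1))⁻¹, E * (2 * C) + 1, inv_pos.2 hDE, by positivity, fun g hg => ⟨?_, ?_⟩⟩
  · have h1 : rhoTilde n Φ v T q g ≤ (D * (E + 1) : ℝ≥0) * assocNorm T ρ₀ g := by
      calc rhoTilde n Φ v T q g ≤ D * (E * assocNorm T ρ₀ g) :=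
            (hD g hg).trans (mul_le_mul_right (hE g hg).1 _)
        _ = (D * E : ℝ≥0) * assocNorm T ρ₀ g := by push_cast; ring
        _ ≤ _ := by gcongr; exact le_self_add
    calc ((D * (E + 1))⁻¹ : ℝ≥0) * rhoTilde n Φ v T q g
        ≤ ((D * (E + 1))⁻¹ : ℝ≥0) * ((D * (E + 1) : ℝ≥0) * assocNorm T ρ₀ g) := by gcongr
      _ = assocNorm T ρ₀ g := by
          rw [← mul_assoc, ← ENNReal.coe_mul, inv_mul_cancel₀ hDE.ne', ENNReal.coe_one, one_mul]
  · calc assocNorm T ρ₀ g ≤ E * ((2 * C : ℝ≥0) * rhoTilde n Φ v T q g) :=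
          (hE g hg).2.trans (mul_le_mul_right (assocNorm_rhoK_le hC hg) _)
      _ = (E * (2 * C) : ℝ≥0) * rhoTilde n Φ v T q g := by push_cast; ring
      _ ≤ _ := by gcongr; exact le_self_add
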